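/- Let $H$ be a real Hilbert space, $A$ a positive self-adjoint operator with dense domain $D(A)\subset H$ and compact inverse, $B$ a bounded linear operator on $H$, and $\tau>0$. Let $k\in L^1_{loc}([0,+\infty))$ be real valued, with a constant $C^*$ such that $\int_{\max(t-\tau,0)}^t|k(s)|\,ds<C^*$ for all $t>0$. Let $\mu:[0,+\infty)\to[0,+\infty)$ be continuous on $[0,+\infty)$, of class $C^1$ on $(0,+\infty)$ and integrable, with $\mu(0)>0$, $\tilde\mu=\int_0^{+\infty}\mu(s)\,ds<1$ and $\mu'(s)\le-\delta_0\,\mu(s)$ for all $s>0$ and some $\delta_0>0$. Let $\psi:D(A^{1/2})\to\mathbb R$ have a linear Gâteaux derivative $D\psi(u)$ at every $u\in D(A^{1/2})$ such that: (H1) for every $u\in D(A^{1/2})$ there is $c(u)>0$ with $|D\psi(u)(v)|\le c(u)\|v\|_H$ for all $v\in D(A^{1/2})$; $\nabla\psi(u)\in H$ denotes the vector with $\langle\nabla\psi(u),v\rangle_H=D\psi(u)(v)$ for all $v\in D(A^{1/2})$; (H2) for every $r>0$ there is $L(r)>0$ with $\|\nabla\psi(u)-\nabla\psi(v)\|_H\le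 L(r)\|A^{1/2}(u-v)\|_H$ whenever $\|A^{1/2}u\|_H,\|A^{1/2}v\|_H\le r$; (H3) $\psi(0)=0$, $\nabla\psi(0)=0$, and $\|\nabla\psi(u)\|_H\le h(\|A^{1/2}u\|_H)\|A^{1/2}u\|_H$ for all $u\in D(A^{1/2})$, where $h$ is a strictly increasing continuous function on $[0,+\infty)$ with $h(0)=0$. Consider $$u_{tt}(t)+(1-\tilde\mu)Au(t)+\int_0^{+\infty}\mu(s)A\eta^t(s)\,ds+k(t)BB^*u_t(t-\tau)=\nabla\psi(u(t)),\qquad \eta^t_t(s)=-\eta^t_s(s)+u_t(t)\qquad(t,s>0),$$ with $u(0)=u_0(0)$, $u_t(0)=u_1$, $B^*u_t(t)=g(t)$ for $t\in(-\tau,0)$, and $\eta^0(s)=\eta_0(s)=u_0(0)-u_0(-s)$ for $s>0$. The phase space is $\mathcal H=D(A^{1/2})\times H\times L^2_\mu((0,+\infty);D(A^{1/2}))$ with the norm $$\|(u,v,w)\|_{\mathcal H}^2=(1-\tilde\mu)\|A^{1/2}u\|_H^2+\|v\|_H^2+\int_0^{+\infty}\mu(s)\|A^{1/2}w(s)\|_H^2\,ds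 .$$ Let $\mathcal A(u,v,w)=\bigl(v,\,-A\bigl((1-\tilde\mu)u+\int_0^{+\infty}\mu(s) w(s)\,ds\bigr),\,-w_s+v\bigr)$, with domain the set of the $(u,v,w)\in\mathcal H$ such that $v\in D(A^{1/2})$, $(1-\tilde\mu)u+\int_0^{+\infty}\mu(s) w(s)\,ds\in D(A)$, $w_s\in L^2_\mu((0,+\infty);D(A^{1/2}))$ and $w(0)=0$. Then $\mathcal A$ generates a $C_0$-semigroup $S(t)$ on $\mathcal H$, and there are $M,\omega>0$ with $$\|S(t)\|_{\mathcal L(\mathcal H)}\le Me^{-\omega t}\qquad\text{for all }t\ge0. \tag{1}$$ Let $M,\omega>0$ be any constants satisfying (1), and assume that there are $\omega'\in[0,\omega)$ and $\gamma\in\mathbb R$ with $$\|B\|^2Me^{\omega\tau}\int_0^t|k(s+\tau)|\,ds\le\gamma+\omega't\qquad\text{for all }t\ge0 .$$ A solution on a time interval $[0,T)$, $0<T\le+\infty$, is a function $U=(u,u_t,\eta)\in C([0,T);\mathcal H)$ which satisfies Duhamel's formula $$U(t)=S(t)(u_0(0),u_1,\eta_0)+\int_0^tS(t-s)\bigl(0,\,-k(s)BB^*u_t(s-\tau)+\nabla\psi(u(s)),\,0\bigr)\,ds,$$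 where $B^*u_t(s)=g(s)$ for $s<0$. Its energy is $$E(t)=\tfrac12\|u_t(t)\|_H^2+\tfrac{1-\tilde\mu}2\|A^{1/2}u(t)\|_H^2-\psi(u(t))+\tfrac12\int_{t-\tau}^t|k(s+\tau)|\,\|B^*u_t(s)\|_H^2\,ds+\tfrac12\int_0^{+\infty}\mu(s)\|A^{1/2}\eta^t(s)\|_H^2\,ds .$$ Then there exist $\delta>0$ and $\beta>0$ such that, for all initial data $u_0:(-\infty,0]\to D(A^{1/2})$ with $\eta_0\in L^2_\mu((0,+\infty);D(A^{1/2}))$, $u_1\in H$, and $g$ with $Bg\in C([-\tau,0];H)$ and $|k(\cdot+\tau)|\,\|g\|_H^2\in L^1(-\tau,0)$, which satisfy $$(1-\tilde\mu)\|A^{1/2}u_0(0)\|_H^2+\|u_1\|_H^2+\int_0^{+\infty}\mu(s)\|A^{1/2}\eta_0(s)\|_H^2\,ds+\int_0^\tau|k(s)|\,\|Bg(s-\tau)\|_H^2\,ds<\delta,$$ there is a solution defined on $[0,+\infty)$; it is unique, every solution on an interval $[0,T)$ with the same data being its restriction; and there is a constant $C$, depending on the initial data, such that $$E(t)\le Ce^{-\beta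 t}\qquad\text{for all }t\ge0 .$$ -/

import Mathlib

open MeasureTheory Set Filter Topology
open scoped ENNReal

noncomputable section

namespace ViscoDelay

universe u

/-! ### The operator `A` and its square root -/

/-- A positive self-adjoint (hence densely defined) operator `A` in the real Hilbert space `H`
which has a compact inverse `A⁻¹` defined on all of `H`. -/
structure PositiveOperator (H : Type u) [NormedAddCommGroup H] [InnerProductSpace ℝ H]
    [CompleteSpace H] where
  /-- the operator `A`, with its domain `D(A)` -/
  op : H →ₗ.[ℝ] H
  selfAdjoint : IsSelfAdjoint op
  nonneg : ∀ x : op.domain, 0 ≤ inner ℝ (op x) (x : H)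
  /-- the inverse `A⁻¹` -/
  inv : H →L[ℝ] H
  compact_inv : IsCompactOperator inv
  op_inv : ∀ f : H, ∃ hf : inv f ∈ op.domain, op ⟨inv f, hf⟩ = f
  inv_op : ∀ x : op.domain, inv (op x) = x

namespace PositiveOperator

variable {H : Type u} [NormedAddCommGroup H] [InnerProductSpace ℝ H] [CompleteSpace H]
variable (P : PositiveOperator H)

/-- The eigenspace `{x ∈ D(A) : A x = lam x}`. -/
def eigenspace (lam : ℝ) : Submodule ℝ H :=
  (LinearMap.ker (P.op.toFun - lam • P.op.domain.subtype)).map P.op.domain.subtype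

theorem mem_eigenspace {lam : ℝ} {x : H} :
    x ∈ P.eigenspace lam ↔ ∃ hx : x ∈ P.op.domain, P.op ⟨x, hx⟩ = lam • x := by
  constructor
  · rintro ⟨y, hy, rfl⟩
    refine ⟨y.2, ?_⟩
    simpa [sub_eq_zero] using hy
  · rintro ⟨hx, h⟩
    refine ⟨⟨x, hx⟩, ?_, rfl⟩
    have h' : P.op.toFun ⟨x, hx⟩ = lam • x := h
    simp [h']

theorem eigenspace_eq_ker (lam : ℝ) :
    P.eigenspace lam = (ContinuousLinearMap.id ℝ H - lam • P.inv).ker := by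
  ext x
  rw [P.mem_eigenspace]
  constructor
  · rintro ⟨hx, h⟩
    have h1 := P.inv_op ⟨x, hx⟩
    rw [h, map_smul] at h1
    simpa [sub_eq_zero] using h1.symm
  · intro h
    have h1 : x = lam • P.inv x := by simpa [sub_eq_zero] using h
    obtain ⟨hf, h2⟩ := P.op_inv x
    have hx : x ∈ P.op.domain := by
      rw [h1]; exact P.op.domain.smul_mem _ hf
    refine ⟨hx, ?_⟩
    have h3 : (⟨x, hx⟩ : P.op.domain) = lam • ⟨P.inv x, hf⟩ := Subtype.ext h1
    rw [h3, LinearPMap.map_smul, h2]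

instance (lam : ℝ) : CompleteSpace (P.eigenspace lam) := by
  rw [P.eigenspace_eq_ker lam]
  exact ContinuousLinearMap.completeSpace_ker _

/-- The orthogonal projection of `H` onto the eigenspace of `A` for `lam`. -/
def proj (lam : ℝ) : H →L[ℝ] H := (P.eigenspace lam).starProjection

/-- The square root `A^{1/2}`, given by the spectral decomposition of `A`:
`A^{1/2} x = ∑_lam lam^{1/2} P_lam x`, with domain `D(A^{1/2})` the set of the `x` for which this
series converges in `H`. Its terms are mutually orthogonal, so this is the condition
`∑_lam lam ‖P_lam x‖² < ∞`; all but countably many terms vanish, since `A` has compact inverse. -/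
def sqrtOp : H →ₗ.[ℝ] H where
  domain :=
    { carrier := {x | Summable fun lam : ℝ => Real.sqrt lam • P.proj lam x}
      add_mem' := fun {x y} hx hy => by
        simpa only [mem_ofPred_eq, map_add, smul_add] using Summable.add hx hy
      zero_mem' := by simp
      smul_mem' := fun c x hx => by
        simpa only [mem_ofPred_eq, map_smul, smul_comm c] using Summable.const_smul c hx }
  toFun :=
    { toFun := fun x => ∑' lam : ℝ, Real.sqrt lam • P.proj lam (x : H)
      map_add' := fun x y => by
        rw [← Summable.tsum_add x.2 y.2]
        simp only [Submodule.coe_add, map_add, smul_add]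
      map_smul' := fun c x => by
        rw [RingHom.id_apply, ← Summable.tsum_const_smul c x.2]
        simp only [Submodule.coe_smul, map_smul, smul_comm c] }

theorem inv_symm (f g : H) : inner ℝ (P.inv f) g = inner ℝ f (P.inv g) := by
  obtain ⟨hf, h1⟩ := P.op_inv f
  obtain ⟨hg, h2⟩ := P.op_inv g
  have hd := P.selfAdjoint.dense_domain
  have h := LinearPMap.adjoint_isFormalAdjoint hd
  rw [LinearPMap.isSelfAdjoint_def.mp P.selfAdjoint] at h
  have h3 := h ⟨P.inv f, hf⟩ ⟨P.inv g, hg⟩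
  rw [h1, h2] at h3
  exact h3.symm

theorem inv_injective : Function.Injective P.inv := by
  intro f g h
  obtain ⟨hf, h1⟩ := P.op_inv f
  obtain ⟨hg, h2⟩ := P.op_inv g
  rw [← h1, ← h2]
  congr 1
  exact Subtype.ext h

theorem inv_nonneg (f : H) : 0 ≤ inner ℝ (P.inv f) f := by
  obtain ⟨hf, h1⟩ := P.op_inv f
  have h := P.nonneg ⟨P.inv f, hf⟩
  rwa [h1, real_inner_comm] at h

/-- Eigenvectors of `A` for different eigenvalues are orthogonal. -/
theorem proj_proj_of_ne {l m : ℝ} (hlm : l ≠ m) (x : H) : P.proj l (P.proj m x) = 0 := by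
  have hm : P.proj m x ∈ P.eigenspace m := Submodule.starProjection_apply_mem _ _
  refine Submodule.eq_starProjection_of_mem_of_inner_eq_zero (Submodule.zero_mem _) ?_
  intro w hw
  obtain ⟨h1, h1'⟩ := P.mem_eigenspace.mp hm
  obtain ⟨h2, h2'⟩ := P.mem_eigenspace.mp hw
  have h := LinearPMap.adjoint_isFormalAdjoint P.selfAdjoint.dense_domain
  rw [LinearPMap.isSelfAdjoint_def.mp P.selfAdjoint] at h
  have h3 := h ⟨_, h1⟩ ⟨_, h2⟩
  rw [h1', h2', inner_smul_left, inner_smul_right] at h3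
  have h4 : (m - l) * inner ℝ (P.proj m x) w = 0 := by
    have : m * inner ℝ (P.proj m x) w = l * inner ℝ (P.proj m x) w := by simpa using h3
    linarith
  rcases mul_eq_zero.mp h4 with h5 | h5
  · exact absurd (by linarith) hlm
  · simpa using h5

theorem eq_zero_of_proj_eq_zero {x : H} (hx : ∀ l : ℝ, 0 < l → P.proj l x = 0) : x = 0 := by
  have hbot := ContinuousLinearMap.orthogonalComplement_iSup_eigenspaces_eq_bot
    (T := P.inv) P.compact_inv (fun f g => P.inv_symm f g)
  have hmem : x ∈ (⨆ κ : ℝ, Module.End.eigenspace (P.inv : Module.End ℝ H) κ)ᗮ := by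
    rw [← Submodule.iInf_orthogonal, Submodule.mem_iInf]
    intro κ
    rw [Submodule.mem_orthogonal']
    intro y hy
    have hy' : P.inv y = κ • y := by simpa using Module.End.mem_eigenspace_iff.mp hy
    by_cases hy0 : y = 0
    · simp [hy0]
    have hyn : 0 < inner ℝ y y := real_inner_self_pos.mpr hy0
    have hκ0 : κ ≠ 0 := by
      rintro rfl
      apply hy0
      apply P.inv_injective
      simpa using hy'
    have hκ : 0 ≤ κ := by
      have h := P.inv_nonneg y
      rw [hy', inner_smul_left] at h
      by_contra hneg
      push Not at hneg
      have : κ * inner ℝ y y < 0 := mul_neg_of_neg_of_pos hneg hyn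
      simp only [conj_trivial] at h
      linarith
    have hpos : 0 < κ⁻¹ := inv_pos.mpr (lt_of_le_of_ne hκ (Ne.symm hκ0))
    have hye : y ∈ P.eigenspace κ⁻¹ := by
      rw [P.eigenspace_eq_ker]
      simp [hy', smul_smul, hκ0]
    have h1 := Submodule.starProjection_inner_eq_zero (K := P.eigenspace κ⁻¹) x y hye
    have h2 : (P.eigenspace κ⁻¹).starProjection x = 0 := hx _ hpos
    rwa [h2, sub_zero] at h1
  rw [hbot] at hmem
  simpa using hmem

theorem sqrtOp_eq_zero (x : P.sqrtOp.domain) (hx : P.sqrtOp x = 0) : x = 0 := by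
  apply Subtype.ext
  apply P.eq_zero_of_proj_eq_zero
  intro l hl
  have hs : Summable fun lam : ℝ => Real.sqrt lam • P.proj lam (x : H) := x.2
  have h0 : ∑' lam : ℝ, Real.sqrt lam • P.proj lam (x : H) = 0 := hx
  have h1 := (P.proj l).map_tsum hs
  rw [h0, map_zero, tsum_eq_single l] at h1
  · have h2 : P.proj l (P.proj l (x : H)) = P.proj l (x : H) :=
      Submodule.starProjection_eq_self_iff.mpr (Submodule.starProjection_apply_mem _ _)
    rw [map_smul, h2] at h1
    exact (smul_eq_zero.mp h1.symm).resolve_left (Real.sqrt_pos.mpr hl).ne'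
  · intro m hm
    rw [map_smul, P.proj_proj_of_ne hm.symm, smul_zero]

/-- The space `D(A^{1/2})`; it carries the inner product `⟪A^{1/2} x, A^{1/2} y⟫` (see below) and
not the one inherited from `H`. -/
def FormDomain : Type u := P.sqrtOp.domain

instance : AddCommGroup P.FormDomain := inferInstanceAs (AddCommGroup P.sqrtOp.domain)

instance : Module ℝ P.FormDomain := inferInstanceAs (Module ℝ P.sqrtOp.domain)

/-- The inclusion `D(A^{1/2}) → H`. -/
def incl : P.FormDomain →ₗ[ℝ] H := P.sqrtOp.domain.subtype

/-- `A^{1/2}` as a linear map `D(A^{1/2}) → H`. -/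
def sqrt : P.FormDomain →ₗ[ℝ] H := P.sqrtOp.toFun

/-- The inner product `⟪x, y⟫ = ⟪A^{1/2} x, A^{1/2} y⟫_H` on `D(A^{1/2})`. -/
abbrev formCore : InnerProductSpace.Core ℝ P.FormDomain where
  inner x y := inner ℝ (P.sqrt x) (P.sqrt y)
  conj_inner_symm x y := by simp [real_inner_comm]
  re_inner_nonneg x := by simp
  add_left x y z := by simp [inner_add_left]
  smul_left x y r := by simp [inner_smul_left]
  definite x hx := P.sqrtOp_eq_zero x (inner_self_eq_zero.mp hx)

instance : NormedAddCommGroup P.FormDomain := P.formCore.toNormedAddCommGroup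

instance : InnerProductSpace ℝ P.FormDomain := InnerProductSpace.ofCore P.formCore.toCore

theorem inner_formDomain (x y : P.FormDomain) : inner ℝ x y = inner ℝ (P.sqrt x) (P.sqrt y) := rfl

theorem norm_formDomain (x : P.FormDomain) : ‖x‖ = ‖P.sqrt x‖ := by
  rw [norm_eq_sqrt_real_inner, norm_eq_sqrt_real_inner, P.inner_formDomain]

end PositiveOperator

/-! ### The nonlinear term -/

/-- A functional `ψ : D(A^{1/2}) → ℝ` with a (linear) Gâteaux derivative `Dψ(u)` at every
`u ∈ D(A^{1/2})`, satisfying `|Dψ(u)(v)| ≤ c(u) ‖v‖_H` for all `v ∈ D(A^{1/2})`. -/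
structure Potential {H : Type u} [NormedAddCommGroup H] [InnerProductSpace ℝ H] [CompleteSpace H]
    (P : PositiveOperator H) where
  /-- the functional `ψ` -/
  psi : P.FormDomain → ℝ
  /-- the Gâteaux derivative `Dψ` -/
  dpsi : P.FormDomain → P.FormDomain →ₗ[ℝ] ℝ
  hasLineDerivAt : ∀ u v, HasLineDerivAt ℝ psi (dpsi u v) u v
  bound : ∀ u, ∃ c > 0, ∀ v, |dpsi u v| ≤ c * ‖P.incl v‖

namespace Potential

variable {H : Type u} [NormedAddCommGroup H] [InnerProductSpace ℝ H] [CompleteSpace H]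
variable {P : PositiveOperator H} (F : Potential P)

theorem exists_gradient (u : P.FormDomain) :
    ∃ y : H, ∀ v : P.FormDomain, inner ℝ y (P.incl v) = F.dpsi u v := by
  obtain ⟨c, -, hc⟩ := F.bound u
  let f : P.sqrtOp.domain →ₗ[ℝ] ℝ := F.dpsi u
  obtain ⟨φ, hφ, -⟩ := exists_extension_norm_eq P.sqrtOp.domain (f.mkContinuous c hc)
  refine ⟨(InnerProductSpace.toDual ℝ H).symm φ, fun v => ?_⟩
  rw [InnerProductSpace.toDual_symm_apply]
  exact hφ v

/-- `∇ψ(u) ∈ H`, the vector representing `Dψ(u)`: `⟪∇ψ(u), v⟫_H = Dψ(u)(v)` for all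
`v ∈ D(A^{1/2})` (it is unique, because `D(A^{1/2})` is dense in `H`). -/
def gradient (u : P.FormDomain) : H := (F.exists_gradient u).choose

/-- `∇ψ` is Lipschitz on bounded sets from `D(A^{1/2})` to `H`. -/
def LipschitzOnBounded : Prop :=
  ∀ r > 0, ∃ L > 0, ∀ u v : P.FormDomain, ‖P.sqrt u‖ ≤ r → ‖P.sqrt v‖ ≤ r →
    ‖F.gradient u - F.gradient v‖ ≤ L * ‖P.sqrt (u - v)‖

/-- `ψ(0) = 0`, `∇ψ(0) = 0`, and `‖∇ψ(u)‖ ≤ h(‖A^{1/2} u‖) ‖A^{1/2} u‖` for a strictly increasing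
continuous function `h` on `[0, ∞)` with `h(0) = 0`. -/
def SuperlinearAtZero : Prop :=
  F.psi 0 = 0 ∧ F.gradient 0 = 0 ∧
    ∃ h : ℝ → ℝ, StrictMonoOn h (Ici 0) ∧ ContinuousOn h (Ici 0) ∧ h 0 = 0 ∧
      ∀ u, ‖F.gradient u‖ ≤ h ‖P.sqrt u‖ * ‖P.sqrt u‖

end Potential

/-! ### The memory kernel -/

/-- The assumptions on the memory kernel `μ : [0, ∞) → [0, ∞)`. -/
structure IsMemoryKernel (μ : ℝ → ℝ) : Prop where
  nonneg : ∀ s, 0 ≤ s → 0 ≤ μ s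
  continuousOn : ContinuousOn μ (Ici 0)
  contDiffOn : ContDiffOn ℝ 1 μ (Ioi 0)
  integrableOn : IntegrableOn μ (Ioi 0)
  pos_zero : 0 < μ 0
  mass_lt_one : (∫ s in Ioi 0, μ s) < 1
  decay : ∃ δ > 0, ∀ s, 0 < s → deriv μ s ≤ -δ * μ s

/-- The measure `μ(s) ds` on `(0, ∞)`. -/
def kernelMeasure (μ : ℝ → ℝ) : Measure ℝ :=
  (volume.restrict (Ioi 0)).withDensity fun s => ENNReal.ofReal (μ s)

/-! ### The system -/

/-- The data of the equation
`u_tt + A u - ∫_0^∞ μ(s) A u(t - s) ds + k(t) B B* u_t(t - τ) = ∇ψ(u)`. -/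
structure DelaySystem {H : Type u} [NormedAddCommGroup H] [InnerProductSpace ℝ H] [CompleteSpace H]
    (P : PositiveOperator H) where
  /-- the memory kernel `μ` -/
  mu : ℝ → ℝ
  /-- the delay `τ` -/
  tau : ℝ
  /-- the coefficient `k` of the delay feedback -/
  k : ℝ → ℝ
  /-- the bounded operator `B` -/
  B : H →L[ℝ] H
  /-- the functional `ψ` -/
  pot : Potential P

namespace DelaySystem

variable {H : Type u} [NormedAddCommGroup H] [InnerProductSpace ℝ H] [CompleteSpace H]
variable {P : PositiveOperator H} (Q : DelaySystem P)

/-- `μ̃ = ∫_0^∞ μ(s) ds`. -/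
def mass : ℝ := ∫ s in Ioi 0, Q.mu s

/-- The phase space `𝓗 = D(A^{1/2}) × H × L²_μ((0, ∞); D(A^{1/2}))`, with the product topology,
which is also the topology of the Hilbert norm `stateNorm` when `μ̃ < 1`. -/
abbrev State : Type u := P.FormDomain × H × Lp P.FormDomain 2 (kernelMeasure Q.mu)

/-- The inner product of `𝓗`,
`(1 - μ̃) ⟪A^{1/2} u, A^{1/2} u'⟫ + ⟪v, v'⟫ + ∫_0^∞ μ(s) ⟪A^{1/2} w(s), A^{1/2} w'(s)⟫ ds`. -/
def stateInner (U V : Q.State) : ℝ :=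
  (1 - Q.mass) * inner ℝ (P.sqrt U.1) (P.sqrt V.1) + inner ℝ U.2.1 V.2.1
    + ∫ s in Ioi 0, Q.mu s * inner ℝ (P.sqrt (U.2.2 s)) (P.sqrt (V.2.2 s))

/-- The norm of `𝓗`. -/
def stateNorm (U : Q.State) : ℝ := Real.sqrt (Q.stateInner U U)

/-- `U ∈ D(𝓐)` and `𝓐 U = W`, for `𝓐 (u, v, w) = (v, -A ((1 - μ̃) u + ∫_0^∞ μ(s) w(s) ds), v - w_s)`
with domain the `(u, v, w)` such that `v ∈ D(A^{1/2})`, `(1 - μ̃) u + ∫_0^∞ μ(s) w(s) ds ∈ D(A)`,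
`w_s ∈ L²_μ((0, ∞); D(A^{1/2}))` and `w(0) = 0`. The last two conditions say that
`w(s) = ∫_0^s z(r) dr` with `z = w_s` in `L²_μ`. -/
def IsGenerator (U W : Q.State) : Prop :=
  P.incl W.1 = U.2.1 ∧
  (∃ hU : P.incl ((1 - Q.mass) • U.1 + ∫ s in Ioi 0, Q.mu s • U.2.2 s) ∈ P.op.domain,
    W.2.1 = -P.op ⟨_, hU⟩) ∧
  ∃ z : Lp P.FormDomain 2 (kernelMeasure Q.mu),
    (∀ᵐ s ∂(kernelMeasure Q.mu), U.2.2 s = ∫ r in (0 : ℝ)..s, z r) ∧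
    ∀ᵐ s ∂(kernelMeasure Q.mu), W.2.2 s = W.1 - z s

/-- `S` (restricted to times `t ≥ 0`) is the strongly continuous semigroup on `𝓗` whose
infinitesimal generator is `𝓐`. -/
structure IsSemigroup (S : ℝ → Q.State →L[ℝ] Q.State) : Prop where
  zero : S 0 = ContinuousLinearMap.id ℝ Q.State
  add : ∀ s t, 0 ≤ s → 0 ≤ t → S (s + t) = (S s).comp (S t)
  tendsto : ∀ U, Tendsto (fun t => S t U) (𝓝[>] 0) (𝓝 U)
  generator : ∀ U W, Q.IsGenerator U W ↔ Tendsto (fun t => t⁻¹ • (S t U - U)) (𝓝[>] 0) (𝓝 W)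

/-- `‖S(t)‖ ≤ M e^{-ω t}` for all `t ≥ 0`, in the operator norm of `𝓗`. -/
def DecayBound (S : ℝ → Q.State →L[ℝ] Q.State) (M ω : ℝ) : Prop :=
  ∀ t, 0 ≤ t → ∀ U, Q.stateNorm (S t U) ≤ M * Real.exp (-ω * t) * Q.stateNorm U

/-- Initial data: the history `u₀ : (-∞, 0] → D(A^{1/2})`, with `η₀(s) = u₀(0) - u₀(-s)` in
`L²_μ((0, ∞); D(A^{1/2}))`; the velocity `u₁ ∈ H`; and the past `g` of `B* u_t` on `(-τ, 0)`, such
that `B g` is continuous on `[-τ, 0]` and `∫_{-τ}^0 |k(s + τ)| ‖g(s)‖² ds < ∞` (which is automatic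
for `g` continuous on `[-τ, 0]`). -/
structure InitialData where
  u0 : ℝ → P.FormDomain
  u1 : H
  g : ℝ → H
  memLp : MemLp (fun s => u0 0 - u0 (-s)) 2 (kernelMeasure Q.mu)
  continuousOn : ContinuousOn (fun s => Q.B (g s)) (Icc (-Q.tau) 0)
  integrableOn : IntegrableOn (fun s => |Q.k (s + Q.tau)| * ‖g s‖ ^ 2) (Ioo (-Q.tau) 0)

variable {Q} in
/-- `η₀(s) = u₀(0) - u₀(-s)`. -/
def InitialData.eta0 (d : Q.InitialData) (s : ℝ) : P.FormDomain := d.u0 0 - d.u0 (-s)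

variable {Q} in
/-- The initial state `U₀ = (u₀(0), u₁, η₀)`. -/
def InitialData.state (d : Q.InitialData) : Q.State := (d.u0 0, d.u1, d.memLp.toLp)

variable {Q} in
/-- `(1 - μ̃) ‖A^{1/2} u₀(0)‖² + ‖u₁‖² + ∫_0^∞ μ(s) ‖A^{1/2} η₀(s)‖² ds
+ ∫_0^τ |k(s)| ‖B g(s - τ)‖² ds`. -/
def InitialData.size (d : Q.InitialData) : ℝ :=
  (1 - Q.mass) * ‖P.sqrt (d.u0 0)‖ ^ 2 + ‖d.u1‖ ^ 2
    + (∫ s in Ioi 0, Q.mu s * ‖P.sqrt (d.eta0 s)‖ ^ 2)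
    + ∫ s in (0 : ℝ)..Q.tau, |Q.k s| * ‖Q.B (d.g (s - Q.tau))‖ ^ 2

/-- `B* u_t(s)`: the datum `g(s)` for `s < 0`, and `B* v(s)` for `s ≥ 0`, where `v = u_t` is the
second component of the state. -/
def feedback (d : Q.InitialData) (U : ℝ → Q.State) (s : ℝ) : H :=
  if s < 0 then d.g s else ContinuousLinearMap.adjoint Q.B (U s).2.1

/-- The inhomogeneous term `(0, -k(t) B B* u_t(t - τ) + ∇ψ(u(t)), 0)`. -/
def forcing (d : Q.InitialData) (U : ℝ → Q.State) (t : ℝ) : Q.State :=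
  (0, -(Q.k t • Q.B (Q.feedback d U (t - Q.tau))) + Q.pot.gradient (U t).1, 0)

/-- `U = (u, u_t, η)` is a mild solution, on the time interval `I` (of the form `[0, ∞)` or
`[0, T)`), of `U' = 𝓐 U + (0, -k(t) B B* u_t(t - τ) + ∇ψ(u), 0)`, `U(0) = U₀`: it is continuous
into `𝓗` and satisfies Duhamel's formula. -/
def IsMildSolution (S : ℝ → Q.State →L[ℝ] Q.State) (d : Q.InitialData) (I : Set ℝ)
    (U : ℝ → Q.State) : Prop :=
  ContinuousOn U I ∧
    ∀ t ∈ I, U t = S t d.state + ∫ s in (0 : ℝ)..t, S (t - s) (Q.forcing d U s)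

/-- The energy `E(t)` of `U = (u, u_t, η)`. -/
def energy (d : Q.InitialData) (U : ℝ → Q.State) (t : ℝ) : ℝ :=
  1 / 2 * ‖(U t).2.1‖ ^ 2 + (1 - Q.mass) / 2 * ‖P.sqrt (U t).1‖ ^ 2 - Q.pot.psi (U t).1
    + 1 / 2 * (∫ s in (t - Q.tau)..t, |Q.k (s + Q.tau)| * ‖Q.feedback d U s‖ ^ 2)
    + 1 / 2 * ∫ s in Ioi 0, Q.mu s * ‖P.sqrt ((U t).2.2 s)‖ ^ 2

end DelaySystem

end ViscoDelay

end

/-! ### The Hille–Yosida theorem for a sequence of resolvents. -/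

namespace HilleYosida

set_option linter.unusedSectionVars false

variable {X : Type*} [NormedAddCommGroup X] [NormedSpace ℝ X]

/-! The linear system is exponentially stable, and both the delay and the nonlinearity are
perturbations of Duhamel's formula that a Grönwall argument absorbs.

Linear part. Write `i` for the inclusion of `D(A^{1/2})` in `H`, `c` for the constants in `L²_μ` and
`Vol` for the primitive vanishing at `0`. Then `A⁻¹ = i i†`, the memory integral is `c†`, and the
generator becomes a relation between bounded operators (`linearGraph`). The kernel inequality `μ' ≤
-δ μ` makes the memory dissipate its own norm: `⟪z, Vol z⟫ ≥ (δ/2) ‖Vol z‖²`. This damping reaches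
the other components because `c† Vol c` is the scalar `m = ∫ s μ(s) ds > 0`: a large multiple of the
energy, corrected by the cross terms `⟪v, i c† Vol w⟫` and `⟪v, i u⟫`, is a Lyapunov form
(`exists_lyapunov`). Lax–Milgram gives the range condition, dissipativity then gives density of the
domain, and Hille–Yosida gives the stable semigroup (`linear_exists_semigroup`).

Delay. In Duhamel's formula multiplied by `e^{ωt}`, shifting the delayed term by `τ` costs a factor
`e^{ωτ}` and leaves a linear Grönwall inequality with kernel `‖B‖² M e^{ωτ} |k(s+τ)|`, plus a
contribution of the datum `g` on `[0, τ]` (`gronwall_delay`). By hypothesis the integral of this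
kernel grows at most like `γ + ω' t`, so a rate `ω - ω'` remains.

Nonlinearity. Composing `∇ψ` with the retraction on a small ball of radius `r` makes it globally
Lipschitz, so the truncated problem has a global solution, by a contraction in a weighted sup norm
(`exists_mild_solution`). It also has size at most `h(r) ‖u‖`; for small `r` this uses up only half
of `ω - ω'`. Hence for small data the truncated solution decays at rate `(ω - ω')/2` and never
leaves the ball, where the truncation does nothing (`exists_decaying_solution`). No continuation
argument is needed. Uniqueness is the same Grönwall estimate applied to a difference
(`eq_of_duhamel`), and the energy is controlled by the square of the norm plus the delay integral
(`energy_le`). -/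

theorem norm_exp_smul_le {J : X →L[ℝ] X} {M : ℝ} (hJ : ∀ k : ℕ, ‖J ^ k‖ ≤ M) {c : ℝ}
    (hc : 0 ≤ c) : ‖NormedSpace.exp (c • J)‖ ≤ M * Real.exp c := by
  rw [NormedSpace.exp_eq_tsum ℝ]
  have hs : HasSum (fun n : ℕ => (n.factorial⁻¹ : ℝ) * c ^ n * M) (Real.exp c * M) := by
    have := NormedSpace.expSeries_div_hasSum_exp (𝔸 := ℝ) c
    rw [← Real.exp_eq_exp_ℝ] at this
    refine HasSum.mul_right M ?_
    simpa [div_eq_inv_mul] using this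
  rw [mul_comm M]
  refine tsum_of_norm_bounded hs fun n => ?_
  rw [smul_pow, norm_smul, norm_smul, norm_inv, norm_pow, Real.norm_of_nonneg hc, mul_assoc,
    RCLike.norm_natCast]
  gcongr
  exact hJ n

/-- The resolvent identity, used with the indices in both orders, shows that the commutator is
killed by `lam m - lam n`. If that number is zero the two resolvents coincide. -/
theorem resolvent_comm {G : X → X → Prop} {R : ℕ → X →L[ℝ] X} {lam : ℕ → ℝ}
    (hG : ∀ n x y, G x y ↔ R n (lam n • x - y) = x) (n m : ℕ) :
    Commute (R n) (R m) := by
  have key : ∀ n m f, R n f - R m f = (lam m - lam n) • R m (R n f) := by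
    intro n m f
    have h1 : G (R n f) (lam n • R n f - f) := (hG n _ _).mpr (by congr 1; abel)
    have h2 := (hG m _ _).mp h1
    have h3 : lam m • R n f - (lam n • R n f - f) = (lam m - lam n) • R n f + f := by
      rw [sub_smul]; abel
    rw [h3, map_add, map_smul] at h2
    nth_rw 1 [← h2]
    abel
  ext f
  change R n (R m f) = R m (R n f)
  by_cases h : lam m - lam n = 0
  · have h1 : ∀ f, R n f = R m f := fun f => by
      have := key n m f
      rwa [h, zero_smul, sub_eq_zero] at this
    simp [h1]
  · have h1 := key n m f
    have h2 := key m n f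
    have h3 : (lam m - lam n) • (R n (R m f) - R m (R n f)) = 0 := by
      rw [smul_sub, ← h1, ← neg_sub (lam n), neg_smul, ← h2]; abel
    exact sub_eq_zero.mp ((smul_eq_zero.mp h3).resolve_left h)

variable [CompleteSpace X]

/-- The Yosida approximation `lam (lam R - 1)` of a generator with resolvent `R` at `lam`. -/
noncomputable def yosida (lam : ℝ) (R : X →L[ℝ] X) : X →L[ℝ] X := lam • (lam • R - 1)

/-- The scalar part `-lam` of the Yosida approximation splits off as `e^{-t lam}`, which exactly
cancels the growth `e^{t lam}` of the exponential of `t lam (lam R)`. -/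
theorem norm_exp_yosida_le {R : X →L[ℝ] X} {lam M : ℝ} (hlam : 0 < lam)
    (hM : ∀ k : ℕ, ‖(lam • R) ^ k‖ ≤ M) {t : ℝ} (ht : 0 ≤ t) :
    ‖NormedSpace.exp (t • yosida lam R)‖ ≤ M := by
  have h1 : t • yosida lam R
      = (t * lam) • (lam • R) + algebraMap ℝ (X →L[ℝ] X) (-(t * lam)) := by
    rw [yosida, Algebra.algebraMap_eq_smul_one]
    module
  have hM0 : 0 ≤ M := (norm_nonneg _).trans (hM 0)
  let : NormedAlgebra ℚ (X →L[ℝ] X) := .restrictScalars ℚ ℝ _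
  rw [h1, NormedSpace.exp_add_of_commute (Algebra.commutes _ _).symm,
    ← NormedSpace.algebraMap_exp_comm, ← Real.exp_eq_exp_ℝ, Algebra.algebraMap_eq_smul_one,
    mul_smul_comm, mul_one, norm_smul, Real.norm_of_nonneg (Real.exp_pos _).le]
  calc _ ≤ Real.exp (-(t * lam)) * (M * Real.exp (t * lam)) := by
        gcongr
        exact norm_exp_smul_le hM (by positivity)
    _ = M := by
        rw [mul_left_comm, ← Real.exp_add]; simp

/-- The path `s ↦ e^{sA} e^{(t-s)B} x` joins the two exponentials. As `A` and `B` commute, its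
derivative is `e^{sA} e^{(t-s)B} (A x - B x)`, and the mean value inequality applies. -/
theorem norm_exp_sub_exp_le {A B : X →L[ℝ] X} (hAB : Commute A B) {M : ℝ}
    (hA : ∀ t : ℝ, 0 ≤ t → ‖NormedSpace.exp (t • A)‖ ≤ M)
    (hB : ∀ t : ℝ, 0 ≤ t → ‖NormedSpace.exp (t • B)‖ ≤ M) {t : ℝ} (ht : 0 ≤ t) (x : X) :
    ‖NormedSpace.exp (t • A) x - NormedSpace.exp (t • B) x‖ ≤ M ^ 2 * ‖A x - B x‖ * t := by
  have hd : ∀ s : ℝ, HasDerivAt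
      (fun s : ℝ => (NormedSpace.exp (s • A) * NormedSpace.exp ((t - s) • B)) x)
      ((NormedSpace.exp (s • A) * NormedSpace.exp ((t - s) • B)) (A x - B x)) s := by
    intro s
    have h1 : HasDerivAt (fun s : ℝ => NormedSpace.exp (s • A)) (NormedSpace.exp (s • A) * A) s :=
      hasDerivAt_exp_smul_const A s
    have h2 : HasDerivAt (fun s : ℝ => NormedSpace.exp ((t - s) • B))
        (-(NormedSpace.exp ((t - s) • B) * B)) s := by
      have h3 : HasDerivAt (fun s : ℝ => NormedSpace.exp (s • B)) _ (t - s) :=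
        hasDerivAt_exp_smul_const B (t - s)
      have h4 := h3.scomp s ((hasDerivAt_id s).const_sub t)
      simpa [Function.comp_def] using h4
    have h5 := (h1.mul h2).clm_apply (hasDerivAt_const s x)
    have hc : Commute A (NormedSpace.exp ((t - s) • B)) :=
      (hAB.smul_right (t - s)).exp_right
    refine h5.congr_deriv ?_
    have h6 : A (NormedSpace.exp ((t - s) • B) x) = NormedSpace.exp ((t - s) • B) (A x) :=
      DFunLike.congr_fun hc.eq x
    change NormedSpace.exp (s • A) (A (NormedSpace.exp ((t - s) • B) x))
      + NormedSpace.exp (s • A) (-(NormedSpace.exp ((t - s) • B) (B x)))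
      + NormedSpace.exp (s • A) (NormedSpace.exp ((t - s) • B) 0)
      = NormedSpace.exp (s • A) (NormedSpace.exp ((t - s) • B) (A x - B x))
    rw [h6]
    simp [sub_eq_add_neg]
  have hM0 : 0 ≤ M := (norm_nonneg _).trans (hA 0 le_rfl)
  have h := norm_image_sub_le_of_norm_deriv_le_segment'
    (f := fun s : ℝ => (NormedSpace.exp (s • A) * NormedSpace.exp ((t - s) • B)) x)
    (a := 0) (b := t) (C := M ^ 2 * ‖A x - B x‖)
    (fun s _ => (hd s).hasDerivWithinAt) (fun s hs => ?_) t (right_mem_Icc.mpr ht)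
  · simpa using h
  · refine (ContinuousLinearMap.le_opNorm _ _).trans ?_
    gcongr
    refine (norm_mul_le _ _).trans ?_
    rw [sq]
    exact mul_le_mul (hA s hs.1) (hB _ (by linarith [hs.2])) (norm_nonneg _) hM0


section Generation

variable {G : X → X → Prop} {R : ℕ → X →L[ℝ] X} {lam : ℕ → ℝ} {M : ℝ}


theorem yosida_commute (hG : ∀ n x y, G x y ↔ R n (lam n • x - y) = x) (n m : ℕ) :
    Commute (yosida (lam n) (R n)) (yosida (lam m) (R m)) := by
  unfold yosida
  refine Commute.smul_left (Commute.smul_right ?_ _) _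
  refine Commute.sub_left (Commute.sub_right ?_ (Commute.one_right _)) (Commute.one_left _)
  exact Commute.smul_left (Commute.smul_right (resolvent_comm hG n m) _) _


/-- On the domain, `lam R x - x = R y` is of order `1 / lam`; the uniform bound on `lam R` carries
the limit over to the closure. -/
theorem tendsto_smul_resolvent (hpos : ∀ n, 0 < lam n) (hlam : Tendsto lam atTop atTop)
    (hG : ∀ n x y, G x y ↔ R n (lam n • x - y) = x) (hM : ∀ n, ‖lam n • R n‖ ≤ M)
    (hd : Dense {x | ∃ y, G x y}) (x : X) :
    Tendsto (fun n => lam n • R n x) atTop (𝓝 x) := by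
  have hM0 : 0 ≤ M := (norm_nonneg _).trans (hM 0)
  have hdom : ∀ x y, G x y → Tendsto (fun n => lam n • R n x) atTop (𝓝 x) := by
    intro x y hxy
    have h1 : ∀ n, lam n • R n x - x = R n y := fun n => by
      have := (hG n x y).mp hxy
      rw [map_sub, map_smul] at this
      nth_rw 2 [← this]
      abel
    rw [tendsto_iff_norm_sub_tendsto_zero]
    have h2 : Tendsto (fun n => M * ‖y‖ / lam n) atTop (𝓝 0) := hlam.const_div_atTop _
    refine squeeze_zero (fun _ => norm_nonneg _) (fun n => ?_) h2
    rw [h1, le_div_iff₀ (hpos n), mul_comm, ← Real.norm_of_nonneg (hpos n).le, ← norm_smul]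
    exact (lam n • R n).le_of_opNorm_le (hM n) y
  rw [Metric.tendsto_atTop]
  intro ε hε
  obtain ⟨x', hxx', y', hx'⟩ := Metric.dense_iff.mp hd x (ε / (2 * (M + 1))) (by positivity)
  obtain ⟨N, hN⟩ := Metric.tendsto_atTop.mp (hdom x' y' hx') (ε / 2) (by positivity)
  refine ⟨N, fun n hn => ?_⟩
  have h3 : ‖x - x'‖ < ε / (2 * (M + 1)) := by rwa [← dist_eq_norm, dist_comm]
  have h4 : (M + 1) * ‖x - x'‖ < ε / 2 := by
    rw [lt_div_iff₀ (by positivity)] at h3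
    linarith
  have h5 := hN n hn
  rw [dist_eq_norm] at h5 ⊢
  have h6 : lam n • R n x - x = (lam n • R n) (x - x') + (lam n • R n x' - x') - (x - x') := by
    simp [smul_sub]
  rw [h6]
  have h7 := (lam n • R n).le_of_opNorm_le (hM n) (x - x')
  have h8 := norm_sub_le ((lam n • R n) (x - x') + (lam n • R n x' - x')) (x - x')
  have h9 := norm_add_le ((lam n • R n) (x - x')) (lam n • R n x' - x')
  linarith

theorem tendsto_yosida (hpos : ∀ n, 0 < lam n) (hlam : Tendsto lam atTop atTop)
    (hG : ∀ n x y, G x y ↔ R n (lam n • x - y) = x) (hM : ∀ n, ‖lam n • R n‖ ≤ M)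
    (hd : Dense {x | ∃ y, G x y}) {x y : X} (hxy : G x y) :
    Tendsto (fun n => yosida (lam n) (R n) x) atTop (𝓝 y) := by
  refine (tendsto_smul_resolvent hpos hlam hG hM hd y).congr fun n => ?_
  have := (hG n x y).mp hxy
  rw [map_sub, map_smul] at this
  change lam n • R n y = lam n • (lam n • R n x - x)
  congr 1
  nth_rw 2 [← this]
  abel

theorem exists_limit (hpos : ∀ n, 0 < lam n) (hlam : Tendsto lam atTop atTop)
    (hG : ∀ n x y, G x y ↔ R n (lam n • x - y) = x) (hM : ∀ n k, ‖(lam n • R n) ^ k‖ ≤ M)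
    (hd : Dense {x | ∃ y, G x y}) {t : ℝ} (ht : 0 ≤ t) (x : X) :
    ∃ y, Tendsto (fun n => NormedSpace.exp (t • yosida (lam n) (R n)) x) atTop (𝓝 y) := by
  have hM1 : ∀ n, ‖lam n • R n‖ ≤ M := fun n => by simpa using hM n 1
  have hE : ∀ n, ∀ t : ℝ, 0 ≤ t → ‖NormedSpace.exp (t • yosida (lam n) (R n))‖ ≤ M :=
    fun n t ht => norm_exp_yosida_le (hpos n) (hM n) ht
  have hM0 : 0 ≤ M := (norm_nonneg _).trans (hM1 0)
  refine cauchySeq_tendsto_of_complete (Metric.cauchySeq_iff.mpr fun ε hε => ?_)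
  obtain ⟨x', hxx', y', hx'⟩ := Metric.dense_iff.mp hd x (ε / (4 * (M + 1))) (by positivity)
  have h3 : ‖x - x'‖ < ε / (4 * (M + 1)) := by rwa [← dist_eq_norm, dist_comm]
  have h4 : (M + 1) * ‖x - x'‖ < ε / 4 := by
    rw [lt_div_iff₀ (by positivity)] at h3
    linarith
  obtain ⟨N, hN⟩ := Metric.cauchySeq_iff.mp
    (tendsto_yosida hpos hlam hG hM1 hd hx').cauchySeq (ε / (4 * (M ^ 2 * t + 1))) (by positivity)
  refine ⟨N, fun m hm n hn => ?_⟩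
  have h5 := hN m hm n hn
  rw [dist_eq_norm, lt_div_iff₀ (by positivity)] at h5
  have h6 := norm_exp_sub_exp_le (yosida_commute hG m n) (hE m) (hE n) ht x'
  have h7 := (NormedSpace.exp (t • yosida (lam m) (R m))).le_of_opNorm_le (hE m t ht) (x - x')
  have h8 := (NormedSpace.exp (t • yosida (lam n) (R n))).le_of_opNorm_le (hE n t ht) (x - x')
  have h9 := norm_nonneg (yosida (lam m) (R m) x' - yosida (lam n) (R n) x')
  rw [dist_eq_norm]
  set a := NormedSpace.exp (t • yosida (lam m) (R m))
  set b := NormedSpace.exp (t • yosida (lam n) (R n))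
  have h10 : a x - b x = a (x - x') + (a x' - b x') - b (x - x') := by
    simp
  rw [h10]
  have h11 := norm_sub_le (a (x - x') + (a x' - b x')) (b (x - x'))
  have h12 := norm_add_le (a (x - x')) (a x' - b x')
  nlinarith [norm_nonneg (x - x')]


/-- A family of bounded operators is a strongly continuous semigroup for `t ≥ 0`, extended by
`T t = 1` for `t < 0`, with generator `G`. -/
structure IsC0Semigroup (G : X → X → Prop) (T : ℝ → X →L[ℝ] X) : Prop where
  of_nonpos : ∀ t ≤ 0, T t = 1
  add : ∀ s t, 0 ≤ s → 0 ≤ t → T (s + t) = T s * T t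
  continuous : Continuous fun p : ℝ × X => T p.1 p.2
  generator : ∀ x y, G x y ↔ Tendsto (fun t => t⁻¹ • (T t x - x)) (𝓝[>] 0) (𝓝 y)


/-- The semigroup law gives `‖T t x - T s x‖ ≤ M ‖T |t - s| x - x‖`, so continuity at `0` propagates
to all times. Joint continuity follows from the uniform bound. -/
theorem continuous_of_tendsto_zero {T : ℝ → X →L[ℝ] X} (h0 : ∀ t ≤ 0, T t = 1)
    (hadd : ∀ s t, 0 ≤ s → 0 ≤ t → T (s + t) = T s * T t) (hTM : ∀ t, ‖T t‖ ≤ M)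
    (hT : ∀ x, Tendsto (fun t => T t x) (𝓝[>] 0) (𝓝 x)) :
    Continuous fun p : ℝ × X => T p.1 p.2 := by
  have hM0 : 0 ≤ M := (norm_nonneg _).trans (hTM 0)
  have hmax : ∀ t, T t = T (max t 0) := fun t => by
    rcases le_total t 0 with h | h
    · rw [max_eq_right h, h0 t h, h0 0 le_rfl]
    · rw [max_eq_left h]
  have hle : ∀ x s t, 0 ≤ s → s ≤ t → ‖T t x - T s x‖ ≤ M * ‖T (t - s) x - x‖ := by
    intro x s t hs hst
    have h1 : T t x = T s (T (t - s) x) := by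
      rw [show T t = T (s + (t - s)) by congr 1; ring, hadd s _ hs (by linarith)]
      rfl
    rw [h1, ← map_sub]
    exact (T s).le_of_opNorm_le (hTM s) _
  have hpos : ∀ x s t, 0 ≤ s → 0 ≤ t → ‖T t x - T s x‖ ≤ M * ‖T |t - s| x - x‖ := by
    intro x s t hs ht
    rcases le_total s t with h | h
    · rw [abs_of_nonneg (by linarith)]; exact hle x s t hs h
    · rw [abs_of_nonpos (by linarith), norm_sub_rev, neg_sub]; exact hle x t s ht h
  have hT' : ∀ x, Tendsto (fun t => T t x) (𝓝 0) (𝓝 x) := by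
    intro x
    rw [← nhdsLE_sup_nhdsGT, tendsto_sup]
    refine ⟨tendsto_const_nhds.congr' ?_, hT x⟩
    filter_upwards [self_mem_nhdsWithin] with t ht
    rw [h0 t ht]; rfl
  have hcont : ∀ x, Continuous fun t => T t x := by
    intro x
    refine continuous_iff_continuousAt.mpr fun s => ?_
    have h1 : Tendsto (fun t : ℝ => |max t 0 - max s 0|) (𝓝 s) (𝓝 0) := by
      have : Continuous fun t : ℝ => |max t 0 - max s 0| := by fun_prop
      simpa using this.tendsto s
    have h2 : Tendsto (fun t : ℝ => M * ‖T |max t 0 - max s 0| x - x‖) (𝓝 s) (𝓝 0) := by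
      have h3 := (((hT' x).comp h1).sub_const x).norm.const_mul M
      simpa using h3
    rw [ContinuousAt, tendsto_iff_norm_sub_tendsto_zero]
    refine squeeze_zero (fun _ => norm_nonneg _) (fun t => ?_) h2
    rw [hmax t, hmax s]
    exact hpos x _ _ (le_max_right _ _) (le_max_right _ _)
  refine continuous_iff_continuousAt.mpr fun ⟨s, x⟩ => ?_
  rw [ContinuousAt, tendsto_iff_norm_sub_tendsto_zero]
  have h1 : Tendsto (fun p : ℝ × X => M * ‖p.2 - x‖ + ‖T p.1 x - T s x‖) (𝓝 (s, x)) (𝓝 0) := by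
    have : Continuous fun p : ℝ × X => M * ‖p.2 - x‖ + ‖T p.1 x - T s x‖ :=
      ((continuous_snd.sub continuous_const).norm.const_mul M).add
        (((hcont x).comp continuous_fst).sub continuous_const).norm
    simpa using this.tendsto (s, x)
  refine squeeze_zero (fun _ => norm_nonneg _) (fun p => ?_) h1
  have h2 : T p.1 p.2 - T s x = T p.1 (p.2 - x) + (T p.1 x - T s x) := by simp
  rw [h2]
  refine (norm_add_le _ _).trans ?_
  gcongr
  exact (T p.1).le_of_opNorm_le (hTM _) _

/-- A bounded semigroup has no eigenvector for a positive eigenvalue of its generator. -/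
theorem eq_zero_of_generator_eq_smul {T : ℝ → X →L[ℝ] X} (h0 : T 0 = 1)
    (hadd : ∀ s t, 0 ≤ s → 0 ≤ t → T (s + t) = T s * T t) (hTM : ∀ t, ‖T t‖ ≤ M)
    (hcont : ∀ x, Continuous fun t => T t x) {c : ℝ} (hc : 0 < c) {w : X}
    (hw : Tendsto (fun t => t⁻¹ • (T t w - w)) (𝓝[>] 0) (𝓝 (c • w))) : w = 0 := by
  have hder : ∀ s, 0 ≤ s → HasDerivWithinAt (fun t => T t w) (c • T s w) (Ici s) s := by
    intro s hs
    rw [hasDerivWithinAt_iff_tendsto_slope, Ici_sdiff_left]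
    have h1 : Tendsto (fun t => t - s) (𝓝[>] s) (𝓝[>] 0) := by
      refine tendsto_nhdsWithin_iff.mpr ⟨?_, ?_⟩
      · have : Tendsto (fun t => t - s) (𝓝 s) (𝓝 (s - s)) := tendsto_id.sub_const s
        rw [sub_self] at this
        exact this.mono_left nhdsWithin_le_nhds
      · filter_upwards [self_mem_nhdsWithin] with t ht
        simpa using ht
    have h2 := ((T s).continuous.tendsto _).comp (hw.comp h1)
    rw [map_smul] at h2
    refine h2.congr' ?_
    filter_upwards [self_mem_nhdsWithin] with t ht
    have h3 : T t w = T s (T (t - s) w) := by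
      rw [show T t = T (s + (t - s)) by congr 1; ring, hadd s _ hs (sub_nonneg.mpr (le_of_lt ht))]
      rfl
    simp only [Function.comp_apply, slope, vsub_eq_sub, map_smul, map_sub]
    rw [h3]
  -- The orbit solves `w' = c w`; multiplied by the integrating factor `e^{-ct}` it is constant. So
  -- `T t w = e^{ct} w`, which is unbounded unless `w = 0`.
  have hder2 : ∀ s, 0 ≤ s →
      HasDerivWithinAt (fun t => Real.exp (-c * t) • T t w) 0 (Ici s) s := by
    intro s hs
    have h1 : HasDerivAt (fun t => Real.exp (-c * t)) (Real.exp (-c * s) * (-c)) s := by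
      simpa using ((hasDerivAt_id s).const_mul (-c)).exp
    have h2 := h1.hasDerivWithinAt.smul (hder s hs)
    refine h2.congr_deriv ?_
    module
  have hconst : ∀ t, 0 ≤ t → T t w = Real.exp (c * t) • w := by
    intro t ht
    have h1 := constant_of_has_deriv_right_zero (f := fun t => Real.exp (-c * t) • T t w)
      (a := 0) (b := t)
      ((Real.continuous_exp.comp (continuous_const.mul continuous_id)).smul
        (hcont w)).continuousOn (fun s hs => hder2 s hs.1) t (right_mem_Icc.mpr ht)
    have h2 : Real.exp (-c * t) • T t w = w := by simpa [h0] using h1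
    conv_rhs => rw [← h2]
    rw [smul_smul, ← Real.exp_add]
    simp
  by_contra hne
  have hn : 0 < ‖w‖ := norm_pos_iff.mpr hne
  have hlim : Tendsto (fun t : ℝ => Real.exp (c * t)) atTop atTop :=
    Real.tendsto_exp_atTop.comp (tendsto_id.const_mul_atTop hc)
  obtain ⟨t, ht0, ht⟩ := ((eventually_ge_atTop (0 : ℝ)).and (hlim.eventually_gt_atTop M)).exists
  have h1 := (T t).le_of_opNorm_le (hTM t) w
  rw [hconst t ht0, norm_smul, Real.norm_of_nonneg (Real.exp_pos _).le] at h1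
  exact absurd (le_of_mul_le_mul_right h1 hn) (not_le.mpr ht)

theorem tendsto_exp_smul_sub (A : X →L[ℝ] X) (x : X) :
    Tendsto (fun t : ℝ => t⁻¹ • (NormedSpace.exp (t • A) x - x)) (𝓝[>] 0) (𝓝 (A x)) := by
  have h1 : HasDerivAt (fun s : ℝ => NormedSpace.exp (s • A)) _ (0 : ℝ) :=
    hasDerivAt_exp_smul_const A 0
  have h2 := (h1.clm_apply (hasDerivAt_const (0 : ℝ) x)).hasDerivWithinAt (s := Ici 0)
  rw [hasDerivWithinAt_iff_tendsto_slope, Ici_sdiff_left] at h2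
  simp only [zero_smul, NormedSpace.exp_zero, one_mul, map_zero, add_zero] at h2
  refine h2.congr fun t => ?_
  simp [slope]

/-- The Hille–Yosida generation theorem, for a sequence of resolvents. -/
theorem exists_semigroup (hpos : ∀ n, 0 < lam n) (hlam : Tendsto lam atTop atTop)
    (hG : ∀ n x y, G x y ↔ R n (lam n • x - y) = x) (hM : ∀ n k, ‖(lam n • R n) ^ k‖ ≤ M)
    (hd : Dense {x | ∃ y, G x y}) :
    ∃ T : ℝ → X →L[ℝ] X, IsC0Semigroup G T ∧ ∀ t, ‖T t‖ ≤ M := by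
  have hM1 : ∀ n, ‖lam n • R n‖ ≤ M := fun n => by simpa using hM n 1
  have hM0 : 0 ≤ M := (norm_nonneg _).trans (hM1 0)
  have hE : ∀ n, ∀ t : ℝ, 0 ≤ t → ‖NormedSpace.exp (t • yosida (lam n) (R n))‖ ≤ M :=
    fun n t ht => norm_exp_yosida_le (hpos n) (hM n) ht
  -- Using the time `max t 0` makes the limit exist for every real `t` and yields the identity for
  -- `t ≤ 0`.
  choose L hL using fun (t : ℝ) (x : X) =>
    exists_limit hpos hlam hG hM hd (le_max_right t 0) x
  let T : ℝ → X →L[ℝ] X := fun t => continuousLinearMapOfTendsto _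
    (tendsto_pi_nhds.mpr (hL t))
  have hTlim : ∀ t, 0 ≤ t → ∀ x,
      Tendsto (fun n => NormedSpace.exp (t • yosida (lam n) (R n)) x) atTop (𝓝 (T t x)) := by
    intro t ht x
    have := hL t x
    rwa [max_eq_left ht] at this
  have h0 : ∀ t ≤ 0, T t = 1 := by
    intro t ht
    ext x
    have h1 := hL t x
    simp only [max_eq_right ht, zero_smul, NormedSpace.exp_zero] at h1
    exact tendsto_nhds_unique h1 tendsto_const_nhds
  have hTM : ∀ t, ‖T t‖ ≤ M := by
    intro t
    refine ContinuousLinearMap.opNorm_le_bound _ hM0 fun x => ?_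
    refine le_of_tendsto (hL t x).norm (Eventually.of_forall fun n => ?_)
    exact ContinuousLinearMap.le_of_opNorm_le _ (hE n _ (le_max_right _ _)) x
  have hadd : ∀ s t, 0 ≤ s → 0 ≤ t → T (s + t) = T s * T t := by
    intro s t hs ht
    ext x
    refine tendsto_nhds_unique (hTlim (s + t) (by linarith) x) ?_
    change Tendsto _ _ (𝓝 (T s (T t x)))
    have h1 := hTlim s hs (T t x)
    have h2 : Tendsto (fun n => NormedSpace.exp (s • yosida (lam n) (R n))
        (NormedSpace.exp (t • yosida (lam n) (R n)) x - T t x)) atTop (𝓝 0) := by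
      have h3 := ((hTlim t ht x).sub_const (T t x)).norm.const_mul M
      rw [sub_self, norm_zero, mul_zero] at h3
      exact squeeze_zero_norm
        (fun n => ContinuousLinearMap.le_of_opNorm_le _ (hE n s hs) _) h3
    have h3 := h1.add h2
    rw [add_zero] at h3
    refine h3.congr fun n => ?_
    rw [map_sub, add_sub_cancel, add_smul]
    let : NormedAlgebra ℚ (X →L[ℝ] X) := .restrictScalars ℚ ℝ _
    rw [NormedSpace.exp_add_of_commute]
    · rfl
    · exact ((Commute.refl _).smul_left _).smul_right _
  have hgen : ∀ x y, G x y → Tendsto (fun t => t⁻¹ • (T t x - x)) (𝓝[>] 0) (𝓝 y) := by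
    intro x y hxy
    have hA := tendsto_yosida hpos hlam hG hM1 hd hxy
    -- This bound is uniform in `t`, which permits exchanging the limit in `n` with the limit `t →
    -- 0`.
    have hdiff : ∀ n t, 0 < t → ‖t⁻¹ • (T t x - x)
        - t⁻¹ • (NormedSpace.exp (t • yosida (lam n) (R n)) x - x)‖
        ≤ M ^ 2 * ‖yosida (lam n) (R n) x - y‖ := by
      intro n t ht
      rw [← smul_sub, sub_sub_sub_cancel_right, norm_smul, norm_inv, Real.norm_of_nonneg ht.le,
        inv_mul_le_iff₀ ht, norm_sub_rev, mul_comm t]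
      refine le_of_tendsto_of_tendsto ((hTlim t ht.le x).const_sub _).norm
        (((hA.const_sub _).norm.const_mul (M ^ 2)).mul_const t) (Eventually.of_forall fun m => ?_)
      exact norm_exp_sub_exp_le (yosida_commute hG n m) (hE n) (hE m) ht.le x
    rw [Metric.tendsto_nhds]
    intro ε hε
    have hε' : 0 < ε / (2 * (M ^ 2 + 1)) := by positivity
    obtain ⟨n, hn⟩ := (Metric.tendsto_nhds.mp hA _ hε').exists
    rw [dist_eq_norm, lt_div_iff₀ (by positivity)] at hn
    filter_upwards [self_mem_nhdsWithin, Metric.tendsto_nhds.mp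
      (tendsto_exp_smul_sub (yosida (lam n) (R n)) x) (ε / 2) (by positivity)] with t ht ht2
    rw [dist_eq_norm] at ht2 ⊢
    have h1 := hdiff n t ht
    set a := t⁻¹ • (T t x - x)
    set b := t⁻¹ • (NormedSpace.exp (t • yosida (lam n) (R n)) x - x)
    set z := yosida (lam n) (R n) x
    have h2 : a - y = (a - b) + (b - z) + (z - y) := by abel
    rw [h2]
    have h3 := norm_add_le (a - b + (b - z)) (z - y)
    have h4 := norm_add_le (a - b) (b - z)
    linarith
  have hzero : ∀ x, Tendsto (fun t => T t x) (𝓝[>] 0) (𝓝 x) := by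
    have hdom : ∀ x y, G x y → Tendsto (fun t => T t x) (𝓝[>] 0) (𝓝 x) := by
      intro x y hxy
      have h1 : Tendsto (fun t : ℝ => t) (𝓝[>] 0) (𝓝 0) := nhdsWithin_le_nhds
      have h2 := (h1.smul (hgen x y hxy)).add_const x
      rw [zero_smul, zero_add] at h2
      refine h2.congr' ?_
      filter_upwards [self_mem_nhdsWithin] with t ht
      rw [smul_smul, mul_inv_cancel₀ (ne_of_gt ht), one_smul, sub_add_cancel]
    intro x
    rw [Metric.tendsto_nhds]
    intro ε hε
    obtain ⟨x', hxx', y', hx'⟩ := Metric.dense_iff.mp hd x (ε / (2 * (M + 1))) (by positivity)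
    have h3 : ‖x - x'‖ < ε / (2 * (M + 1)) := by rwa [← dist_eq_norm, dist_comm]
    rw [lt_div_iff₀ (by positivity)] at h3
    filter_upwards [Metric.tendsto_nhds.mp (hdom x' y' hx') (ε / 2) (by positivity)] with t ht
    rw [dist_eq_norm] at ht ⊢
    have h6 : T t x - x = T t (x - x') + (T t x' - x') - (x - x') := by
      simp
    rw [h6]
    have h7 := (T t).le_of_opNorm_le (hTM t) (x - x')
    have h8 := norm_sub_le (T t (x - x') + (T t x' - x')) (x - x')
    have h9 := norm_add_le (T t (x - x')) (T t x' - x')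
    linarith
  have hcont := continuous_of_tendsto_zero h0 hadd hTM hzero
  refine ⟨T, ⟨h0, hadd, hcont, fun x y => ⟨hgen x y, fun hxy => ?_⟩⟩, hTM⟩
  -- The generator of `T` extends `G`. It is no larger: the resolvent supplies a point `z` of the
  -- domain of `G` such that `x - z` would be an eigenvector for the eigenvalue `lam 0 > 0`.
  set z := R 0 (lam 0 • x - y) with hz
  have h1 : G z (lam 0 • z - (lam 0 • x - y)) := (hG 0 _ _).mpr (by rw [sub_sub_cancel])
  have h2 : x - z = 0 := by
    refine eq_zero_of_generator_eq_smul (h0 0 le_rfl) hadd hTM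
      (fun x => hcont.comp (continuous_id.prodMk continuous_const)) (hpos 0) ?_
    have h3 := hxy.sub (hgen _ _ h1)
    have h4 : y - (lam 0 • z - (lam 0 • x - y)) = lam 0 • (x - z) := by
      rw [smul_sub]; abel
    rw [h4] at h3
    refine h3.congr fun t => ?_
    rw [← smul_sub, map_sub]
    congr 1
    abel
  exact (hG 0 x y).mpr (sub_eq_zero.mp h2).symm

end Generation

end HilleYosida

/-! ### Generation from dissipativity in an equivalent inner product. -/

namespace HilleYosida

variable {X : Type*} [NormedAddCommGroup X] [NormedSpace ℝ X]

/-- A subspace on whose annihilator every functional vanishes is dense. -/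
theorem dense_of_forall_dual (D : Submodule ℝ X)
    (h : ∀ f : X →L[ℝ] ℝ, (∀ x ∈ D, f x = 0) → f = 0) : Dense (D : Set X) := by
  intro x
  by_contra hx
  obtain ⟨f, u, h1, h2⟩ := geometric_hahn_banach_closed_point (E := X)
    (s := closure (D : Set X)) D.convex.closure isClosed_closure hx
  have hf : f = 0 := by
    refine h f fun y hy => ?_
    by_contra hne
    -- A functional bounded above by `u` on a subspace vanishes there: otherwise some multiple of
    -- `y` takes exactly the value `u`.
    have h3 := h1 ((u / f y) • y) (subset_closure (D.smul_mem _ hy))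
    rw [map_smul, smul_eq_mul, div_mul_cancel₀ _ hne] at h3
    exact lt_irrefl _ h3
  have h4 := h1 0 (subset_closure D.zero_mem)
  simp [hf] at h2 h4
  linarith

/-- A linear relation which is strictly dissipative for an equivalent inner product `Φ` and
satisfies the range condition generates an exponentially decaying semigroup. -/
theorem exists_semigroup_of_dissipative [CompleteSpace X] (G : Submodule ℝ (X × X))
    (Φ : LinearMap.BilinForm ℝ X) (hsymm : ∀ x y, Φ x y = Φ y x) {a b ω : ℝ} (ha : 0 < a) (hb : 0 ≤ b)
    (hlow : ∀ x, a * ‖x‖ ^ 2 ≤ Φ x x) (hup : ∀ x, Φ x x ≤ b * ‖x‖ ^ 2) (hω : 0 ≤ ω)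
    (hdiss : ∀ x y, (x, y) ∈ G → Φ y x ≤ -ω * Φ x x)
    (hrange : ∀ s : ℝ, 0 < s → ∀ f, ∃ x y, (x, y) ∈ G ∧ s • x - y = f)
    (hdense : Dense {x | ∃ y, (x, y) ∈ G}) :
    ∃ S : ℝ → X →L[ℝ] X, IsC0Semigroup (fun x y => (x, y) ∈ G) S ∧
      ∃ M, 0 < M ∧ ∀ t, 0 ≤ t → ‖S t‖ ≤ M * Real.exp (-ω * t) := by
  have hΦ0 : ∀ x, 0 ≤ Φ x x := fun x => le_trans (by positivity) (hlow x)
  -- Expanding the right side leaves `Φ y y`, which is bounded below by `0 ≤ Φ (y + ω x) (y + ω x)`.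
  -- The gain `(s + ω)²` instead of `s²` is what allows the shift by `ω` below.
  have hest : ∀ s : ℝ, 0 < s → ∀ x y, (x, y) ∈ G →
      (s + ω) ^ 2 * Φ x x ≤ Φ (s • x - y) (s • x - y) := by
    intro s hs x y hxy
    have h1 := hdiss x y hxy
    have h2 := hΦ0 (y + ω • x)
    have h3 := hΦ0 x
    simp only [map_add, map_sub, map_smul, LinearMap.add_apply, LinearMap.sub_apply,
      LinearMap.smul_apply, smul_eq_mul, hsymm x y] at h2 ⊢
    nlinarith
  have hzero : ∀ x, Φ x x ≤ 0 → x = 0 := by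
    intro x hx
    have h1 := hlow x
    have h2 : ‖x‖ ^ 2 ≤ 0 := by
      by_contra hne
      nlinarith [mul_pos ha (not_le.mp hne)]
    exact norm_eq_zero.mp (pow_eq_zero_iff (two_ne_zero) |>.mp (le_antisymm h2 (sq_nonneg _)))
  have huniq : ∀ s : ℝ, 0 < s → ∀ x y x' y', (x, y) ∈ G → (x', y') ∈ G →
      s • x - y = s • x' - y' → x = x' := by
    intro s hs x y x' y' h h' he
    have h1 := hest s hs _ _ (G.sub_mem h h')
    have h2 : s • (x - x') - (y - y') = 0 := by
      rw [smul_sub, sub_sub_sub_comm, he, sub_self]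
    rw [h2] at h1
    simp only [map_zero] at h1
    exact sub_eq_zero.mp (hzero _ (nonpos_of_mul_nonpos_right h1 (by positivity)))
  have hres : ∀ s : ℝ, 0 < s → ∃ R : X →L[ℝ] X, (∀ f, ∃ y, (R f, y) ∈ G ∧ s • R f - y = f) := by
    intro s hs
    choose r q hr hrq using hrange s hs
    let L : X →ₗ[ℝ] X :=
      { toFun := r
        map_add' := fun f g => huniq s hs _ _ _ _ (hr _) (G.add_mem (hr f) (hr g)) (by
          rw [hrq]
          change f + g = s • (r f + r g) - (q f + q g)
          rw [smul_add, add_sub_add_comm, hrq, hrq])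
        map_smul' := fun c f => huniq s hs _ _ _ _ (hr _) (G.smul_mem c (hr f)) (by
          rw [hrq]
          change c • f = s • (c • r f) - c • q f
          rw [smul_comm, ← smul_sub, hrq]) }
    refine ⟨L.mkContinuous (Real.sqrt (b / (a * (s + ω) ^ 2))) fun f => ?_, fun f =>
      ⟨q f, hr f, hrq f⟩⟩
    have h1 := hest s hs _ _ (hr f)
    rw [hrq] at h1
    have h2 := hlow (r f)
    have h3 := hup f
    refine abs_le_of_sq_le_sq' ?_ (by positivity) |>.2
    change ‖r f‖ ^ 2 ≤ _
    rw [mul_pow, Real.sq_sqrt (by positivity), div_mul_eq_mul_div, le_div_iff₀ (by positivity)]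
    nlinarith [sq_nonneg (s + ω)]
  choose R hR using fun n : ℕ => hres (n + 1) (by positivity)
  set lam : ℕ → ℝ := fun n => n + 1 + ω with hlam
  have hpos : ∀ n, 0 < lam n := fun n => by positivity
  have hcontr : ∀ n f, Φ ((lam n • R n) f) ((lam n • R n) f) ≤ Φ f f := by
    intro n f
    obtain ⟨y, h1, h2⟩ := hR n f
    have h3 := hest (n + 1) (by positivity) _ _ h1
    rw [h2] at h3
    simp only [FunLike.coe_smul, Pi.smul_apply, map_smul, LinearMap.smul_apply,
      smul_eq_mul]
    linarith
  -- Powers are bounded in the form `Φ`, where each factor is a contraction. Comparing with the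
  -- original norm then costs `√(b/a)` only once, whatever `k` is.
  have hpow : ∀ n k, ‖(lam n • R n) ^ k‖ ≤ Real.sqrt (b / a) := by
    intro n k
    have h1 : ∀ f, Φ (((lam n • R n) ^ k) f) (((lam n • R n) ^ k) f) ≤ Φ f f := by
      induction k with
      | zero => intro f; simp
      | succ k ih =>
        intro f
        rw [pow_succ]
        exact (ih _).trans (hcontr n f)
    refine ContinuousLinearMap.opNorm_le_bound _ (Real.sqrt_nonneg _) fun f => ?_
    refine abs_le_of_sq_le_sq' ?_ (by positivity) |>.2
    rw [mul_pow, Real.sq_sqrt (by positivity), div_mul_eq_mul_div, le_div_iff₀ ha, mul_comm]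
    exact (hlow _).trans ((h1 f).trans (hup f))
  -- The generator is shifted by `+ω`: the resolvent of the original at `n + 1` is that of the
  -- shifted one at `n + 1 + ω`. Its semigroup is bounded, and the factor `e^{-ωt}` undoes the
  -- shift.
  obtain ⟨T, hT, hTM⟩ := exists_semigroup (G := fun x y => (x, y - ω • x) ∈ G) (R := R)
    (lam := lam) (M := Real.sqrt (b / a)) hpos
    (tendsto_atTop_add_const_right _ _ (tendsto_atTop_add_const_right _ _
      tendsto_natCast_atTop_atTop))
    (by
      intro n x y
      obtain ⟨q, h1, h2⟩ := hR n (lam n • x - y)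
      constructor
      · intro h
        refine huniq (n + 1) (by positivity) _ _ _ _ h1 h ?_
        rw [h2, hlam]
        module
      · intro h
        rw [h] at h1 h2
        have h3 : q = y - ω • x := by
          rw [sub_eq_iff_eq_add] at h2
          have : q = ((n : ℝ) + 1) • x - (lam n • x - y) := by rw [h2]; abel
          rw [this, hlam]
          module
        rwa [← h3])
    hpow
    (by
      refine hdense.mono ?_
      rintro x ⟨y, hy⟩
      exact ⟨y + ω • x, by simpa using hy⟩)
  refine ⟨fun t => Real.exp (-ω * max t 0) • T t, ⟨?_, ?_, ?_, ?_⟩,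
    Real.sqrt (b / a) + 1, by positivity, ?_⟩
  · intro t ht
    simp [max_eq_right ht, hT.of_nonpos t ht]
  · intro s t hs ht
    rw [max_eq_left hs, max_eq_left ht, max_eq_left (add_nonneg hs ht), hT.add s t hs ht,
      smul_mul_smul_comm, ← Real.exp_add]
    ring_nf
  · have : Continuous fun p : ℝ × X => Real.exp (-ω * max p.1 0) := by fun_prop
    exact this.smul hT.continuous
  · intro x y
    have h1 := hT.generator x (y + ω • x)
    simp only [add_sub_cancel_right] at h1
    have hexp : Tendsto (fun t : ℝ => Real.exp (-ω * t)) (𝓝[>] 0) (𝓝 1) := by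
      have : Continuous fun t : ℝ => Real.exp (-ω * t) := by fun_prop
      simpa using (this.tendsto 0).mono_left nhdsWithin_le_nhds
    have hexp2 : Tendsto (fun t : ℝ => Real.exp (ω * t)) (𝓝[>] 0) (𝓝 1) := by
      have : Continuous fun t : ℝ => Real.exp (ω * t) := by fun_prop
      simpa using (this.tendsto 0).mono_left nhdsWithin_le_nhds
    have hder : ∀ c : ℝ, Tendsto (fun t : ℝ => t⁻¹ * (Real.exp (c * t) - 1)) (𝓝[>] 0) (𝓝 c) := by
      intro c
      have h2 : HasDerivAt (fun t : ℝ => Real.exp (c * t)) c 0 := by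
        simpa using ((hasDerivAt_id (0 : ℝ)).const_mul c).exp
      have h3 := h2.hasDerivWithinAt (s := Ici 0)
      rw [hasDerivWithinAt_iff_tendsto_slope, Ici_sdiff_left] at h3
      refine h3.congr fun t => ?_
      simp [slope]
    rw [h1]
    constructor
    · intro h
      have h2 := (hexp.smul h).add ((hder (-ω)).smul_const x)
      rw [one_smul, neg_smul, add_neg_cancel_right] at h2
      refine h2.congr' ?_
      filter_upwards [self_mem_nhdsWithin] with t ht
      rw [max_eq_left (le_of_lt ht), FunLike.coe_smul, Pi.smul_apply]
      module
    · intro h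
      have h2 := (hexp2.smul h).add ((hder ω).smul_const x)
      rw [one_smul] at h2
      refine h2.congr' ?_
      filter_upwards [self_mem_nhdsWithin] with t ht
      have h3 : Real.exp (ω * t) * Real.exp (-ω * t) = 1 := by
        rw [← Real.exp_add]; simp
      rw [max_eq_left (le_of_lt ht), FunLike.coe_smul, Pi.smul_apply, smul_comm,
        smul_sub, smul_smul, h3]
      module
  · intro t ht
    rw [norm_smul, max_eq_left ht, Real.norm_of_nonneg (Real.exp_pos _).le, mul_comm]
    gcongr
    linarith [hTM t]

end HilleYosida

/-! ### The abstract linear system with memory and its Lyapunov form. -/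

namespace ViscoDelay

set_option linter.unusedSectionVars false

/-- A bounded operator with `c ‖x‖² ≤ ⟪T x, x⟫` is invertible. -/
theorem exists_equiv_of_coercive {E : Type*} [NormedAddCommGroup E] [InnerProductSpace ℝ E]
    [CompleteSpace E] (T : E →L[ℝ] E) {c : ℝ} (hc : 0 < c)
    (hT : ∀ x, c * ‖x‖ ^ 2 ≤ inner ℝ (T x) x) : ∃ e : E ≃L[ℝ] E, ∀ x, e x = T x := by
  have hB : IsCoercive ((innerSL ℝ).comp T : E →L[ℝ] E →L[ℝ] ℝ) :=
    ⟨c, hc, fun x => by simpa [mul_assoc, sq] using hT x⟩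
  refine ⟨hB.continuousLinearEquivOfBilin, fun x => ?_⟩
  exact (hB.unique_continuousLinearEquivOfBilin fun w => by simp).symm

section Linear

variable {V H W : Type*} [NormedAddCommGroup V] [InnerProductSpace ℝ V] [CompleteSpace V]
  [NormedAddCommGroup H] [InnerProductSpace ℝ H] [CompleteSpace H]
  [NormedAddCommGroup W] [InnerProductSpace ℝ W] [CompleteSpace W]

open ContinuousLinearMap (adjoint)

/-- The graph of the generator `(u, v, w) ↦ (v, -A (κ u + c† w), c v - w_s)`, where `A⁻¹ = i i†` and
`Vol` is the inverse of `w ↦ w_s`. -/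
def linearGraph (κ : ℝ) (i : V →L[ℝ] H) (c : V →L[ℝ] W) (Vol : W →L[ℝ] W) :
    Submodule ℝ ((V × H × W) × (V × H × W)) where
  carrier := {p | i p.2.1 = p.1.2.1 ∧ κ • p.1.1 + adjoint c p.1.2.2 = -adjoint i p.2.2.1 ∧
    ∃ z, p.1.2.2 = Vol z ∧ p.2.2.2 = c p.2.1 - z}
  add_mem' := by
    rintro p q ⟨h1, h2, z, h3, h4⟩ ⟨h1', h2', z', h3', h4'⟩
    refine ⟨?_, ?_, z + z', ?_, ?_⟩
    · simp [h1, h1']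
    · have := congrArg₂ (· + ·) h2 h2'
      simp only [Prod.fst_add, Prod.snd_add, map_add, smul_add, neg_add] at this ⊢
      rw [← this]; abel
    · simp [h3, h3']
    · simp [h4, h4']; abel
  zero_mem' := ⟨by simp, by simp, 0, by simp, by simp⟩
  smul_mem' := by
    rintro r p ⟨h1, h2, z, h3, h4⟩
    refine ⟨by simp [h1], ?_, r • z, by simp [h3], by simp [h4, smul_sub]⟩
    have := congrArg (r • ·) h2
    simpa [smul_comm κ r] using this

variable {κ : ℝ} {i : V →L[ℝ] H} {c : V →L[ℝ] W} {Vol : W →L[ℝ] W} {d m : ℝ}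

/-- Everything can be expressed through `u'`: `u = (u' + f1) / s`, `v = i u'`, and `z = (1 + s
Vol)⁻¹ (f3 + c u')`. What remains is one equation for `u'` with the operator `κ/s + c† E c + s i†
i`, where `E = Vol (1 + s Vol)⁻¹` is monotone because `Vol` is; Lax–Milgram solves it. -/
theorem linearGraph_range (hκ : 0 < κ) (hVol : ∀ z, 0 ≤ inner ℝ z (Vol z)) {s : ℝ} (hs : 0 < s)
    (f : V × H × W) : ∃ x y, (x, y) ∈ linearGraph κ i c Vol ∧ s • x - y = f := by
  obtain ⟨e, he⟩ := exists_equiv_of_coercive (1 + s • Vol) one_pos (fun z => by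
    have h1 := mul_nonneg hs.le (hVol z)
    have h2 : inner ℝ ((1 + s • Vol) z) z = ‖z‖ ^ 2 + s * inner ℝ z (Vol z) := by
      simp [inner_add_left, inner_smul_left, real_inner_comm]
    rw [h2]; linarith)
  have he' : ∀ z, e z = z + s • Vol z := fun z => by rw [he]; simp
  have hE : ∀ y, 0 ≤ inner ℝ (Vol (e.symm y)) y := by
    intro y
    obtain ⟨z, rfl⟩ := e.surjective y
    rw [e.symm_apply_apply, he', inner_add_right, inner_smul_right, real_inner_self_eq_norm_sq,
      real_inner_comm]
    have := hVol z
    positivity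
  let E : W →L[ℝ] W := Vol.comp e.symm.toContinuousLinearMap
  obtain ⟨e2, he2⟩ := exists_equiv_of_coercive
    ((κ / s) • (1 : V →L[ℝ] V) + (adjoint c).comp (E.comp c) + s • (adjoint i).comp i)
    (c := κ / s) (by positivity) (fun v => by
      have h1 := hE (c v)
      have h2 : inner ℝ (((κ / s) • (1 : V →L[ℝ] V) + (adjoint c).comp (E.comp c)
          + s • (adjoint i).comp i) v) v
          = κ / s * ‖v‖ ^ 2 + inner ℝ (Vol (e.symm (c v))) (c v) + s * ‖i v‖ ^ 2 := by
        simp [E, inner_add_left, inner_smul_left, ContinuousLinearMap.adjoint_inner_left]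
      rw [h2]
      have : 0 ≤ s * ‖i v‖ ^ 2 := by positivity
      linarith)
  obtain ⟨f1, f2, f3⟩ := f
  set u' := e2.symm (adjoint i f2 - adjoint c (E f3) - (κ / s) • f1) with hu'
  have h1 : e2 u' = adjoint i f2 - adjoint c (E f3) - (κ / s) • f1 := by simp [hu']
  rw [he2] at h1
  simp only [add_apply, smul_apply,
    one_apply_eq_self, ContinuousLinearMap.comp_apply] at h1
  set z := e.symm (f3 + c u') with hz
  have hz1 : z + s • Vol z = f3 + c u' := by rw [← he', hz, e.apply_symm_apply]
  have hz2 : Vol z = E f3 + E (c u') := by simp [E, hz]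
  refine ⟨(s⁻¹ • (u' + f1), i u', Vol z), (u', s • i u' - f2, c u' - z), ⟨rfl, ?_, z, rfl, rfl⟩, ?_⟩
  · simp only [hz2, map_add, map_sub, map_smul, neg_sub]
    rw [smul_smul, ← div_eq_mul_inv, smul_add]
    have h2 : adjoint i f2 = (κ / s) • u' + adjoint c (E (c u')) + s • adjoint i (i u')
      + adjoint c (E f3) + (κ / s) • f1 := by rw [h1]; abel
    rw [h2]; abel
  · have h3 : s • s⁻¹ • (u' + f1) - u' = f1 := by
      rw [smul_smul, mul_inv_cancel₀ hs.ne', one_smul, add_sub_cancel_left]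
    have h4 : s • Vol z - (c u' - z) = f3 := by
      have : s • Vol z - (c u' - z) = (z + s • Vol z) - c u' := by abel
      rw [this, hz1, add_sub_cancel_right]
    simp only [Prod.smul_mk, Prod.mk_sub_mk, h3, h4, sub_sub_cancel]

/-- A functional vanishing on the domain is represented, in the weighted inner product, by some `f =
x - y` with `(x, y)` in the graph. Evaluating it at `x` itself gives `κ ‖u‖² + ‖v‖² + ‖w‖² + ⟪z, w⟫
= 0`, so `x = 0`; the injectivity assumptions then force `y = 0`. -/
theorem linearGraph_dense (hκ : 0 < κ) (hVol : ∀ z, 0 ≤ inner ℝ z (Vol z))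
    (hi : Function.Injective i) (hi' : Function.Injective (adjoint i))
    (hV : Function.Injective Vol) :
    Dense {x | ∃ y, (x, y) ∈ linearGraph κ i c Vol} := by
  have h0 := HilleYosida.dense_of_forall_dual ((linearGraph κ i c Vol).map (LinearMap.fst ℝ _ _)) ?_
  · refine h0.mono ?_
    rintro x ⟨⟨x', y⟩, h, rfl⟩
    exact ⟨y, h⟩
  intro f hf
  set a := (InnerProductSpace.toDual ℝ V).symm (f.comp (.inl ℝ V (H × W))) with ha
  set b := (InnerProductSpace.toDual ℝ H).symm
    (f.comp ((ContinuousLinearMap.inr ℝ V (H × W)).comp (.inl ℝ H W))) with hb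
  set g := (InnerProductSpace.toDual ℝ W).symm
    (f.comp ((ContinuousLinearMap.inr ℝ V (H × W)).comp (.inr ℝ H W))) with hg
  have hfe : ∀ u v w, f (u, v, w) = inner ℝ a u + inner ℝ b v + inner ℝ g w := by
    intro u v w
    rw [ha, hb, hg]
    simp only [InnerProductSpace.toDual_symm_apply]
    simp only [ContinuousLinearMap.comp_apply, ContinuousLinearMap.inl_apply,
      ContinuousLinearMap.inr_apply, ← map_add]
    simp
  obtain ⟨⟨u, v, w⟩, ⟨u', v', w'⟩, hmem, hxy⟩ := linearGraph_range (i := i) (c := c) hκ hVol one_pos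
    (κ⁻¹ • a, b, g)
  have h1 := hf (u, v, w) ⟨_, hmem, rfl⟩
  obtain ⟨e1, e2, z, e3, e4⟩ := hmem
  simp only [one_smul, Prod.mk_sub_mk, Prod.mk.injEq] at hxy e1 e2 e3 e4
  obtain ⟨x1, x2, x3⟩ := hxy
  have x1' : a = κ • (u - u') := by rw [x1, smul_smul, mul_inv_cancel₀ hκ.ne', one_smul]
  rw [hfe, x1', ← x2, ← x3, e4, ← e1] at h1
  have h2 : inner ℝ v' (i u') = -κ * inner ℝ u u' - inner ℝ w (c u') := by
    have := congrArg (fun x => inner ℝ x u') e2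
    simp only [inner_add_left, inner_smul_left, inner_neg_left,
      ContinuousLinearMap.adjoint_inner_left, conj_trivial] at this
    linarith
  have h3 := hVol z
  rw [← e3] at h3
  simp only [inner_sub_left, inner_smul_left, real_inner_self_eq_norm_sq, conj_trivial] at h1
  rw [h2, real_inner_comm u u', real_inner_comm w (c u')] at h1
  have hu : u = 0 := by
    have : ‖u‖ ^ 2 ≤ 0 := by
      by_contra hne
      nlinarith [mul_pos hκ (not_le.mp hne), sq_nonneg ‖i u'‖, sq_nonneg ‖w‖]
    simpa using le_antisymm this (sq_nonneg _)
  subst hu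
  have hκu : 0 ≤ κ * ‖(0 : V)‖ ^ 2 := by positivity
  have hv : i u' = 0 := by
    have : ‖i u'‖ ^ 2 ≤ 0 := by nlinarith [sq_nonneg ‖w‖]
    simpa using le_antisymm this (sq_nonneg _)
  have hw : w = 0 := by
    have : ‖w‖ ^ 2 ≤ 0 := by nlinarith [sq_nonneg ‖i u'‖]
    simpa using le_antisymm this (sq_nonneg _)
  have hu' : u' = 0 := hi (by rw [hv, map_zero])
  subst hw hu'
  have hv' : v' = 0 := hi' (by simpa using e2.symm)
  have hz : z = 0 := hV (by rw [← e3, map_zero])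
  refine ContinuousLinearMap.ext fun ⟨p1, p2, p3⟩ => ?_
  rw [hfe, x1', ← x2, ← x3, e4, ← e1, hv', hz]
  simp

/-- The form `N ⟪x, y⟫ - ⟪v, L w'⟫ - ⟪v', L w⟫ + ε (⟪v, i u'⟫ + ⟪v', i u⟫)`, a perturbation of a
multiple of the inner product of the energy space. -/
noncomputable def lyapunovForm (N κ ε : ℝ) (i : V →L[ℝ] H) (L : W →L[ℝ] H) :
    LinearMap.BilinForm ℝ (V × H × W) := LinearMap.mk₂ ℝ
  (fun x y => N * (κ * inner ℝ x.1 y.1 + inner ℝ x.2.1 y.2.1 + inner ℝ x.2.2 y.2.2)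
    - inner ℝ x.2.1 (L y.2.2) - inner ℝ y.2.1 (L x.2.2)
    + ε * (inner ℝ x.2.1 (i y.1) + inner ℝ y.2.1 (i x.1)))
  (by intro x x' y; simp only [Prod.fst_add, Prod.snd_add, inner_add_left, map_add,
        inner_add_right]; ring)
  (by intro r x y; simp only [Prod.smul_fst, Prod.smul_snd, inner_smul_left, map_smul,
        inner_smul_right, conj_trivial, smul_eq_mul]; ring)
  (by intro x y y'; simp only [Prod.fst_add, Prod.snd_add, inner_add_left, map_add,
        inner_add_right]; ring)
  (by intro r x y; simp only [Prod.smul_fst, Prod.smul_snd, inner_smul_left, map_smul,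
        inner_smul_right, conj_trivial, smul_eq_mul]; ring)

theorem lyapunovForm_apply (N κ ε : ℝ) (i : V →L[ℝ] H) (L : W →L[ℝ] H) (x y : V × H × W) :
    lyapunovForm N κ ε i L x y
      = N * (κ * inner ℝ x.1 y.1 + inner ℝ x.2.1 y.2.1 + inner ℝ x.2.2 y.2.2)
      - inner ℝ x.2.1 (L y.2.2) - inner ℝ y.2.1 (L x.2.2)
      + ε * (inner ℝ x.2.1 (i y.1) + inner ℝ y.2.1 (i x.1)) := rfl

theorem lyapunovForm_symm (N κ ε : ℝ) (i : V →L[ℝ] H) (L : W →L[ℝ] H) (x y : V × H × W) :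
    lyapunovForm N κ ε i L x y = lyapunovForm N κ ε i L y x := by
  rw [lyapunovForm_apply, lyapunovForm_apply, real_inner_comm x.1, real_inner_comm x.2.1 y.2.1,
    real_inner_comm x.2.2]
  ring

/-- By Young's inequality the cross terms are bounded independently of `N`, so a large `N` makes the
form equivalent to the energy. -/
theorem lyapunovForm_cross (N κ : ℝ) {ε B : ℝ} (hε : 0 ≤ ε) (hB0 : 0 ≤ B) {i : V →L[ℝ] H}
    {L : W →L[ℝ] H} (hBi : ∀ u, ‖i u‖ ≤ B * ‖u‖) (hBL : ∀ w, ‖L w‖ ≤ B * ‖w‖) (x : V × H × W) :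
    |lyapunovForm N κ ε i L x x - N * (κ * ‖x.1‖ ^ 2 + ‖x.2.1‖ ^ 2 + ‖x.2.2‖ ^ 2)|
      ≤ B * (‖x.2.1‖ ^ 2 + ‖x.2.2‖ ^ 2) + ε * B * (‖x.2.1‖ ^ 2 + ‖x.1‖ ^ 2) := by
  obtain ⟨u, v, w⟩ := x
  rw [lyapunovForm_apply]
  simp only [real_inner_self_eq_norm_sq]
  have h1 : |inner ℝ v (L w)| ≤ ‖v‖ * (B * ‖w‖) :=
    (abs_real_inner_le_norm _ _).trans (by gcongr; exact hBL w)
  have h2 : |inner ℝ v (i u)| ≤ ‖v‖ * (B * ‖u‖) :=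
    (abs_real_inner_le_norm _ _).trans (by gcongr; exact hBi u)
  have h3 : 2 * (‖v‖ * (B * ‖w‖)) ≤ B * (‖v‖ ^ 2 + ‖w‖ ^ 2) := by
    nlinarith [mul_nonneg hB0 (sq_nonneg (‖v‖ - ‖w‖))]
  have h4 : 2 * (‖v‖ * (B * ‖u‖)) ≤ B * (‖v‖ ^ 2 + ‖u‖ ^ 2) := by
    nlinarith [mul_nonneg hB0 (sq_nonneg (‖v‖ - ‖u‖))]
  generalize inner ℝ v (L w) = p at h1 ⊢
  generalize inner ℝ v (i u) = q at h2 ⊢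
  have h5 : 2 * |p| ≤ B * (‖v‖ ^ 2 + ‖w‖ ^ 2) := by linarith
  have h6 : ε * (2 * |q|) ≤ ε * (B * (‖v‖ ^ 2 + ‖u‖ ^ 2)) :=
    mul_le_mul_of_nonneg_left (by linarith) hε
  calc _ = |-(2 * p) + ε * (2 * q)| := by congr 1; ring
    _ ≤ |-(2 * p)| + |ε * (2 * q)| := abs_add_le _ _
    _ = 2 * |p| + ε * (2 * |q|) := by
      rw [abs_neg, abs_mul, abs_mul, abs_mul, abs_two, abs_of_nonneg hε]
    _ ≤ _ := by linarith

/-- The conservative terms of the energy cancel and leave `-N ⟪z, w⟫`. Since `c† Vol w' = m u' - c†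
w`, the term `-⟪v, L w'⟫` produces `-m ‖v‖²`. The last correction, with `ε = m/2`, produces `-(m/2)
κ ‖u‖²` and gives back only half of the damping of `v`. The other terms all contain `w`. -/
theorem lyapunovForm_generator (N : ℝ) (hc : ∀ v, adjoint c (Vol (c v)) = m • v)
    {u u' : V} {v v' : H} {w w' z : W} (e1 : i u' = v)
    (e2 : κ • u + adjoint c w = -adjoint i v') (e3 : w = Vol z) (e4 : w' = c u' - z) :
    lyapunovForm N κ (m / 2) i (i.comp ((adjoint c).comp Vol)) (u', v', w') (u, v, w)
      = -(N * inner ℝ z w) + κ * inner ℝ u (adjoint c (Vol w))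
      + inner ℝ (adjoint c w) (adjoint c (Vol w)) - m / 2 * ‖v‖ ^ 2 + inner ℝ v (i (adjoint c w))
      - m / 2 * κ * ‖u‖ ^ 2 - m / 2 * inner ℝ (adjoint c w) u := by
  have hv' : ∀ φ, inner ℝ v' (i φ) = -(κ * inner ℝ u φ) - inner ℝ (adjoint c w) φ := by
    intro φ
    have := congrArg (fun x => inner ℝ x φ) e2
    simp only [inner_add_left, inner_smul_left, inner_neg_left, conj_trivial,
      ContinuousLinearMap.adjoint_inner_left i] at this
    linarith
  have hKw' : adjoint c (Vol w') = m • u' - adjoint c w := by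
    simp only [e4, map_sub, e3, hc]
  have hcw : inner ℝ (c u') w = inner ℝ u' (adjoint c w) :=
    (ContinuousLinearMap.adjoint_inner_right c u' w).symm
  rw [lyapunovForm_apply]
  simp only [ContinuousLinearMap.comp_apply]
  rw [hKw', hv', hv', map_sub, map_smul, e1, inner_sub_right, inner_smul_right, ← e1, hv', e4,
    inner_sub_left, hcw, real_inner_comm u u', real_inner_comm (adjoint c w) u']
  simp only [real_inner_self_eq_norm_sq]
  ring

/-- The decay estimate, in terms of a Lyapunov form equivalent to the energy. -/
theorem exists_lyapunov (hκ : 0 < κ) (hd : 0 < d) (hm : 0 < m)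
    (hVol : ∀ z, d * ‖Vol z‖ ^ 2 ≤ inner ℝ z (Vol z))
    (hc : ∀ v, adjoint c (Vol (c v)) = m • v) :
    ∃ (Φ : LinearMap.BilinForm ℝ (V × H × W)) (a b ω : ℝ), 0 < a ∧ 0 < b ∧ 0 < ω ∧
      (∀ x y, Φ x y = Φ y x) ∧
      (∀ x, a * (‖x.1‖ ^ 2 + ‖x.2.1‖ ^ 2 + ‖x.2.2‖ ^ 2) ≤ Φ x x) ∧
      (∀ x, Φ x x ≤ b * (‖x.1‖ ^ 2 + ‖x.2.1‖ ^ 2 + ‖x.2.2‖ ^ 2)) ∧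
      ∀ x y, (x, y) ∈ linearGraph κ i c Vol → Φ y x ≤ -ω * Φ x x := by
  obtain ⟨B, hB0, hBi, hBJ, hBK, hBiJ, hBiK⟩ : ∃ B : ℝ, 0 ≤ B ∧ (∀ u, ‖i u‖ ≤ B * ‖u‖) ∧
      (∀ w, ‖adjoint c w‖ ≤ B * ‖w‖) ∧ (∀ w, ‖adjoint c (Vol w)‖ ≤ B * ‖w‖) ∧
      (∀ w, ‖i (adjoint c w)‖ ≤ B * ‖w‖) ∧ (∀ w, ‖i (adjoint c (Vol w))‖ ≤ B * ‖w‖) := by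
    have n1 := norm_nonneg i
    have n2 := norm_nonneg (adjoint c)
    have n3 := norm_nonneg ((adjoint c).comp Vol)
    have n4 := norm_nonneg (i.comp (adjoint c))
    have n5 := norm_nonneg (i.comp ((adjoint c).comp Vol))
    refine ⟨‖i‖ + ‖adjoint c‖ + ‖(adjoint c).comp Vol‖ + ‖i.comp (adjoint c)‖
      + ‖i.comp ((adjoint c).comp Vol)‖, by positivity, i.le_of_opNorm_le ?_,
      (adjoint c).le_of_opNorm_le ?_, ((adjoint c).comp Vol).le_of_opNorm_le ?_,
      (i.comp (adjoint c)).le_of_opNorm_le ?_,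
      (i.comp ((adjoint c).comp Vol)).le_of_opNorm_le ?_⟩ <;> linarith
  -- `N1` is the damping of `w` needed to absorb every term containing `w`: `B²` for the term
  -- quadratic in `w`, the two quotients for the Young remainders of its products with `u` and `v`,
  -- and `1` to spare.
  obtain ⟨N1, hN1⟩ : ∃ N1 : ℝ,
    N1 = 1 + B ^ 2 + (κ * B + m / 2 * B) ^ 2 / (m * κ) + B ^ 2 / m := ⟨_, rfl⟩
  have hN1' : 0 < N1 := by rw [hN1]; positivity
  -- The first condition secures the damping of `w`; the other two make the form at least the sum of
  -- the squares.
  obtain ⟨N, hNd, hNκ, hN1B⟩ : ∃ N : ℝ, N1 ≤ N * d ∧ 1 + m / 2 * B ≤ N * κ ∧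
      1 + B + m / 2 * B ≤ N := by
    have p1 : 0 ≤ N1 / d := by positivity
    have p2 : 0 ≤ (1 + m / 2 * B) / κ := by positivity
    have p3 : 0 ≤ 1 + B + m / 2 * B := by positivity
    refine ⟨N1 / d + (1 + m / 2 * B) / κ + (1 + B + m / 2 * B), ?_, ?_, by linarith⟩
    · rw [← div_le_iff₀ hd]; linarith
    · rw [← div_le_iff₀ hκ]; linarith
  have hN0 : 0 < N := lt_of_lt_of_le (by positivity) hN1B
  obtain ⟨Φ, hΦ⟩ : ∃ Φ, Φ = lyapunovForm N κ (m / 2) i (i.comp ((adjoint c).comp Vol)) := ⟨_, rfl⟩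
  have hcross := lyapunovForm_cross (ε := m / 2) N κ (by positivity) hB0 hBi
    (L := i.comp ((adjoint c).comp Vol)) hBiK
  rw [← hΦ] at hcross
  have hlow : ∀ x : V × H × W, 1 * (‖x.1‖ ^ 2 + ‖x.2.1‖ ^ 2 + ‖x.2.2‖ ^ 2) ≤ Φ x x := by
    intro x
    have h1 := (abs_le.mp (hcross x)).1
    have h2 := mul_le_mul_of_nonneg_right hNκ (sq_nonneg ‖x.1‖)
    have h3 := mul_le_mul_of_nonneg_right hN1B (sq_nonneg ‖x.2.1‖)
    have h4 := mul_le_mul_of_nonneg_right hN1B (sq_nonneg ‖x.2.2‖)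
    have h5 : 0 ≤ m / 2 * B * ‖x.2.2‖ ^ 2 := by positivity
    linarith
  obtain ⟨b, hb⟩ : ∃ b : ℝ, b = N * (κ + 1) + B + m / 2 * B + m / 2 * B := ⟨_, rfl⟩
  have hb0 : 0 < b := by rw [hb]; positivity
  have hup : ∀ x : V × H × W, Φ x x ≤ b * (‖x.1‖ ^ 2 + ‖x.2.1‖ ^ 2 + ‖x.2.2‖ ^ 2) := by
    intro x
    have h1 := (abs_le.mp (hcross x)).2
    have h2 : 0 ≤ (N + B + m / 2 * B) * ‖x.1‖ ^ 2 := by positivity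
    have h3 : 0 ≤ (N * κ + m / 2 * B) * ‖x.2.1‖ ^ 2 := by positivity
    have h4 : 0 ≤ (N * κ + m / 2 * B + m / 2 * B) * ‖x.2.2‖ ^ 2 := by positivity
    rw [hb]
    linarith
  -- The smallest of the three damping coefficients that survive absorption; divided by the upper
  -- constant `b` it gives the decay rate.
  obtain ⟨c0, hc0', hc1, hc2, hc3⟩ : ∃ c0 : ℝ, 0 < c0 ∧ c0 ≤ m * κ / 4 ∧ c0 ≤ m / 4 ∧ c0 ≤ 1 :=
    ⟨min (m * κ / 4) (min (m / 4) 1), by positivity, min_le_left _ _,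
      (min_le_right _ _).trans (min_le_left _ _), (min_le_right _ _).trans (min_le_right _ _)⟩
  refine ⟨Φ, 1, b, c0 / b, one_pos, hb0, by positivity, ?_, hlow, hup, ?_⟩
  · rw [hΦ]; exact lyapunovForm_symm _ _ _ _ _
  rintro ⟨u, v, w⟩ ⟨u', v', w'⟩ ⟨e1, e2, z, e3, e4⟩
  simp only at e1 e2 e3 e4
  have hzw := hVol z
  rw [← e3] at hzw
  have hmain : Φ (u', v', w') (u, v, w) = -(N * inner ℝ z w) + κ * inner ℝ u (adjoint c (Vol w))
      + inner ℝ (adjoint c w) (adjoint c (Vol w)) - m / 2 * ‖v‖ ^ 2 + inner ℝ v (i (adjoint c w))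
      - m / 2 * κ * ‖u‖ ^ 2 - m / 2 * inner ℝ (adjoint c w) u :=
    hΦ ▸ lyapunovForm_generator N hc e1 e2 e3 e4
  have b1 : inner ℝ u (adjoint c (Vol w)) ≤ ‖u‖ * (B * ‖w‖) :=
    (real_inner_le_norm _ _).trans (by gcongr; exact hBK w)
  have b2 : inner ℝ (adjoint c w) (adjoint c (Vol w)) ≤ (B * ‖w‖) * (B * ‖w‖) :=
    (real_inner_le_norm _ _).trans (by gcongr; exacts [hBJ w, hBK w])
  have b3 : inner ℝ v (i (adjoint c w)) ≤ ‖v‖ * (B * ‖w‖) :=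
    (real_inner_le_norm _ _).trans (by gcongr; exact hBiJ w)
  have b4 : -inner ℝ (adjoint c w) u ≤ (B * ‖w‖) * ‖u‖ :=
    (neg_le_abs _).trans ((abs_real_inner_le_norm _ _).trans (by gcongr; exact hBJ w))
  have y1 : (κ * B + m / 2 * B) * (‖u‖ * ‖w‖)
      ≤ m * κ / 4 * ‖u‖ ^ 2 + (κ * B + m / 2 * B) ^ 2 / (m * κ) * ‖w‖ ^ 2 := by
    have h := sq_nonneg (m * κ / 2 * ‖u‖ - (κ * B + m / 2 * B) * ‖w‖)
    have h2 : m * κ / 4 * ‖u‖ ^ 2 + (κ * B + m / 2 * B) ^ 2 / (m * κ) * ‖w‖ ^ 2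
      - (κ * B + m / 2 * B) * (‖u‖ * ‖w‖)
      = (m * κ / 2 * ‖u‖ - (κ * B + m / 2 * B) * ‖w‖) ^ 2 / (m * κ) := by
        field_simp; ring
    have h3 : 0 ≤ (m * κ / 2 * ‖u‖ - (κ * B + m / 2 * B) * ‖w‖) ^ 2 / (m * κ) := by positivity
    linarith
  have y2 : B * (‖v‖ * ‖w‖) ≤ m / 4 * ‖v‖ ^ 2 + B ^ 2 / m * ‖w‖ ^ 2 := by
    have h2 : m / 4 * ‖v‖ ^ 2 + B ^ 2 / m * ‖w‖ ^ 2 - B * (‖v‖ * ‖w‖)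
      = (m / 2 * ‖v‖ - B * ‖w‖) ^ 2 / m := by
        field_simp; ring
    have h3 : 0 ≤ (m / 2 * ‖v‖ - B * ‖w‖) ^ 2 / m := by positivity
    linarith
  have y3 : N1 * ‖w‖ ^ 2 ≤ N * inner ℝ z w := by
    calc N1 * ‖w‖ ^ 2 ≤ N * d * ‖w‖ ^ 2 := by gcongr
      _ = N * (d * ‖w‖ ^ 2) := by ring
      _ ≤ _ := by gcongr
  have hfin : Φ (u', v', w') (u, v, w)
      ≤ -(m * κ / 4 * ‖u‖ ^ 2 + m / 4 * ‖v‖ ^ 2 + 1 * ‖w‖ ^ 2) := by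
    rw [hmain]
    rw [hN1] at y3
    have c1 := mul_le_mul_of_nonneg_left b1 hκ.le
    have c4 := mul_le_mul_of_nonneg_left b4 (show 0 ≤ m / 2 by positivity)
    nlinarith
  have hup' : c0 / b * Φ (u, v, w) (u, v, w) ≤ c0 * (‖u‖ ^ 2 + ‖v‖ ^ 2 + ‖w‖ ^ 2) := by
    rw [div_mul_eq_mul_div, div_le_iff₀ hb0, mul_assoc, mul_comm _ b]
    gcongr
    exact hup (u, v, w)
  have k1 := mul_le_mul_of_nonneg_right hc1 (sq_nonneg ‖u‖)
  have k2 := mul_le_mul_of_nonneg_right hc2 (sq_nonneg ‖v‖)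
  have k3 := mul_le_mul_of_nonneg_right hc3 (sq_nonneg ‖w‖)
  linarith

/-- The linear system generates an exponentially stable semigroup. -/
theorem linear_exists_semigroup (hκ : 0 < κ) (hd : 0 < d) (hm : 0 < m)
    (hVol : ∀ z, d * ‖Vol z‖ ^ 2 ≤ inner ℝ z (Vol z))
    (hc : ∀ v, adjoint c (Vol (c v)) = m • v)
    (hi : Function.Injective i) (hi' : Function.Injective (adjoint i))
    (hV : Function.Injective Vol) :
    ∃ S : ℝ → V × H × W →L[ℝ] V × H × W,
      HilleYosida.IsC0Semigroup (fun x y => (x, y) ∈ linearGraph κ i c Vol) S ∧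
      ∃ M ω, 0 < M ∧ 0 < ω ∧ ∀ t, 0 ≤ t → ‖S t‖ ≤ M * Real.exp (-ω * t) := by
  obtain ⟨Φ, a, b, ω, ha, hb, hω, hsymm, hlow, hup, hdiss⟩ :=
    exists_lyapunov (i := i) hκ hd hm hVol hc
  have hVol' : ∀ z, 0 ≤ inner ℝ z (Vol z) := fun z => le_trans (by positivity) (hVol z)
  have hlow' : ∀ x : V × H × W, a * ‖x‖ ^ 2 ≤ Φ x x := by
    intro x
    refine le_trans ?_ (hlow x)
    gcongr
    have h1 : ‖x‖ = max ‖x.1‖ (max ‖x.2.1‖ ‖x.2.2‖) := rfl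
    have h2 := sq_nonneg ‖x.1‖
    have h3 := sq_nonneg ‖x.2.1‖
    have h4 := sq_nonneg ‖x.2.2‖
    rw [h1]
    rcases max_choice ‖x.1‖ (max ‖x.2.1‖ ‖x.2.2‖) with h | h <;> rw [h]
    · linarith
    · rcases max_choice ‖x.2.1‖ ‖x.2.2‖ with h | h <;> rw [h] <;> linarith
  have hup' : ∀ x : V × H × W, Φ x x ≤ 3 * b * ‖x‖ ^ 2 := by
    intro x
    refine (hup x).trans ?_
    have h1 : ‖x.1‖ ^ 2 ≤ ‖x‖ ^ 2 := by gcongr; exact norm_fst_le x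
    have h2 : ‖x.2.1‖ ^ 2 ≤ ‖x‖ ^ 2 := by
      gcongr; exact (norm_fst_le x.2).trans (norm_snd_le x)
    have h3 : ‖x.2.2‖ ^ 2 ≤ ‖x‖ ^ 2 := by
      gcongr; exact (norm_snd_le x.2).trans (norm_snd_le x)
    nlinarith
  obtain ⟨S, hS, M, hM, hSM⟩ := HilleYosida.exists_semigroup_of_dissipative
    (linearGraph κ i c Vol) Φ hsymm ha (b := 3 * b) (by positivity) hlow' hup'
    hω.le hdiss (fun s hs f => linearGraph_range hκ hVol' hs f)
    (linearGraph_dense hκ hVol' hi hi' hV)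
  exact ⟨S, hS, M, ω, hM, hω, hSM⟩

end Linear

end ViscoDelay

/-! ### Spectral decomposition of `A`, its square root and the form domain. -/

noncomputable section

namespace ViscoDelay

namespace PositiveOperator

universe u

variable {H : Type u} [NormedAddCommGroup H] [InnerProductSpace ℝ H] [CompleteSpace H]
variable (P : PositiveOperator H)

theorem proj_mem (l : ℝ) (x : H) : P.proj l x ∈ P.eigenspace l :=
  Submodule.starProjection_apply_mem _ _

theorem proj_proj (l : ℝ) (x : H) : P.proj l (P.proj l x) = P.proj l x :=
  Submodule.starProjection_eq_self_iff.mpr (P.proj_mem l x)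

theorem inv_eq_of_mem_eigenspace {l : ℝ} {x : H} (hx : x ∈ P.eigenspace l) :
    x = l • P.inv x := by
  rw [P.eigenspace_eq_ker] at hx
  simpa [sub_eq_zero] using hx

theorem proj_eq_zero_of_nonpos {l : ℝ} (hl : l ≤ 0) (x : H) : P.proj l x = 0 := by
  have hx := P.inv_eq_of_mem_eigenspace (P.proj_mem l x)
  have h1 := P.inv_nonneg (P.proj l x)
  have h2 : ‖P.proj l x‖ ^ 2 = l * inner ℝ (P.inv (P.proj l x)) (P.proj l x) := by
    rw [← real_inner_self_eq_norm_sq]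
    nth_rw 1 [hx]
    rw [inner_smul_left]; rfl
  have h3 : ‖P.proj l x‖ ^ 2 ≤ 0 := h2 ▸ mul_nonpos_of_nonpos_of_nonneg hl h1
  simpa using le_antisymm h3 (sq_nonneg _)

/-- The spectral gap: a nonzero eigencomponent forces `1 ≤ l ‖A⁻¹‖`. In this form the zero component
needs no separate treatment. -/
theorem norm_proj_le {l : ℝ} (hl : 0 < l) (x : H) : ‖P.proj l x‖ ≤ l * ‖P.inv‖ * ‖P.proj l x‖ := by
  have hx := P.inv_eq_of_mem_eigenspace (P.proj_mem l x)
  calc ‖P.proj l x‖ = l * ‖P.inv (P.proj l x)‖ := by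
        nth_rw 1 [hx]
        rw [norm_smul, Real.norm_of_nonneg hl.le]
    _ ≤ _ := by rw [mul_assoc]; gcongr; exact P.inv.le_opNorm _

theorem orthogonalFamily :
    OrthogonalFamily ℝ (fun l : ℝ => P.eigenspace l) fun l => (P.eigenspace l).subtypeₗᵢ := by
  intro l m hlm x y
  have h1 : P.proj l (P.proj m (y : H)) = 0 := P.proj_proj_of_ne hlm _
  have h2 : P.proj m (y : H) = y := Submodule.starProjection_eq_self_iff.mpr y.2
  have h3 := Submodule.starProjection_inner_eq_zero (K := P.eigenspace l) (y : H) (x : H) x.2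
  have h4 : (P.eigenspace l).starProjection (y : H) = 0 := by rwa [h2] at h1
  rw [h4, sub_zero, real_inner_comm] at h3
  exact h3

/-- Completeness of the eigenspaces comes from the spectral theorem for the compact symmetric
operator `A⁻¹`, through `eq_zero_of_proj_eq_zero`. -/
theorem isHilbertSum :
    IsHilbertSum ℝ (fun l : ℝ => P.eigenspace l) fun l => (P.eigenspace l).subtypeₗᵢ := by
  refine IsHilbertSum.mkInternal _ P.orthogonalFamily ?_
  rw [top_le_iff, Submodule.topologicalClosure_eq_top_iff, Submodule.eq_bot_iff]
  intro x hx
  refine P.eq_zero_of_proj_eq_zero fun l _ => ?_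
  refine Submodule.eq_starProjection_of_mem_of_inner_eq_zero (Submodule.zero_mem _) fun w hw => ?_
  rw [sub_zero]
  exact (Submodule.mem_orthogonal' _ _).mp hx w (Submodule.mem_iSup_of_mem l hw)

theorem hasSum_proj (x : H) : HasSum (fun l : ℝ => P.proj l x) x := by
  have h1 := P.isHilbertSum.hasSum_linearIsometryEquiv_symm (P.isHilbertSum.linearIsometryEquiv x)
  rw [LinearIsometryEquiv.symm_apply_apply] at h1
  set w := P.isHilbertSum.linearIsometryEquiv x
  have h2 : ∀ l, P.proj l x = w l := by
    intro l
    refine (h1.mapL (P.proj l)).unique ?_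
    convert hasSum_single l fun m hm => ?_
    · exact (Submodule.starProjection_eq_self_iff.mpr (w l).2).symm
    · have h3 : P.proj m (w m : H) = w m := Submodule.starProjection_eq_self_iff.mpr (w m).2
      change P.proj l (w m : H) = 0
      rw [← h3, P.proj_proj_of_ne hm.symm]
  simp only [h2]
  exact h1

/-- A combination `∑ c_l P_l y` of spectral projections with bounded coefficients converges. -/
theorem summable_smul_proj {c : ℝ → ℝ} {C : ℝ} (y : H)
    (hc : ∀ l, ‖c l • P.proj l y‖ ^ 2 ≤ C * ‖P.proj l y‖ ^ 2) :
    Summable fun l : ℝ => c l • P.proj l y := by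
  have h1 : Summable fun l : ℝ => ‖P.proj l y‖ ^ 2 := by
    have := (P.orthogonalFamily.summable_iff_norm_sq_summable
      (fun l => ⟨P.proj l y, P.proj_mem l y⟩)).mp (P.hasSum_proj y).summable
    exact this
  refine (P.orthogonalFamily.summable_iff_norm_sq_summable
    (fun l => ⟨c l • P.proj l y, Submodule.smul_mem _ _ (P.proj_mem l y)⟩)).mpr ?_
  exact Summable.of_nonneg_of_le (fun _ => sq_nonneg _) hc (h1.mul_left C)

theorem hasSum_inner_proj (x y : H) :
    HasSum (fun l : ℝ => inner ℝ (P.proj l x) (P.proj l y)) (inner ℝ x y) := by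
  have h1 : HasSum (fun l : ℝ => inner ℝ (P.proj l x) y) (inner ℝ x y) := by
    simpa [real_inner_comm] using (P.hasSum_proj x).mapL (innerSL ℝ y)
  have h2 : ∀ l, inner ℝ (P.proj l x) (P.proj l y) = inner ℝ (P.proj l x) y := by
    intro l
    have h3 := Submodule.starProjection_inner_eq_zero (K := P.eigenspace l) y _ (P.proj_mem l x)
    rw [inner_sub_left, sub_eq_zero, real_inner_comm] at h3
    rw [h3, real_inner_comm]
    rfl
  simp only [h2]
  exact h1

theorem proj_hasSum {c : ℝ → ℝ} {x y : H} (h : HasSum (fun l : ℝ => c l • P.proj l y) x) (l : ℝ) :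
    P.proj l x = c l • P.proj l y := by
  have h1 := h.mapL (P.proj l)
  refine h1.unique ?_
  convert hasSum_single l fun m hm => ?_
  · rw [map_smul, P.proj_proj]
  · rw [map_smul, P.proj_proj_of_ne hm.symm, smul_zero]

theorem norm_inv_sqrt_smul_proj (l : ℝ) (y : H) :
    ‖(Real.sqrt l)⁻¹ • P.proj l y‖ ^ 2 ≤ ‖P.inv‖ * ‖P.proj l y‖ ^ 2 := by
  rcases le_or_gt l 0 with hl | hl
  · simp [P.proj_eq_zero_of_nonpos hl]
  · have h1 := P.norm_proj_le hl y
    rw [norm_smul, mul_pow, norm_inv, Real.norm_of_nonneg (Real.sqrt_nonneg _), inv_pow,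
      Real.sq_sqrt hl.le, inv_mul_le_iff₀ hl]
    nlinarith [norm_nonneg (P.proj l y)]

theorem proj_sqrt (x : P.FormDomain) (l : ℝ) :
    P.proj l (P.sqrt x) = Real.sqrt l • P.proj l (P.incl x) :=
  P.proj_hasSum (Summable.hasSum (show Summable fun l : ℝ => Real.sqrt l • P.proj l (P.incl x)
    from x.2)) l

/-- The preimage of `y` is `∑ l^{-1/2} P_l y`, which converges thanks to the spectral gap. Thus
`D(A^{1/2})` is isometric to `H`, hence complete. -/
theorem sqrt_surjective : Function.Surjective P.sqrt := by
  intro y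
  obtain ⟨x, hx⟩ := P.summable_smul_proj y (P.norm_inv_sqrt_smul_proj · y)
  have h1 : ∀ l, Real.sqrt l • P.proj l x = P.proj l y := by
    intro l
    rw [P.proj_hasSum hx]
    rcases le_or_gt l 0 with hl | hl
    · simp [P.proj_eq_zero_of_nonpos hl]
    · rw [smul_smul, mul_inv_cancel₀ (Real.sqrt_pos.mpr hl).ne', one_smul]
  have h2 : HasSum (fun l : ℝ => Real.sqrt l • P.proj l x) y := by
    simpa only [h1] using P.hasSum_proj y
  exact ⟨⟨x, h2.summable⟩, h2.tsum_eq⟩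

theorem incl_injective : Function.Injective P.incl := Subtype.val_injective

/-- `A^{1/2}` as an isometric isomorphism from `D(A^{1/2})` to `H`. -/
def sqrtEquiv : P.FormDomain ≃ₗᵢ[ℝ] H :=
  LinearIsometryEquiv.ofSurjective ⟨P.sqrt, fun x => (P.norm_formDomain x).symm⟩ P.sqrt_surjective

instance : CompleteSpace P.FormDomain := P.sqrtEquiv.toIsometryEquiv.completeSpace

theorem norm_incl_le (x : P.FormDomain) : ‖P.incl x‖ ≤ Real.sqrt ‖P.inv‖ * ‖x‖ := by
  have h1 := P.hasSum_inner_proj (P.incl x) (P.incl x)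
  have h2 := (P.hasSum_inner_proj (P.sqrt x) (P.sqrt x)).mul_left ‖P.inv‖
  have h3 := hasSum_le (fun l => ?_) h1 h2
  · rw [real_inner_self_eq_norm_sq, real_inner_self_eq_norm_sq, ← P.norm_formDomain] at h3
    refine abs_le_of_sq_le_sq' ?_ (by positivity) |>.2
    rwa [mul_pow, Real.sq_sqrt (norm_nonneg _)]
  · rw [P.proj_sqrt, real_inner_self_eq_norm_sq, real_inner_self_eq_norm_sq]
    rcases le_or_gt l 0 with hl | hl
    · simp [P.proj_eq_zero_of_nonpos hl]
    · have h1 := P.norm_proj_le hl (P.incl x)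
      rw [norm_smul, mul_pow, Real.norm_of_nonneg (Real.sqrt_nonneg _), Real.sq_sqrt hl.le]
      nlinarith [norm_nonneg (P.proj l (P.incl x))]

/-- The bounded inclusion `D(A^{1/2}) → H`. -/
def inclL : P.FormDomain →L[ℝ] H := P.incl.mkContinuous _ P.norm_incl_le

theorem proj_inv (f : H) {l : ℝ} (hl : 0 < l) : P.proj l (P.inv f) = l⁻¹ • P.proj l f := by
  refine Submodule.eq_starProjection_of_mem_of_inner_eq_zero
    (Submodule.smul_mem _ _ (P.proj_mem l f)) fun w hw => ?_
  have h1 : P.inv w = l⁻¹ • w := by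
    have := P.inv_eq_of_mem_eigenspace hw
    nth_rw 2 [this]
    rw [smul_smul, inv_mul_cancel₀ hl.ne', one_smul]
  have h2 : inner ℝ (f - P.proj l f) w = 0 := Submodule.starProjection_inner_eq_zero f w hw
  rw [inner_sub_left, P.inv_symm, h1, inner_smul_right, inner_smul_left, conj_trivial, ← mul_sub,
    ← inner_sub_left, h2, mul_zero]

theorem sqrt_smul_proj_inv (f : H) (l : ℝ) :
    Real.sqrt l • P.proj l (P.inv f) = (Real.sqrt l)⁻¹ • P.proj l f := by
  rcases le_or_gt l 0 with hl | hl
  · simp [P.proj_eq_zero_of_nonpos hl]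
  · rw [P.proj_inv f hl, smul_smul]
    congr 1
    have := Real.mul_self_sqrt hl.le
    have h0 := (Real.sqrt_pos.mpr hl).ne'
    nth_rw 2 [← this]
    field_simp

/-- The adjoint of the inclusion `D(A^{1/2}) → H` is `A⁻¹`. -/
theorem incl_adjoint (f : H) : P.incl (ContinuousLinearMap.adjoint P.inclL f) = P.inv f := by
  have hs : Summable fun l : ℝ => Real.sqrt l • P.proj l (P.inv f) := by
    simp only [P.sqrt_smul_proj_inv]
    exact P.summable_smul_proj f (P.norm_inv_sqrt_smul_proj · f)
  -- `A⁻¹ f` lies in the form domain. It is compared with `i† f` by pairing with `φ` componentwise: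
  -- the weights `l^{-1/2}` from `x` and `l^{1/2}` from `φ` cancel.
  let x : P.FormDomain := ⟨P.inv f, hs⟩
  have hx : P.incl x = P.inv f := rfl
  rw [← hx]
  congr 1
  refine ext_inner_right ℝ fun φ => ?_
  rw [ContinuousLinearMap.adjoint_inner_left, P.inner_formDomain]
  refine (P.hasSum_inner_proj f (P.inclL φ)).unique ?_
  have h2 : ∀ l, inner ℝ (P.proj l (P.sqrt x)) (P.proj l (P.sqrt φ))
      = inner ℝ (P.proj l f) (P.proj l (P.inclL φ)) := by
    intro l
    rw [P.proj_sqrt, hx, P.sqrt_smul_proj_inv, P.proj_sqrt]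
    rcases le_or_gt l 0 with hl | hl
    · simp [P.proj_eq_zero_of_nonpos hl]
    · rw [inner_smul_left, inner_smul_right, ← mul_assoc, conj_trivial,
        inv_mul_cancel₀ (Real.sqrt_pos.mpr hl).ne', one_mul]
      rfl
  simpa only [h2] using P.hasSum_inner_proj (P.sqrt x) (P.sqrt φ)

end PositiveOperator

end ViscoDelay

end

/-! ### The memory kernel and the primitive operator on `L²_μ`. -/

noncomputable section

namespace ViscoDelay

section Memory

set_option linter.unusedSectionVars false

variable {μ : ℝ → ℝ} (hμ : IsMemoryKernel μ)
variable {E : Type*} [NormedAddCommGroup E] [InnerProductSpace ℝ E] [CompleteSpace E]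

include hμ

namespace IsMemoryKernel

theorem antitoneOn : AntitoneOn μ (Ici 0) := by
  refine antitoneOn_of_deriv_nonpos (convex_Ici 0) hμ.continuousOn ?_ ?_
  · rw [interior_Ici]; exact hμ.contDiffOn.differentiableOn one_ne_zero
  · rw [interior_Ici]
    obtain ⟨δ, hδ, h⟩ := hμ.decay
    intro s hs
    have := hμ.nonneg s (le_of_lt hs)
    nlinarith [h s hs]

theorem isFiniteMeasure : IsFiniteMeasure (kernelMeasure μ) :=
  isFiniteMeasure_withDensity_ofReal hμ.integrableOn.2

theorem aemeasurable : AEMeasurable (fun s => ENNReal.ofReal (μ s)) (volume.restrict (Ioi 0)) :=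
  hμ.integrableOn.aestronglyMeasurable.aemeasurable.ennreal_ofReal

theorem integral_eq (f : ℝ → E) : ∫ s, f s ∂(kernelMeasure μ) = ∫ s in Ioi 0, μ s • f s := by
  rw [kernelMeasure, integral_withDensity_eq_integral_toReal_smul₀ hμ.aemeasurable (by simp)]
  refine setIntegral_congr_fun measurableSet_Ioi fun s hs => ?_
  simp only [ENNReal.toReal_ofReal (hμ.nonneg s (le_of_lt hs))]

theorem ae_pos : ∀ᵐ s ∂(kernelMeasure μ), 0 < s ∧ 0 < μ s := by
  rw [kernelMeasure, ae_withDensity_iff' hμ.aemeasurable]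
  filter_upwards [ae_restrict_mem measurableSet_Ioi] with s hs h
  exact ⟨hs, by simpa using h⟩

/-- `μ` is nonincreasing, hence at least `μ a` on `(0, a]`. So functions in `L²_μ` are integrable on
`(0, a]` as long as `μ a > 0`, and their primitives make sense even if `μ` vanishes further on. -/
theorem restrict_le {a : ℝ} (ha : 0 < μ a) :
    volume.restrict (Ioc 0 a) ≤ ENNReal.ofReal (μ a)⁻¹ • kernelMeasure μ := by
  refine Measure.le_iff.mpr fun s hs => ?_
  rw [Measure.smul_apply, kernelMeasure, withDensity_apply _ hs, Measure.restrict_restrict hs,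
    Measure.restrict_apply hs, smul_eq_mul]
  have h1 : ENNReal.ofReal (μ a) * volume (s ∩ Ioc 0 a)
      ≤ ∫⁻ r in s ∩ Ioi 0, ENNReal.ofReal (μ r) := by
    rw [← setLIntegral_const]
    refine (setLIntegral_mono_ae' (hs.inter measurableSet_Ioc) ?_).trans
      (lintegral_mono_set (inter_subset_inter_right s Ioc_subset_Ioi_self))
    refine Eventually.of_forall fun r hr => ENNReal.ofReal_le_ofReal ?_
    exact hμ.antitoneOn (le_of_lt hr.2.1) ((le_of_lt hr.2.1).trans hr.2.2) hr.2.2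
  calc volume (s ∩ Ioc 0 a)
      = ENNReal.ofReal (μ a)⁻¹ * (ENNReal.ofReal (μ a) * volume (s ∩ Ioc 0 a)) := by
        rw [← mul_assoc, ← ENNReal.ofReal_mul (inv_nonneg.mpr ha.le), inv_mul_cancel₀ ha.ne',
          ENNReal.ofReal_one, one_mul]
    _ ≤ _ := by gcongr

theorem exists_pos : ∃ a, 0 < a ∧ 0 < μ a := by
  have h1 : Tendsto μ (𝓝[>] 0) (𝓝 (μ 0)) :=
    (hμ.continuousOn 0 self_mem_Ici).mono_left (nhdsWithin_mono _ Ioi_subset_Ici_self)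
  obtain ⟨a, h2, h3⟩ := ((h1.eventually (lt_mem_nhds hμ.pos_zero)).and self_mem_nhdsWithin).exists
  exact ⟨a, h3, h2⟩

theorem measure_ne_zero : kernelMeasure μ ≠ 0 := by
  intro h
  obtain ⟨a, ha, hμa⟩ := hμ.exists_pos
  have h1 := hμ.restrict_le hμa
  rw [h, smul_zero] at h1
  have h2 := h1 univ
  simp [ha.not_ge] at h2

theorem ae_of_ae {p : ℝ → Prop} (h : ∀ᵐ s ∂(kernelMeasure μ), p s) {a : ℝ} (ha : 0 < μ a) :
    ∀ᵐ s, s ∈ Ioc 0 a → p s := by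
  rw [← ae_restrict_iff' measurableSet_Ioc]
  exact (Measure.absolutelyContinuous_of_le (hμ.restrict_le ha)).ae_le
    ((Measure.smul_absolutelyContinuous).ae_le h)

theorem integrableOn_Ioc {z : ℝ → E} (hz : Integrable z (kernelMeasure μ)) {a : ℝ}
    (ha : 0 < μ a) : IntegrableOn z (Ioc 0 a) :=
  (hz.smul_measure ENNReal.ofReal_ne_top).mono_measure (hμ.restrict_le ha)

theorem norm_primitive_le {z : ℝ → E} (hz : Integrable z (kernelMeasure μ)) {a : ℝ}
    (ha0 : 0 ≤ a) (ha : 0 < μ a) :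
    ‖∫ r in (0 : ℝ)..a, z r‖ ≤ (μ a)⁻¹ * ∫ r, ‖z r‖ ∂(kernelMeasure μ) := by
  rw [intervalIntegral.integral_of_le ha0]
  refine (norm_integral_le_integral_norm _).trans ?_
  refine (integral_mono_measure (hμ.restrict_le ha) (Eventually.of_forall fun _ => norm_nonneg _)
    (hz.norm.smul_measure ENNReal.ofReal_ne_top)).trans ?_
  rw [integral_smul_measure, ENNReal.toReal_ofReal (inv_nonneg.mpr ha.le), smul_eq_mul]

theorem integral_norm_le :
    ∃ C : ℝ, ∀ z : Lp E 2 (kernelMeasure μ), ∫ r, ‖z r‖ ∂(kernelMeasure μ) ≤ C * ‖z‖ := by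
  have := hμ.isFiniteMeasure
  refine ⟨((kernelMeasure μ) univ ^ (1 / (1 : ℝ≥0∞).toReal - 1 / (2 : ℝ≥0∞).toReal)).toReal,
    fun z => ?_⟩
  have h1 := eLpNorm_le_eLpNorm_mul_rpow_measure_univ (p := 1) (q := 2) (μ := kernelMeasure μ)
    (by norm_num) (Lp.aestronglyMeasurable z)
  rw [integral_norm_eq_lintegral_enorm (Lp.aestronglyMeasurable z), ← eLpNorm_one_eq_lintegral_enorm,
    Lp.norm_def, mul_comm, ← ENNReal.toReal_mul]
  refine ENNReal.toReal_mono ?_ h1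
  refine ENNReal.mul_ne_top (Lp.eLpNorm_ne_top z) ?_
  exact ENNReal.rpow_ne_top_of_nonneg (by norm_num) (measure_ne_top _ _)

/-- With `w` the primitive of `φ`, `(μ ‖w‖²)' = μ' ‖w‖² + 2 μ ⟪φ, w⟫ ≤ μ (2 ⟪φ, w⟫ - δ ‖w‖²)`.
Integrating from `0`, where `w` vanishes, to `a` leaves a nonnegative boundary term at `a`; then `a
→ ∞`. -/
theorem primitive_dissipative {δ : ℝ} (hδ : ∀ s, 0 < s → deriv μ s ≤ -δ * μ s) {φ : ℝ → E}
    (hφ : Continuous φ) (hφc : HasCompactSupport φ) :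
    MemLp (fun s => ∫ r in (0 : ℝ)..s, φ r) 2 (kernelMeasure μ) ∧
    δ * ∫ s, ‖∫ r in (0 : ℝ)..s, φ r‖ ^ 2 ∂(kernelMeasure μ)
      ≤ 2 * ∫ s, inner ℝ (φ s) (∫ r in (0 : ℝ)..s, φ r) ∂(kernelMeasure μ) := by
  have := hμ.isFiniteMeasure
  set w : ℝ → E := fun s => ∫ r in (0 : ℝ)..s, φ r with hw
  have hder : ∀ s, HasDerivAt w (φ s) s := fun s =>
    intervalIntegral.integral_hasDerivAt_right (hφ.intervalIntegrable _ _)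
      (hφ.stronglyMeasurableAtFilter _ _) hφ.continuousAt
  have hwc : Continuous w := continuous_iff_continuousAt.mpr fun s => (hder s).continuousAt
  have hint : Integrable φ := hφ.integrable_of_hasCompactSupport hφc
  have hwb : ∀ s, ‖w s‖ ≤ ∫ r, ‖φ r‖ := fun s => by
    refine intervalIntegral.norm_integral_le_integral_norm_uIoc.trans ?_
    exact setIntegral_le_integral hint.norm (Eventually.of_forall fun _ => norm_nonneg _)
  obtain ⟨C, hC⟩ := hφ.bounded_above_of_compact_support hφc
  set B := ∫ r, ‖φ r‖
  have hB : 0 ≤ B := (norm_nonneg _).trans (hwb 0)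
  have hC0 : 0 ≤ C := (norm_nonneg _).trans (hC 0)
  have hwm : MemLp w 2 (kernelMeasure μ) :=
    MemLp.of_bound hwc.aestronglyMeasurable B (Eventually.of_forall hwb)
  refine ⟨hwm, ?_⟩
  set g : ℝ → ℝ := fun s => 2 * inner ℝ (φ s) (w s) - δ * ‖w s‖ ^ 2 with hg
  have hgc : Continuous g := by fun_prop
  have hgb : ∀ s, ‖g s‖ ≤ 2 * (C * B) + |δ| * B ^ 2 := by
    intro s
    refine (norm_sub_le _ _).trans ?_
    rw [norm_mul, norm_mul, Real.norm_eq_abs, Real.norm_eq_abs, Real.norm_eq_abs, abs_two,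
      Real.norm_eq_abs, abs_pow, abs_norm]
    gcongr
    · exact (abs_real_inner_le_norm _ _).trans (by gcongr; exacts [hC s, hwb s])
    · exact hwb s
  have hgi : IntegrableOn (fun s => μ s * g s) (Ioi 0) :=
    hμ.integrableOn.mul_bdd hgc.aestronglyMeasurable (Eventually.of_forall hgb)
  have hpos : ∀ a : ℝ, 0 ≤ a → 0 ≤ ∫ s in (0 : ℝ)..a, μ s * g s := by
    intro a ha
    have hcont : ContinuousOn (fun s => μ s * ‖w s‖ ^ 2) (Icc 0 a) :=
      (hμ.continuousOn.mono Icc_subset_Ici_self).mul (by fun_prop)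
    have h1 := intervalIntegral.sub_le_integral_of_hasDeriv_right_of_le ha hcont
      (g' := fun s => deriv μ s * ‖w s‖ ^ 2 + μ s * (2 * inner ℝ (w s) (φ s)))
      (φ := fun s => μ s * g s) (fun s hs => ?_)
      (((hμ.continuousOn.mono Icc_subset_Ici_self).mul hgc.continuousOn).integrableOn_Icc)
      (fun s hs => ?_)
    · have h2 : w 0 = 0 := by simp [hw]
      have h3 : 0 ≤ μ a * ‖w a‖ ^ 2 := mul_nonneg (hμ.nonneg a ha) (sq_nonneg _)
      simp only [h2, norm_zero] at h1
      linarith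
    · have h2 : HasDerivAt μ (deriv μ s) s :=
        ((hμ.contDiffOn.differentiableOn one_ne_zero).differentiableAt
          (Ioi_mem_nhds hs.1)).hasDerivAt
      exact (h2.mul (hder s).norm_sq).hasDerivWithinAt
    · have h2 := mul_le_mul_of_nonneg_right (hδ s hs.1) (sq_nonneg ‖w s‖)
      simp only [hg]
      rw [real_inner_comm (φ s) (w s)]
      nlinarith
  have hlim : 0 ≤ ∫ s in Ioi 0, μ s * g s :=
    ge_of_tendsto (intervalIntegral_tendsto_integral_Ioi 0 hgi tendsto_id)
      ((eventually_ge_atTop 0).mono hpos)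
  have h1 := hμ.integral_eq g
  simp only [smul_eq_mul] at h1
  rw [← h1] at hlim
  have i1 : Integrable (fun s => inner ℝ (φ s) (w s)) (kernelMeasure μ) :=
    (MemLp.of_bound (p := 1) (by fun_prop) (C * B) (Eventually.of_forall fun s =>
      (norm_inner_le_norm _ _).trans (by gcongr; exacts [hC s, hwb s]))).integrable le_rfl
  have i2 : Integrable (fun s => ‖w s‖ ^ 2) (kernelMeasure μ) := hwm.integrable_norm_pow (by simp)
  simp only [hg] at hlim
  rw [integral_sub (i1.const_mul 2) (i2.const_mul δ), integral_const_mul, integral_const_mul]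
    at hlim
  linarith

variable (E) in
omit hμ [CompleteSpace E] in
/-- The continuous compactly supported functions. -/
def testFunctions : Submodule ℝ (ℝ → E) where
  carrier := {φ | Continuous φ ∧ HasCompactSupport φ}
  add_mem' := fun h h' => ⟨h.1.add h'.1, h.2.add h'.2⟩
  zero_mem' := ⟨continuous_const, HasCompactSupport.zero⟩
  smul_mem' := fun c _ h => ⟨h.1.const_smul c, h.2.smul_left (f := fun _ => c)⟩

/-- The primitive `z ↦ ∫_0^s z(r) dr` on `L²_μ`. -/
theorem exists_primitive (E : Type*) [NormedAddCommGroup E] [InnerProductSpace ℝ E]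
    [CompleteSpace E] : ∃ d > 0, ∃ Vol : Lp E 2 (kernelMeasure μ) →L[ℝ] Lp E 2 (kernelMeasure μ),
      (∀ z, Vol z =ᵐ[kernelMeasure μ] fun s => ∫ r in (0 : ℝ)..s, z r) ∧
      ∀ z, d * ‖Vol z‖ ^ 2 ≤ inner ℝ z (Vol z) := by
  have := hμ.isFiniteMeasure
  obtain ⟨δ, hδ0, hδ⟩ := hμ.decay
  have hmem : ∀ φ : testFunctions E, MemLp (φ : ℝ → E) 2 (kernelMeasure μ) := fun φ =>
    φ.2.1.memLp_of_hasCompactSupport φ.2.2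
  have hprim := fun φ : testFunctions E => hμ.primitive_dissipative hδ φ.2.1 φ.2.2
  let e : testFunctions E →ₗ[ℝ] Lp E 2 (kernelMeasure μ) :=
    { toFun := fun φ => (hmem φ).toLp
      map_add' := fun φ ψ => MemLp.toLp_add (hmem φ) (hmem ψ)
      map_smul' := fun c φ => MemLp.toLp_const_smul c (hmem φ) }
  let f : testFunctions E →ₗ[ℝ] Lp E 2 (kernelMeasure μ) :=
    { toFun := fun φ => (hprim φ).1.toLp
      map_add' := fun φ ψ => by
        rw [← MemLp.toLp_add]
        refine MemLp.toLp_congr _ _ (Eventually.of_forall fun s => ?_)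
        exact intervalIntegral.integral_add (φ.2.1.intervalIntegrable _ _)
          (ψ.2.1.intervalIntegrable _ _)
      map_smul' := fun c φ => by
        rw [RingHom.id_apply, ← MemLp.toLp_const_smul]
        refine MemLp.toLp_congr _ _ (Eventually.of_forall fun s => ?_)
        exact intervalIntegral.integral_smul c _ }
  have hdense : DenseRange e := by
    intro z
    rw [Metric.mem_closure_iff]
    intro ε hε
    obtain ⟨g, hg1, hg2, hg3, hg4⟩ := (Lp.memLp z).exists_hasCompactSupport_eLpNorm_sub_le
      (ε := ENNReal.ofReal (ε / 2)) (by simp) (by simpa using hε)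
    refine ⟨e ⟨g, hg3, hg1⟩, mem_range_self _, ?_⟩
    have h1 : dist z (e ⟨g, hg3, hg1⟩) ≤ ε / 2 := by
      rw [Lp.dist_def]
      refine ENNReal.toReal_le_of_le_ofReal (by positivity) ?_
      refine (eLpNorm_congr_ae ?_).trans_le hg2
      filter_upwards [MemLp.coeFn_toLp (hmem ⟨g, hg3, hg1⟩)] with s hs
      simp only [Pi.sub_apply, e, LinearMap.coe_mk, AddHom.coe_mk, hs]
    linarith
  have hdiss : ∀ φ, δ / 2 * ‖f φ‖ ^ 2 ≤ inner ℝ (e φ) (f φ) := by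
    intro φ
    have h1 := (hprim φ).2
    rw [← real_inner_self_eq_norm_sq, L2.inner_def, L2.inner_def]
    have h2 : ∫ s, inner ℝ (e φ s) (f φ s) ∂(kernelMeasure μ)
        = ∫ s, inner ℝ ((φ : ℝ → E) s) (∫ r in (0 : ℝ)..s, (φ : ℝ → E) r) ∂(kernelMeasure μ) := by
      refine integral_congr_ae ?_
      filter_upwards [MemLp.coeFn_toLp (hmem φ), MemLp.coeFn_toLp (hprim φ).1] with s hs hs'
      simp only [e, f, LinearMap.coe_mk, AddHom.coe_mk, hs, hs']
    have h3 : ∫ s, inner ℝ (f φ s) (f φ s) ∂(kernelMeasure μ)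
        = ∫ s, ‖∫ r in (0 : ℝ)..s, (φ : ℝ → E) r‖ ^ 2 ∂(kernelMeasure μ) := by
      refine integral_congr_ae ?_
      filter_upwards [MemLp.coeFn_toLp (hprim φ).1] with s hs'
      simp only [f, LinearMap.coe_mk, AddHom.coe_mk, hs', real_inner_self_eq_norm_sq]
    rw [h2, h3]
    linarith
  have hbound : ∀ φ, ‖f φ‖ ≤ 2 / δ * ‖e φ‖ := by
    intro φ
    have h1 := (hdiss φ).trans (real_inner_le_norm _ _)
    rcases (norm_nonneg (f φ)).eq_or_lt with h | h
    · rw [← h]; positivity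
    · have h2 : δ / 2 * ‖f φ‖ ≤ ‖e φ‖ := by
        refine le_of_mul_le_mul_right ?_ h
        linarith
      rw [div_mul_eq_mul_div, le_div_iff₀ hδ0]
      linarith
  -- The dissipation inequality and Cauchy–Schwarz bound the primitive by `2/δ` in the `L²_μ` norm,
  -- so it extends from test functions by density.
  let Vol := f.extendOfNorm e
  have hVol : ∀ φ, Vol (e φ) = f φ := LinearMap.extendOfNorm_eq hdense ⟨_, hbound⟩
  refine ⟨δ / 2, by positivity, Vol, fun z => ?_, fun z => ?_⟩
  · obtain ⟨x, hx1, hx2⟩ := mem_closure_iff_seq_limit.mp (hdense z)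
    choose φ hφ using hx1
    obtain ⟨C, hC⟩ := hμ.integral_norm_le (E := E)
    have h1 : Tendsto (fun n => Vol (x n)) atTop (𝓝 (Vol z)) := (Vol.continuous.tendsto z).comp hx2
    -- To identify the extension: a subsequence of the images converges almost everywhere, while the
    -- primitives converge at each point where `μ` is positive, by `norm_primitive_le`.
    obtain ⟨ns, hns, h2⟩ := (tendstoInMeasure_of_tendsto_Lp h1).exists_seq_tendsto_ae
    have h3 : ∀ᵐ s ∂(kernelMeasure μ), ∀ n, Vol (x n) s = ∫ r in (0 : ℝ)..s, x n r := by
      rw [ae_all_iff]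
      intro n
      have h4 := MemLp.coeFn_toLp (hprim (φ n)).1
      have h5 := MemLp.coeFn_toLp (hmem (φ n))
      filter_upwards [h4, hμ.ae_pos] with s hs hpos
      rw [← hφ, hVol]
      refine hs.trans (intervalIntegral.integral_congr_ae ?_)
      rw [uIoc_of_le hpos.1.le]
      filter_upwards [hμ.ae_of_ae h5 hpos.2] with r hr hr'
      exact (hr hr').symm
    filter_upwards [h2, h3, hμ.ae_pos] with s hs hs' hpos
    refine tendsto_nhds_unique hs ?_
    simp only [hs']
    have hzi : ∀ z : Lp E 2 (kernelMeasure μ), Integrable z (kernelMeasure μ) := fun z =>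
      (Lp.memLp z).integrable (by norm_num)
    have hii : ∀ z : Lp E 2 (kernelMeasure μ), IntervalIntegrable z volume 0 s := fun z =>
      (intervalIntegrable_iff_integrableOn_Ioc_of_le hpos.1.le).mpr
        (hμ.integrableOn_Ioc (hzi z) hpos.2)
    rw [tendsto_iff_norm_sub_tendsto_zero]
    have h6 : Tendsto (fun n => (μ s)⁻¹ * (C * ‖x (ns n) - z‖)) atTop (𝓝 0) := by
      have h7 := (tendsto_iff_norm_sub_tendsto_zero.mp (hx2.comp hns.tendsto_atTop))
      simpa using (h7.const_mul C).const_mul (μ s)⁻¹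
    refine squeeze_zero (fun _ => norm_nonneg _) (fun n => ?_) h6
    rw [← intervalIntegral.integral_sub (hii _) (hii _)]
    refine (hμ.norm_primitive_le ((hzi _).sub (hzi _)) hpos.1.le hpos.2).trans ?_
    have hμs := inv_nonneg.mpr hpos.2.le
    refine mul_le_mul_of_nonneg_left (le_trans (le_of_eq ?_) (hC _)) hμs
    refine integral_congr_ae ?_
    filter_upwards [Lp.coeFn_sub (x (ns n)) z] with r hr
    rw [hr]
  · refine hdense.induction_on (p := fun z => δ / 2 * ‖Vol z‖ ^ 2 ≤ inner ℝ z (Vol z)) z ?_ ?_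
    · exact isClosed_le (by fun_prop) (by fun_prop)
    · intro φ
      rw [hVol]
      exact hdiss φ

theorem intervalIntegrable (z : Lp E 2 (kernelMeasure μ)) {s : ℝ} (hs0 : 0 < s) (hs : 0 < μ s) :
    IntervalIntegrable z volume 0 s :=
  have := hμ.isFiniteMeasure
  (intervalIntegrable_iff_integrableOn_Ioc_of_le hs0.le).mpr
    (hμ.integrableOn_Ioc ((Lp.memLp z).integrable (by norm_num)) hs)

theorem eq_zero_of_primitive_eq_zero {z : Lp E 2 (kernelMeasure μ)}
    (h : ∀ᵐ s ∂(kernelMeasure μ), ∫ r in (0 : ℝ)..s, z r = 0) : z = 0 := by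
  have key : ∀ a, 0 < a → 0 < μ a → ∀ᵐ r, r ∈ Ioo 0 a → z r = 0 := by
    intro a ha hμa
    have hii := hμ.intervalIntegrable z ha hμa
    have h1 : EqOn (fun s => ∫ r in (0 : ℝ)..s, z r) 0 (Ioo 0 a) := by
      refine Measure.eqOn_Ioo_of_ae_eq volume ?_ ?_ continuousOn_const
      · rw [EventuallyEq, ae_restrict_iff' measurableSet_Ioo]
        filter_upwards [hμ.ae_of_ae h hμa] with s hs hs'
        exact hs (Ioo_subset_Ioc_self hs')
      · refine (intervalIntegral.continuousOn_primitive_interval ?_).mono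
          (Ioo_subset_Icc_self.trans Icc_subset_uIcc)
        rw [uIcc_of_le ha.le, integrableOn_Icc_iff_integrableOn_Ioc]
        exact (intervalIntegrable_iff_integrableOn_Ioc_of_le ha.le).mp hii
    filter_upwards [hii.ae_hasDerivAt_integral] with r hr hr'
    have h2 := hr (Icc_subset_uIcc (Ioo_subset_Icc_self hr')) 0 left_mem_uIcc
    have h3 : HasDerivAt (fun s => ∫ r in (0 : ℝ)..s, z r) 0 r := by
      refine (hasDerivAt_const r (0 : E)).congr_of_eventuallyEq ?_
      filter_upwards [Ioo_mem_nhds hr'.1 hr'.2] with s hs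
      exact h1 hs
    exact h2.unique h3
  -- Lebesgue differentiation gives `z = 0` almost everywhere on each `(0, a)` with `μ a > 0`.
  -- Rational endpoints keep the union of exceptional sets null, and suffice because `μ` stays
  -- positive just to the right of a point where it is positive.
  have key2 : ∀ᵐ r, ∀ q : ℚ, 0 < (q : ℝ) → 0 < μ q → r ∈ Ioo 0 (q : ℝ) → z r = 0 := by
    rw [ae_all_iff]
    intro q
    by_cases h1 : 0 < (q : ℝ) ∧ 0 < μ q
    · filter_upwards [key q h1.1 h1.2] with r hr _ _ using hr
    · exact Eventually.of_forall fun r h2 h3 => absurd ⟨h2, h3⟩ h1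
  have hac : kernelMeasure μ ≪ volume :=
    (withDensity_absolutelyContinuous _ _).trans Measure.restrict_le_self.absolutelyContinuous
  rw [Lp.eq_zero_iff_ae_eq_zero]
  filter_upwards [hac.ae_le key2, hμ.ae_pos] with s hs hpos
  have hcont : ContinuousAt μ s := hμ.continuousOn.continuousAt (Ici_mem_nhds hpos.1)
  obtain ⟨b, hsb, hb⟩ := exists_Ico_subset_of_mem_nhds (hcont.eventually (lt_mem_nhds hpos.2))
    ⟨s + 1, by linarith⟩
  obtain ⟨q, hq1, hq2⟩ := exists_rat_btwn hsb
  exact hs q (hpos.1.trans hq1) (hb ⟨hq1.le, hq2⟩) ⟨hpos.1, hq1⟩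

theorem adjoint_const [IsFiniteMeasure (kernelMeasure μ)] (w : Lp E 2 (kernelMeasure μ)) :
    ContinuousLinearMap.adjoint (Lp.constL 2 (kernelMeasure μ) ℝ) w
      = ∫ s in Ioi 0, μ s • w s := by
  rw [← hμ.integral_eq]
  refine ext_inner_left ℝ fun v => ?_
  rw [ContinuousLinearMap.adjoint_inner_right, L2.inner_def,
    ← integral_inner ((Lp.memLp w).integrable (by norm_num))]
  refine integral_congr_ae ?_
  filter_upwards [Lp.coeFn_const 2 (kernelMeasure μ) v] with s hs
  have : (Lp.constL 2 (kernelMeasure μ) ℝ) v s = v := hs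
  rw [this]

theorem primitive_const [IsFiniteMeasure (kernelMeasure μ)]
    {Vol : Lp E 2 (kernelMeasure μ) →L[ℝ] Lp E 2 (kernelMeasure μ)}
    (hVol : ∀ z, Vol z =ᵐ[kernelMeasure μ] fun s => ∫ r in (0 : ℝ)..s, z r) (v : E) :
    Vol (Lp.constL 2 (kernelMeasure μ) ℝ v) =ᵐ[kernelMeasure μ] fun s => s • v := by
  filter_upwards [hVol (Lp.constL 2 (kernelMeasure μ) ℝ v), hμ.ae_pos] with s hs hpos
  rw [hs]
  have h1 : ∫ r in (0 : ℝ)..s, (Lp.constL 2 (kernelMeasure μ) ℝ v) r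
      = ∫ r in (0 : ℝ)..s, v := by
    refine intervalIntegral.integral_congr_ae ?_
    rw [uIoc_of_le hpos.1.le]
    exact hμ.ae_of_ae (Lp.coeFn_const 2 (kernelMeasure μ) v) hpos.2
  rw [h1, intervalIntegral.integral_const, sub_zero]

theorem mean_pos : 0 < ∫ s : ℝ, s ∂(kernelMeasure μ) := by
  have := hμ.isFiniteMeasure
  -- The function `s` is the primitive of the constant `1`, so it belongs to `L²_μ`, and the measure
  -- is finite.
  have hint : Integrable (fun s : ℝ => s) (kernelMeasure μ) := by
    obtain ⟨_, _, Vol, hVol, _⟩ := hμ.exists_primitive ℝ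
    refine ((((Lp.memLp _).integrable (by norm_num)).congr (hμ.primitive_const hVol 1))).congr ?_
    exact Eventually.of_forall fun s => by simp
  have h0 : 0 ≤ᵐ[kernelMeasure μ] fun s : ℝ => s := by
    filter_upwards [hμ.ae_pos] with s hs using hs.1.le
  refine lt_of_le_of_ne (integral_nonneg_of_ae h0) fun h => hμ.measure_ne_zero ?_
  have h1 := (integral_eq_zero_iff_of_nonneg_ae h0 hint).mp h.symm
  have h2 : ∀ᵐ s ∂(kernelMeasure μ), False := by
    filter_upwards [h1, hμ.ae_pos] with s hs hs'
    exact hs'.1.ne' hs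
  simpa using h2

/-- This is the hypothesis `c† Vol c = m` of the Lyapunov construction, with `m` the first moment of
the kernel. -/
theorem adjoint_primitive_const [IsFiniteMeasure (kernelMeasure μ)]
    {Vol : Lp E 2 (kernelMeasure μ) →L[ℝ] Lp E 2 (kernelMeasure μ)}
    (hVol : ∀ z, Vol z =ᵐ[kernelMeasure μ] fun s => ∫ r in (0 : ℝ)..s, z r) (v : E) :
    ContinuousLinearMap.adjoint (Lp.constL 2 (kernelMeasure μ) ℝ)
        (Vol (Lp.constL 2 (kernelMeasure μ) ℝ v)) = (∫ s : ℝ, s ∂(kernelMeasure μ)) • v := by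
  rw [hμ.adjoint_const, ← hμ.integral_eq, integral_congr_ae (hμ.primitive_const hVol v),
    integral_smul_const]

end IsMemoryKernel

end Memory

end ViscoDelay

end

/-! ### The generator of the system and the energy norm. -/

noncomputable section

namespace ViscoDelay

namespace DelaySystem

universe u

variable {H : Type u} [NormedAddCommGroup H] [InnerProductSpace ℝ H] [CompleteSpace H]
variable {P : PositiveOperator H} (Q : DelaySystem P)

/-- Since `i i† = A⁻¹` and `c† w = ∫ μ w`, the condition `x ∈ D(A)` with `A x = -v'` is the same as
`x = -i† v'`; unbounded operators disappear. -/
theorem isGenerator_iff (hmu : IsMemoryKernel Q.mu) [IsFiniteMeasure (kernelMeasure Q.mu)]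
    {Vol : Lp P.FormDomain 2 (kernelMeasure Q.mu) →L[ℝ] Lp P.FormDomain 2 (kernelMeasure Q.mu)}
    (hVol : ∀ z, Vol z =ᵐ[kernelMeasure Q.mu] fun s => ∫ r in (0 : ℝ)..s, z r) (U W : Q.State) :
    Q.IsGenerator U W ↔ (U, W) ∈ linearGraph (1 - Q.mass) P.inclL
      (Lp.constL 2 (kernelMeasure Q.mu) ℝ) Vol := by
  refine and_congr Iff.rfl (and_congr ?_ (exists_congr fun z => and_congr ?_ ?_))
  · rw [hmu.adjoint_const]
    set x := (1 - Q.mass) • U.1 + ∫ s in Ioi 0, Q.mu s • U.2.2 s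
    constructor
    · rintro ⟨hU, h⟩
      apply P.incl_injective
      have h1 := P.inv_op ⟨_, hU⟩
      rw [← map_neg, P.incl_adjoint, h, neg_neg, h1]
    · intro h
      have h1 : P.incl x = P.inv (-W.2.1) := by
        rw [h, ← map_neg, P.incl_adjoint]
      obtain ⟨hf, h2⟩ := P.op_inv (-W.2.1)
      refine ⟨h1 ▸ hf, ?_⟩
      rw [← neg_eq_iff_eq_neg]
      exact h2.symm.trans (congrArg P.op (Subtype.ext h1.symm))
  · rw [Lp.ext_iff]
    constructor
    · intro h
      filter_upwards [h, hVol z] with s hs hs'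
      rw [hs, hs']
    · intro h
      filter_upwards [h, hVol z] with s hs hs'
      rw [hs, hs']
  · rw [Lp.ext_iff]
    have hc : (Lp.constL 2 (kernelMeasure Q.mu) ℝ W.1) =ᵐ[kernelMeasure Q.mu] fun _ => W.1 :=
      Lp.coeFn_const 2 (kernelMeasure Q.mu) W.1
    constructor
    · intro h
      filter_upwards [h, hc, Lp.coeFn_sub (Lp.constL 2 (kernelMeasure Q.mu) ℝ W.1) z]
        with s hs hs' hs''
      rw [hs, hs'', Pi.sub_apply, hs']
    · intro h
      filter_upwards [h, hc, Lp.coeFn_sub (Lp.constL 2 (kernelMeasure Q.mu) ℝ W.1) z]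
        with s hs hs' hs''
      rw [hs, hs'', Pi.sub_apply, hs']

theorem exists_stable_semigroup (hmu : IsMemoryKernel Q.mu) :
    ∃ S : ℝ → Q.State →L[ℝ] Q.State, HilleYosida.IsC0Semigroup Q.IsGenerator S ∧
      ∃ M ω, 0 < M ∧ 0 < ω ∧ ∀ t, 0 ≤ t → ‖S t‖ ≤ M * Real.exp (-ω * t) := by
  have := hmu.isFiniteMeasure
  obtain ⟨d, hd, Vol, hVol, hVold⟩ := hmu.exists_primitive P.FormDomain
  have hκ : 0 < 1 - Q.mass := sub_pos.mpr hmu.mass_lt_one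
  obtain ⟨S, hS, M, ω, hM, hω, hb⟩ := linear_exists_semigroup (i := P.inclL)
    (c := Lp.constL 2 (kernelMeasure Q.mu) ℝ) (Vol := Vol) hκ hd hmu.mean_pos hVold
    (hmu.adjoint_primitive_const hVol) P.incl_injective
    (fun f g hfg => P.inv_injective (by rw [← P.incl_adjoint, hfg, P.incl_adjoint]))
    ((injective_iff_map_eq_zero Vol).mpr fun z hz => by
      refine hmu.eq_zero_of_primitive_eq_zero ?_
      have h1 := hVol z
      rw [hz] at h1
      filter_upwards [h1, Lp.coeFn_zero P.FormDomain 2 (kernelMeasure Q.mu)] with s hs hs'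
      rw [← hs, hs']; rfl)
  refine ⟨S, ?_, M, ω, hM, hω, hb⟩
  have : Q.IsGenerator = fun x y => (x, y) ∈ linearGraph (1 - Q.mass) P.inclL
      (Lp.constL 2 (kernelMeasure Q.mu) ℝ) Vol := by
    funext x y
    exact propext (Q.isGenerator_iff hmu hVol x y)
  rwa [this]

theorem stateInner_self (hmu : IsMemoryKernel Q.mu) (U : Q.State) :
    Q.stateInner U U = (1 - Q.mass) * ‖U.1‖ ^ 2 + ‖U.2.1‖ ^ 2 + ‖U.2.2‖ ^ 2 := by
  have h := hmu.integral_eq fun s => (inner ℝ (U.2.2 s) (U.2.2 s) : ℝ)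
  rw [← L2.inner_def (𝕜 := ℝ), real_inner_self_eq_norm_sq] at h
  rw [stateInner, real_inner_self_eq_norm_sq, real_inner_self_eq_norm_sq, ← P.norm_formDomain, h]
  rfl

/-- The energy space `𝓗` with its Hilbert norm. -/
abbrev EnergySpace : Type u :=
  WithLp 2 (P.FormDomain × WithLp 2 (H × Lp P.FormDomain 2 (kernelMeasure Q.mu)))

/-- The map from `𝓗` with the product norm to `𝓗` with the Hilbert norm. -/
def toEnergy : Q.State →L[ℝ] Q.EnergySpace :=
  (WithLp.prodContinuousLinearEquiv 2 ℝ P.FormDomain _).symm.toContinuousLinearMap.comp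
    ((Real.sqrt (1 - Q.mass) • ContinuousLinearMap.fst ℝ _ _).prod
      ((WithLp.prodContinuousLinearEquiv 2 ℝ H
        (Lp P.FormDomain 2 (kernelMeasure Q.mu))).symm.toContinuousLinearMap.comp
        (ContinuousLinearMap.snd ℝ _ _)))

/-- Realises `stateNorm` as a genuine norm along a continuous linear map, so that the triangle
inequality and norm bounds for integrals apply without loss of constants. The sharp `M` and `ω` must
survive in the final estimate. -/
theorem norm_toEnergy (hmu : IsMemoryKernel Q.mu) (U : Q.State) :
    ‖Q.toEnergy U‖ = Q.stateNorm U := by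
  have hκ : 0 < 1 - Q.mass := sub_pos.mpr hmu.mass_lt_one
  rw [stateNorm, Q.stateInner_self hmu, WithLp.prod_norm_eq_of_L2]
  congr 1
  have h1 : (Q.toEnergy U).fst = Real.sqrt (1 - Q.mass) • U.1 := rfl
  have h2 : (Q.toEnergy U).snd = WithLp.toLp 2 U.2 := rfl
  rw [h1, h2, WithLp.prod_norm_sq_eq_of_L2, norm_smul, mul_pow,
    Real.norm_of_nonneg (Real.sqrt_nonneg _), Real.sq_sqrt hκ.le, add_assoc]
  rfl

theorem norm_snd_le_stateNorm (hmu : IsMemoryKernel Q.mu) (U : Q.State) :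
    ‖U.2.1‖ ≤ Q.stateNorm U := by
  have hκ : 0 < 1 - Q.mass := sub_pos.mpr hmu.mass_lt_one
  rw [stateNorm, Q.stateInner_self hmu]
  refine Real.le_sqrt_of_sq_le ?_
  have : 0 ≤ (1 - Q.mass) * ‖U.1‖ ^ 2 := by positivity
  linarith [sq_nonneg ‖U.2.2‖]

theorem norm_fst_le_stateNorm (hmu : IsMemoryKernel Q.mu) (U : Q.State) :
    Real.sqrt (1 - Q.mass) * ‖U.1‖ ≤ Q.stateNorm U := by
  have hκ : 0 < 1 - Q.mass := sub_pos.mpr hmu.mass_lt_one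
  rw [stateNorm, Q.stateInner_self hmu]
  refine Real.le_sqrt_of_sq_le ?_
  rw [mul_pow, Real.sq_sqrt hκ.le]
  linarith [sq_nonneg ‖U.2.2‖, sq_nonneg ‖U.2.1‖]

theorem stateNorm_zero_mk (hmu : IsMemoryKernel Q.mu) (v : H) :
    Q.stateNorm (0, v, 0) = ‖v‖ := by
  rw [stateNorm, Q.stateInner_self hmu]
  simp

theorem exists_norm_le_stateNorm (hmu : IsMemoryKernel Q.mu) :
    ∃ C > 0, ∀ U : Q.State, ‖U‖ ≤ C * Q.stateNorm U := by
  have hκ : 0 < 1 - Q.mass := sub_pos.mpr hmu.mass_lt_one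
  have hs := Real.sqrt_pos.mpr hκ
  refine ⟨(Real.sqrt (1 - Q.mass))⁻¹ + 1, by positivity, fun U => ?_⟩
  have h0 : 0 ≤ Q.stateNorm U := Real.sqrt_nonneg _
  have h1 := Q.norm_fst_le_stateNorm hmu U
  have h2 := Q.norm_snd_le_stateNorm hmu U
  have h3 : ‖U.2.2‖ ≤ Q.stateNorm U := by
    rw [stateNorm, Q.stateInner_self hmu]
    refine Real.le_sqrt_of_sq_le ?_
    have : 0 ≤ (1 - Q.mass) * ‖U.1‖ ^ 2 := by positivity
    linarith [sq_nonneg ‖U.2.1‖]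
  have h4 : 0 ≤ (Real.sqrt (1 - Q.mass))⁻¹ * Q.stateNorm U := by positivity
  have h5 : ‖U.1‖ ≤ (Real.sqrt (1 - Q.mass))⁻¹ * Q.stateNorm U := by
    rw [← div_eq_inv_mul, le_div_iff₀ hs]; linarith
  rw [add_mul, one_mul]
  refine max_le (by linarith) (max_le (by linarith) (by linarith))

theorem exists_semigroup (hmu : IsMemoryKernel Q.mu) :
    ∃ S : ℝ → Q.State →L[ℝ] Q.State, Q.IsSemigroup S ∧
      (Continuous fun p : ℝ × Q.State => S p.1 p.2) ∧
      ∃ M ω : ℝ, 0 < M ∧ 0 < ω ∧ Q.DecayBound S M ω := by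
  obtain ⟨S, hS, M, ω, hM, hω, hb⟩ := Q.exists_stable_semigroup hmu
  obtain ⟨C, hC, hCU⟩ := Q.exists_norm_le_stateNorm hmu
  refine ⟨S, ⟨hS.of_nonpos 0 le_rfl, hS.add, fun U => ?_, hS.generator⟩, hS.continuous,
    (‖Q.toEnergy‖ + 1) * M * C, ω, by positivity, hω, fun t ht U => ?_⟩
  · have h1 : Continuous fun t => S t U := hS.continuous.comp (continuous_id.prodMk continuous_const)
    have h2 := h1.tendsto 0
    rw [hS.of_nonpos 0 le_rfl] at h2
    exact h2.mono_left nhdsWithin_le_nhds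
  · rw [← Q.norm_toEnergy hmu]
    calc ‖Q.toEnergy (S t U)‖ ≤ ‖Q.toEnergy‖ * (M * Real.exp (-ω * t) * (C * Q.stateNorm U)) := by
          refine Q.toEnergy.le_opNorm_of_le ?_
          exact (S t).le_of_opNorm_le_of_le (hb t ht) (hCU U)
      _ ≤ (‖Q.toEnergy‖ + 1) * (M * Real.exp (-ω * t) * (C * Q.stateNorm U)) := by
          have : 0 ≤ Q.stateNorm U := Real.sqrt_nonneg _
          gcongr
          linarith
      _ = _ := by ring

end DelaySystem

end ViscoDelay

end

/-! ### Grönwall inequalities with integrable kernels and delay. -/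

noncomputable section

namespace ViscoDelay

/-- The primitive `N` of an `L¹` kernel is only absolutely continuous; this gives the same for
`e^N`, for which the fundamental theorem of calculus is needed. -/
theorem _root_.AbsolutelyContinuousOnInterval.comp_lipschitzOnWith {f g : ℝ → ℝ} {a b : ℝ}
    {K : NNReal} {s : Set ℝ} (hf : AbsolutelyContinuousOnInterval f a b)
    (hfs : MapsTo f (uIcc a b) s) (hg : LipschitzOnWith K g s) :
    AbsolutelyContinuousOnInterval (fun x => g (f x)) a b := by
  have h0 : Tendsto (fun E : ℕ × (ℕ → ℝ × ℝ) =>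
      (K : ℝ) * ∑ i ∈ Finset.range E.1, dist (f (E.2 i).1) (f (E.2 i).2))
      (AbsolutelyContinuousOnInterval.totalLengthFilter ⊓
        𝓟 (AbsolutelyContinuousOnInterval.disjWithin a b)) (𝓝 0) := by
    simpa using Tendsto.const_mul (K : ℝ) hf
  refine tendsto_of_tendsto_of_tendsto_of_le_of_le' tendsto_const_nhds h0 ?_ ?_
  · exact Eventually.of_forall fun E => Finset.sum_nonneg fun _ _ => dist_nonneg
  · refine Eventually.filter_mono inf_le_right ?_
    rw [eventually_principal]
    intro E hE
    rw [Finset.mul_sum]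
    refine Finset.sum_le_sum fun i hi => ?_
    exact hg.dist_le_mul _ (hfs (hE.1 i hi).1) _ (hfs (hE.1 i hi).2)

/-- `(e^N)' = m e^N` in integrated form, for the primitive `N` of an integrable function `m`. -/
theorem integral_mul_exp_primitive {m : ℝ → ℝ} {t : ℝ}
    (hm : IntervalIntegrable m volume 0 t) :
    ∫ s in (0 : ℝ)..t, m s * Real.exp (∫ r in (0 : ℝ)..s, m r)
      = Real.exp (∫ r in (0 : ℝ)..t, m r) - 1 := by
  have hN := hm.absolutelyContinuousOnInterval_intervalIntegral (c := 0) left_mem_uIcc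
  obtain ⟨R, hR⟩ := hN.exists_bound
  obtain ⟨K, hK⟩ : ∃ K, LipschitzOnWith K Real.exp (Icc (-R) R) :=
    (Real.contDiff_exp.contDiffOn (n := 1)).exists_lipschitzOnWith one_ne_zero
      (convex_Icc _ _) isCompact_Icc
  have hAC := hN.comp_lipschitzOnWith (g := Real.exp) (fun x hx => abs_le.mp (hR x hx)) hK
  have h := hAC.integral_deriv_eq_sub
  rw [intervalIntegral.integral_same, Real.exp_zero] at h
  rw [← h]
  refine intervalIntegral.integral_congr_ae ?_
  filter_upwards [hm.ae_hasDerivAt_integral] with x hx hxt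
  rw [((hx (uIoc_subset_uIcc hxt) 0 left_mem_uIcc).exp).deriv, mul_comm]

/-- Grönwall's inequality with an integrable kernel. -/
theorem gronwall_integrable {m φ : ℝ → ℝ} {C T : ℝ} (hT : 0 ≤ T)
    (hm : IntervalIntegrable m volume 0 T) (hm0 : ∀ s ∈ Icc 0 T, 0 ≤ m s)
    (hφ : ContinuousOn φ (Icc 0 T))
    (h : ∀ t ∈ Icc 0 T, φ t ≤ C + ∫ s in (0 : ℝ)..t, m s * φ s) :
    φ T ≤ C * Real.exp (∫ s in (0 : ℝ)..T, m s) := by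
  set N : ℝ → ℝ := fun t => ∫ s in (0 : ℝ)..t, m s with hNdef
  have hNc : ContinuousOn N (Icc 0 T) := by
    have := intervalIntegral.continuousOn_primitive_interval (μ := volume) (f := m) (a := 0) (b := T)
      (by rw [uIcc_of_le hT]; exact (intervalIntegrable_iff_integrableOn_Icc_of_le hT).mp hm)
    rwa [uIcc_of_le hT] at this
  have hsub : ∀ t ∈ Icc 0 T, IntervalIntegrable m volume 0 t := fun t ht =>
    hm.mono_set (by rw [uIcc_of_le hT, uIcc_of_le ht.1]; exact Icc_subset_Icc_right ht.2)
  -- Let `x` be the maximum of `φ e^{-N}`, attained at `t1`. Inserting `φ ≤ x e^N` in the inequality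
  -- at `t1` gives `x e^{N(t1)} ≤ C + x (e^{N(t1)} - 1)`, that is `x ≤ C`.
  obtain ⟨t1, ht1, hmax⟩ := isCompact_Icc.exists_isMaxOn (nonempty_Icc.mpr hT)
    (hφ.mul (hNc.neg.rexp))
  set x := φ t1 * Real.exp (-N t1) with hx
  have hle : ∀ s ∈ Icc 0 T, φ s ≤ x * Real.exp (N s) := by
    intro s hs
    have h1 : φ s * Real.exp (-N s) ≤ x := hmax hs
    calc φ s = φ s * Real.exp (-N s) * Real.exp (N s) := by
          rw [mul_assoc, ← Real.exp_add]; simp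
      _ ≤ _ := mul_le_mul_of_nonneg_right h1 (Real.exp_pos _).le
  have hcont : ∀ t ∈ Icc 0 T, ∀ f : ℝ → ℝ, ContinuousOn f (Icc 0 T) →
      IntervalIntegrable (fun s => m s * f s) volume 0 t := by
    intro t ht f hf
    refine (hsub t ht).mul_continuousOn (hf.mono ?_)
    rw [uIcc_of_le ht.1]; exact Icc_subset_Icc_right ht.2
  have hxC : x ≤ C := by
    have h1 := h t1 ht1
    have h2 : ∫ s in (0 : ℝ)..t1, m s * φ s ≤
        ∫ s in (0 : ℝ)..t1, x * (m s * Real.exp (N s)) := by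
      refine intervalIntegral.integral_mono_on ht1.1 (hcont t1 ht1 _ hφ)
        ((hcont t1 ht1 _ hNc.rexp).const_mul _) fun s hs => ?_
      have hs' : s ∈ Icc 0 T := ⟨hs.1, hs.2.trans ht1.2⟩
      calc m s * φ s ≤ m s * (x * Real.exp (N s)) :=
            mul_le_mul_of_nonneg_left (hle s hs') (hm0 s hs')
        _ = _ := by ring
    rw [intervalIntegral.integral_const_mul, integral_mul_exp_primitive (hsub t1 ht1)] at h2
    have h3 : φ t1 = x * Real.exp (N t1) := by
      rw [hx, mul_assoc, ← Real.exp_add]; simp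
    rw [h3] at h1
    have : x * (Real.exp (N t1) - 1) = x * Real.exp (N t1) - x := by ring
    simp only [hNdef] at *
    linarith
  exact (hle T (right_mem_Icc.mpr hT)).trans
    (mul_le_mul_of_nonneg_right hxC (Real.exp_pos _).le)

/-- Grönwall's inequality for exponentially stable problems with delay `τ`. -/
theorem gronwall_delay {p d K : ℝ → ℝ} {T τ ω M ε p0 D0 : ℝ} (hT : 0 ≤ T) (hτ : 0 ≤ τ)
    (hω : 0 ≤ ω) (hM : 0 ≤ M) (hε : 0 ≤ ε) (hp : ContinuousOn p (Icc 0 T))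
    (hp0 : ∀ t ∈ Icc 0 T, 0 ≤ p t) (hd : IntervalIntegrable d volume 0 T)
    (hd0 : ∀ s ∈ Icc 0 T, 0 ≤ d s) (hK : IntervalIntegrable K volume 0 T)
    (hK0 : ∀ s ∈ Icc 0 T, 0 ≤ K s) (hdK : ∀ s ∈ Icc τ T, d s ≤ K (s - τ) * p (s - τ))
    (hD0 : ∀ t ∈ Icc 0 T, t ≤ τ → ∫ s in (0 : ℝ)..t, d s ≤ D0)
    (h : ∀ t ∈ Icc 0 T, p t ≤ M * Real.exp (-ω * t) * p0
      + ∫ s in (0 : ℝ)..t, M * Real.exp (-ω * (t - s)) * (d s + ε * p s)) :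
    p T ≤ (M * p0 + M * Real.exp (ω * τ) * D0)
      * Real.exp (-ω * T + ∫ s in (0 : ℝ)..T, (M * Real.exp (ω * τ) * K s + M * ε)) := by
  set q : ℝ → ℝ := fun t => Real.exp (ω * t) * p t with hq
  have hexpc : ContinuousOn (fun s => Real.exp (ω * s)) (Icc 0 T) := by fun_prop
  have hqc : ContinuousOn q (Icc 0 T) := hexpc.mul hp
  have hq0 : ∀ t ∈ Icc 0 T, 0 ≤ q t := fun t ht => mul_nonneg (Real.exp_pos _).le (hp0 t ht)
  have hss : ∀ a b, a ∈ Icc 0 T → b ∈ Icc 0 T → uIcc a b ⊆ Icc 0 T := fun a b ha hb =>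
    ordConnected_Icc.uIcc_subset ha hb
  have hsT : ∀ a b, a ∈ Icc 0 T → b ∈ Icc 0 T → uIcc a b ⊆ uIcc 0 T := fun a b ha hb => by
    rw [uIcc_of_le hT]; exact hss a b ha hb
  have h0T : (0 : ℝ) ∈ Icc 0 T := left_mem_Icc.mpr hT
  have hed : ∀ a b, a ∈ Icc 0 T → b ∈ Icc 0 T →
      IntervalIntegrable (fun s => Real.exp (ω * s) * d s) volume a b := fun a b ha hb =>
    (hd.mono_set (hsT a b ha hb)).continuousOn_mul (hexpc.mono (hss a b ha hb))
  have hKq : ∀ a b, a ∈ Icc 0 T → b ∈ Icc 0 T →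
      IntervalIntegrable (fun s => K s * q s) volume a b := fun a b ha hb =>
    (hK.mono_set (hsT a b ha hb)).mul_continuousOn (hqc.mono (hss a b ha hb))
  have hqi : ∀ a b, a ∈ Icc 0 T → b ∈ Icc 0 T → IntervalIntegrable q volume a b :=
    fun a b ha hb => (hqc.mono (hss a b ha hb)).intervalIntegrable
  have hbase : ∀ t ∈ Icc 0 T, t ≤ τ →
      ∫ s in (0 : ℝ)..t, Real.exp (ω * s) * d s ≤ Real.exp (ω * τ) * D0 := by
    intro t ht htτ
    calc ∫ s in (0 : ℝ)..t, Real.exp (ω * s) * d s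
        ≤ ∫ s in (0 : ℝ)..t, Real.exp (ω * τ) * d s := by
          refine intervalIntegral.integral_mono_on ht.1 (hed 0 t h0T ht)
            ((hd.mono_set (hsT 0 t h0T ht)).const_mul _) fun s hs => ?_
          refine mul_le_mul_of_nonneg_right ?_ (hd0 s ⟨hs.1, hs.2.trans ht.2⟩)
          exact Real.exp_le_exp.mpr (mul_le_mul_of_nonneg_left (hs.2.trans htτ) hω)
      _ ≤ _ := by
          rw [intervalIntegral.integral_const_mul]
          exact mul_le_mul_of_nonneg_left (hD0 t ht htτ) (Real.exp_pos _).le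
  have hKnn : ∀ t ∈ Icc 0 T, 0 ≤ ∫ s in (0 : ℝ)..t, K s * q s := fun t ht =>
    intervalIntegral.integral_nonneg ht.1 fun s hs =>
      mul_nonneg (hK0 s ⟨hs.1, hs.2.trans ht.2⟩) (hq0 s ⟨hs.1, hs.2.trans ht.2⟩)
  -- Up to time `τ` the delayed term is data, bounded through `D0`. After `τ`, the change of
  -- variable `s ↦ s - τ` turns `e^{ωs} p(s - τ)` into `e^{ωτ} q(s)`, and the interval of
  -- integration is enlarged from `[0, t - τ]` to `[0, t]`.
  have hdelay : ∀ t ∈ Icc 0 T, ∫ s in (0 : ℝ)..t, Real.exp (ω * s) * d s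
      ≤ Real.exp (ω * τ) * D0 + Real.exp (ω * τ) * ∫ s in (0 : ℝ)..t, K s * q s := by
    intro t ht
    rcases le_or_gt t τ with htτ | htτ
    · have := mul_nonneg (Real.exp_pos (ω * τ)).le (hKnn t ht)
      linarith [hbase t ht htτ]
    · have hτm : τ ∈ Icc 0 T := ⟨hτ, htτ.le.trans ht.2⟩
      have htm : t - τ ∈ Icc 0 T := ⟨by linarith, by linarith [ht.2]⟩
      rw [← intervalIntegral.integral_add_adjacent_intervals (hed 0 τ h0T hτm) (hed τ t hτm ht)]
      refine add_le_add (hbase τ hτm le_rfl) ?_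
      have hshift : IntervalIntegrable (fun s => K (s - τ) * q (s - τ)) volume τ t := by
        have := (hKq 0 (t - τ) h0T htm).comp_sub_right τ
        simpa using this
      calc ∫ s in τ..t, Real.exp (ω * s) * d s
          ≤ ∫ s in τ..t, Real.exp (ω * τ) * (K (s - τ) * q (s - τ)) := by
            refine intervalIntegral.integral_mono_on htτ.le (hed τ t hτm ht)
              (hshift.const_mul _) fun s hs => ?_
            calc Real.exp (ω * s) * d s
                ≤ Real.exp (ω * s) * (K (s - τ) * p (s - τ)) :=
                  mul_le_mul_of_nonneg_left (hdK s ⟨hs.1, hs.2.trans ht.2⟩) (Real.exp_pos _).le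
              _ = _ := by
                  simp only [hq]
                  rw [show ω * s = ω * τ + ω * (s - τ) by ring, Real.exp_add]
                  ring
        _ = Real.exp (ω * τ) * ∫ s in (0 : ℝ)..(t - τ), K s * q s := by
            rw [intervalIntegral.integral_const_mul,
              intervalIntegral.integral_comp_sub_right (fun s => K s * q s) τ, sub_self]
        _ ≤ _ := by
            refine mul_le_mul_of_nonneg_left ?_ (Real.exp_pos _).le
            rw [← intervalIntegral.integral_add_adjacent_intervals (hKq 0 (t - τ) h0T htm)
              (hKq (t - τ) t htm ht)]
            refine le_add_of_nonneg_right (intervalIntegral.integral_nonneg (by linarith) ?_)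
            intro s hs
            have hs' : s ∈ Icc 0 T := ⟨htm.1.trans hs.1, hs.2.trans ht.2⟩
            exact mul_nonneg (hK0 s hs') (hq0 s hs')
  have hm : IntervalIntegrable (fun s => M * Real.exp (ω * τ) * K s + M * ε) volume 0 T :=
    (hK.const_mul _).add intervalIntegrable_const
  have hmain : q T ≤ (M * p0 + M * Real.exp (ω * τ) * D0)
      * Real.exp (∫ s in (0 : ℝ)..T, (M * Real.exp (ω * τ) * K s + M * ε)) := by
    refine gronwall_integrable hT hm (fun s hs => ?_) hqc fun t ht => ?_
    · have := hK0 s hs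
      positivity
    · have h1 := mul_le_mul_of_nonneg_left (h t ht) (Real.exp_pos (ω * t)).le
      have h2 : Real.exp (ω * t) * (M * Real.exp (-ω * t) * p0
          + ∫ s in (0 : ℝ)..t, M * Real.exp (-ω * (t - s)) * (d s + ε * p s))
          = M * p0 + ∫ s in (0 : ℝ)..t, (M * (Real.exp (ω * s) * d s) + M * ε * q s) := by
        rw [mul_add, ← intervalIntegral.integral_const_mul]
        congr 1
        · rw [show Real.exp (ω * t) * (M * Real.exp (-ω * t) * p0)
            = M * p0 * (Real.exp (ω * t) * Real.exp (-ω * t)) by ring, ← Real.exp_add]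
          simp
        · refine intervalIntegral.integral_congr fun s _ => ?_
          simp only [hq]
          rw [show -ω * (t - s) = -(ω * t) + ω * s by ring, Real.exp_add, Real.exp_neg]
          field_simp [(Real.exp_pos (ω * t)).ne']
      have h3 : ∫ s in (0 : ℝ)..t, (M * Real.exp (ω * τ) * K s + M * ε) * q s
          = M * (Real.exp (ω * τ) * ∫ s in (0 : ℝ)..t, K s * q s)
            + M * ε * ∫ s in (0 : ℝ)..t, q s := by
        rw [← intervalIntegral.integral_const_mul, ← intervalIntegral.integral_const_mul,
          ← intervalIntegral.integral_const_mul, ← intervalIntegral.integral_add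
            (((hKq 0 t h0T ht).const_mul _).const_mul _) ((hqi 0 t h0T ht).const_mul _)]
        refine intervalIntegral.integral_congr fun s _ => ?_
        ring
      rw [h2, intervalIntegral.integral_add ((hed 0 t h0T ht).const_mul _)
        ((hqi 0 t h0T ht).const_mul _), intervalIntegral.integral_const_mul,
        intervalIntegral.integral_const_mul] at h1
      have h4 := mul_le_mul_of_nonneg_left (hdelay t ht) hM
      rw [h3]
      have h5 : q t = Real.exp (ω * t) * p t := rfl
      nlinarith [h1, h4, h5]
  have h1 : p T = Real.exp (-ω * T) * q T := by
    simp only [hq]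
    rw [← mul_assoc, ← Real.exp_add]; simp
  rw [h1, Real.exp_add]
  calc _ ≤ _ := mul_le_mul_of_nonneg_left hmain (Real.exp_pos _).le
    _ = _ := by ring

end ViscoDelay

end

/-! ### Duhamel's formula and global mild solutions. -/

noncomputable section

namespace ViscoDelay

theorem intervalIntegrable_indicator_Ioi {E : Type*} [NormedAddCommGroup E] {g : ℝ → E}
    (hg : ∀ t, 0 ≤ t → IntervalIntegrable g volume 0 t) (a b : ℝ) :
    IntervalIntegrable ((Ioi 0).indicator g) volume a b := by
  obtain ⟨c, hc⟩ : ∃ c, c = max |a| |b| := ⟨_, rfl⟩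
  have hc0 : 0 ≤ c := hc ▸ (abs_nonneg a).trans (le_max_left _ _)
  have ha : |a| ≤ c := hc ▸ le_max_left _ _
  have hb : |b| ≤ c := hc ▸ le_max_right _ _
  have h1 : IntegrableOn ((Ioi 0).indicator g) (Ioc (-c) c) := by
    rw [IntegrableOn, integrable_indicator_iff measurableSet_Ioi, IntegrableOn,
      Measure.restrict_restrict measurableSet_Ioi]
    refine IntegrableOn.mono_set
      ((intervalIntegrable_iff_integrableOn_Ioc_of_le hc0).mp (hg c hc0)) ?_
    rintro s ⟨hs1, hs2⟩
    exact ⟨hs1, hs2.2⟩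
  rw [intervalIntegrable_iff]
  refine h1.mono_set ?_
  rw [uIoc]
  refine Ioc_subset_Ioc ?_ ?_
  · exact le_min (abs_le.mp ha).1 (abs_le.mp hb).1
  · exact max_le (abs_le.mp ha).2 (abs_le.mp hb).2

section Duhamel

variable {X : Type*} [NormedAddCommGroup X] [NormedSpace ℝ X]

theorem intervalIntegrable_convolution {S : ℝ → X →L[ℝ] X}
    (hS : Continuous fun p : ℝ × X => S p.1 p.2) {M : ℝ}
    (hM : ∀ t, 0 ≤ t → ‖S t‖ ≤ M) {g : ℝ → X} {t : ℝ} (ht : 0 ≤ t)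
    (hg : IntervalIntegrable g volume 0 t) :
    IntervalIntegrable (fun s => S (t - s) (g s)) volume 0 t := by
  rw [intervalIntegrable_iff_integrableOn_Ioc_of_le ht] at hg ⊢
  have hmeas : AEStronglyMeasurable (fun s => S (t - s) (g s)) (volume.restrict (Ioc 0 t)) :=
    hS.comp_aestronglyMeasurable (f := fun s => (t - s, g s))
      ((continuous_const.sub continuous_id).aestronglyMeasurable.prodMk hg.1)
  refine Integrable.mono' (hg.norm.const_mul M) hmeas ?_
  refine (ae_restrict_iff' measurableSet_Ioc).mpr (Eventually.of_forall fun s hs => ?_)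
  exact (S (t - s)).le_of_opNorm_le (hM _ (by linarith [hs.2])) _

/-- The Duhamel integral is continuous in time. -/
theorem continuous_convolution [CompleteSpace X] {S : ℝ → X →L[ℝ] X}
    (hS : Continuous fun p : ℝ × X => S p.1 p.2)
    {M : ℝ} (hM : ∀ t, 0 ≤ t → ‖S t‖ ≤ M) {g : ℝ → X}
    (hg : ∀ t, 0 ≤ t → IntervalIntegrable g volume 0 t) :
    Continuous fun t : ℝ => ∫ s in (0 : ℝ)..(max t 0), S (max t 0 - s) (g s) := by
  set G := (Ioi (0 : ℝ)).indicator g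
  have hG : ∀ a b, IntervalIntegrable G volume a b := intervalIntegrable_indicator_Ioi hg
  have hS' : Continuous fun p : ℝ × X => S (max p.1 0) p.2 :=
    hS.comp ((continuous_fst.max continuous_const).prodMk continuous_snd)
  -- Extending `g` by zero and cutting the time at `0` makes the integrand defined and dominated for
  -- all `t` and `s`, with the kernel and the endpoint varying together.
  have hc : Continuous fun t : ℝ => ∫ s in (0 : ℝ)..t, S (max (t - s) 0) (G s) := by
    refine continuous_iff_continuousAt.mpr fun b0 => ?_
    have h0 : (0 : ℝ) ∈ Ioo (min 0 b0 - 1) (max 0 b0 + 1) :=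
      ⟨by linarith [min_le_left 0 b0], by linarith [le_max_left 0 b0]⟩
    have hb : b0 ∈ Ioo (min 0 b0 - 1) (max 0 b0 + 1) :=
      ⟨by linarith [min_le_right 0 b0], by linarith [le_max_right 0 b0]⟩
    have key := intervalIntegral.continuousAt_parametric_primitive_of_dominated (μ := volume)
      (F := fun t s => S (max (t - s) 0) (G s)) (fun s => M * ‖G s‖)
      (min 0 b0 - 1) (max 0 b0 + 1) (a₀ := 0) (b₀ := b0) (x₀ := b0) ?_ ?_
      ((hG _ _).norm.const_mul M) ?_ h0 hb (by simp)
    · have h2 : ContinuousAt (fun t : ℝ => (t, t)) b0 := by fun_prop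
      exact ContinuousAt.comp (f := fun t : ℝ => (t, t))
        (g := fun p : ℝ × ℝ => ∫ s in (0 : ℝ)..p.2, S (max (p.1 - s) 0) (G s)) key h2
    · intro t
      exact hS'.comp_aestronglyMeasurable (f := fun s => (t - s, G s))
        ((continuous_const.sub continuous_id).aestronglyMeasurable.prodMk
          (intervalIntegrable_iff.mp (hG _ _)).1)
    · refine Eventually.of_forall fun t => Eventually.of_forall fun s => ?_
      exact (S _).le_of_opNorm_le (hM _ (le_max_right _ _)) _
    · refine Eventually.of_forall fun s => ?_
      have : Continuous fun t : ℝ => S (max (t - s) 0) (G s) :=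
        hS'.comp ((continuous_id.sub continuous_const).prodMk continuous_const)
      exact this.continuousAt
  refine (hc.comp (continuous_id.max (continuous_const (y := (0 : ℝ))))).congr fun t => ?_
  refine intervalIntegral.integral_congr_ae (Eventually.of_forall fun s hs => ?_)
  rw [uIoc_of_le (le_max_right _ _)] at hs
  have h1 : G s = g s := indicator_of_mem (mem_Ioi.mpr hs.1) g
  have h2 : max (max t 0 - s) 0 = max t 0 - s := max_eq_left (sub_nonneg.mpr hs.2)
  simp only [id_eq, h1, h2]

open BoundedContinuousFunction in
/-- Global mild solutions for a causal, Lipschitz nonlinearity with integrable Lipschitz constant: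
`‖f U s - f V s‖ ≤ m(s) sup_{[0, s]} ‖U - V‖`. -/
theorem exists_mild_solution [CompleteSpace X] {S : ℝ → X →L[ℝ] X}
    (hS : Continuous fun p : ℝ × X => S p.1 p.2) {M : ℝ}
    (hM : ∀ t, 0 ≤ t → ‖S t‖ ≤ M) (x0 : X) {f : (ℝ → X) → ℝ → X} {m : ℝ → ℝ}
    (hm : ∀ t, 0 ≤ t → IntervalIntegrable m volume 0 t) (hm0 : ∀ s, 0 ≤ s → 0 ≤ m s)
    (hf : ∀ U, Continuous U → ∀ t, 0 ≤ t → IntervalIntegrable (f U) volume 0 t)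
    (hlip : ∀ U V s D, 0 ≤ s → (∀ r ∈ Icc 0 s, ‖U r - V r‖ ≤ D) →
      ‖f U s - f V s‖ ≤ m s * D) :
    ∃ U, Continuous U ∧ ∀ t, 0 ≤ t → U t = S t x0 + ∫ s in (0 : ℝ)..t, S (t - s) (f U s) := by
  have hM0 : 0 ≤ M := (norm_nonneg _).trans (hM 0 le_rfl)
  -- Including `‖f 0‖` in the weight makes the Duhamel map preserve bounded functions after
  -- rescaling, not only contract differences.
  set b : ℝ → ℝ := fun s => m s + ‖f 0 s‖ with hb
  have hb0 : ∀ s, 0 ≤ s → 0 ≤ b s := fun s hs => add_nonneg (hm0 s hs) (norm_nonneg _)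
  have hbi : ∀ t, 0 ≤ t → IntervalIntegrable b volume 0 t := fun t ht =>
    (hm t ht).add (hf 0 continuous_zero t ht).norm
  set a : ℝ → ℝ := (Ioi 0).indicator fun s => (2 * M + 1) * b s with ha
  have ha0 : ∀ s, 0 ≤ a s := fun s => indicator_nonneg (fun r hr =>
    mul_nonneg (by linarith) (hb0 r (le_of_lt hr))) s
  have hai : ∀ x y, IntervalIntegrable a volume x y :=
    intervalIntegrable_indicator_Ioi fun t ht => (hbi t ht).const_mul _
  set N : ℝ → ℝ := fun t => ∫ s in (0 : ℝ)..t, a s with hN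
  have hNc : Continuous N := intervalIntegral.continuous_primitive hai 0
  have hNmono : Monotone N := by
    intro x y hxy
    have := intervalIntegral.integral_add_adjacent_intervals (hai 0 x) (hai x y)
    have h2 : 0 ≤ ∫ s in x..y, a s := intervalIntegral.integral_nonneg hxy fun s _ => ha0 s
    simp only [hN]; linarith
  have hN0 : ∀ t, 0 ≤ t → 0 ≤ N t := fun t ht =>
    intervalIntegral.integral_nonneg ht fun s _ => ha0 s
  have hexp1 : ∀ t, 0 ≤ t → 1 ≤ Real.exp (N t) := fun t ht => Real.one_le_exp (hN0 t ht)
  -- As `N' = a` dominates `2 M b`, integrating `M c b e^N` gives at most `(c/2) (e^N - 1)`. In the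
  -- norm weighted by `e^{-N}` the Duhamel integral contracts by `1/2` on the whole half-line,
  -- without a small time interval.
  have hest : ∀ (g : ℝ → X) (c t : ℝ), 0 ≤ c → 0 ≤ t →
      (∀ s ∈ Ioc 0 t, ‖g s‖ ≤ c * b s * Real.exp (N s)) →
      ‖∫ s in (0 : ℝ)..t, S (t - s) (g s)‖ ≤ c / 2 * Real.exp (N t) := by
    intro g c t hc ht hg
    have h1 : ‖∫ s in (0 : ℝ)..t, S (t - s) (g s)‖
        ≤ ∫ s in (0 : ℝ)..t, c / 2 * (a s * Real.exp (N s)) := by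
      refine intervalIntegral.norm_integral_le_of_norm_le ht
        (Eventually.of_forall fun s hs => ?_)
        (((hai 0 t).mul_continuousOn hNc.rexp.continuousOn).const_mul _)
      have h2 := (S (t - s)).le_of_opNorm_le (hM _ (by linarith [hs.2])) (g s)
      have h3 : a s = (2 * M + 1) * b s := indicator_of_mem (mem_Ioi.mpr hs.1) _
      have h4 : 0 ≤ b s * Real.exp (N s) :=
        mul_nonneg (hb0 s hs.1.le) (Real.exp_pos _).le
      calc ‖S (t - s) (g s)‖ ≤ M * (c * b s * Real.exp (N s)) :=
            h2.trans (mul_le_mul_of_nonneg_left (hg s hs) hM0)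
        _ ≤ M * (c * b s * Real.exp (N s)) + c / 2 * (b s * Real.exp (N s)) :=
            le_add_of_nonneg_right (mul_nonneg (by linarith) h4)
        _ = _ := by rw [h3]; ring
    rw [intervalIntegral.integral_const_mul, integral_mul_exp_primitive (hai 0 t)] at h1
    refine h1.trans (mul_le_mul_of_nonneg_left ?_ (by linarith))
    simp only [hN]; linarith
  let W : (ℝ →ᵇ X) → ℝ → X := fun v t => Real.exp (N t) • v t
  have hWc : ∀ v, Continuous (W v) := fun v => hNc.rexp.smul v.continuous
  have hW0 : W 0 = 0 := by funext t; simp [W]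
  have hWlip : ∀ v w s, 0 ≤ s → ‖f (W v) s - f (W w) s‖ ≤ ‖v - w‖ * b s * Real.exp (N s) := by
    intro v w s hs
    have h1 := hlip (W v) (W w) s (Real.exp (N s) * ‖v - w‖) hs fun r hr => by
      simp only [W]
      rw [← smul_sub, norm_smul, Real.norm_of_nonneg (Real.exp_pos _).le]
      exact mul_le_mul (Real.exp_le_exp.mpr (hNmono hr.2))
        ((v - w).norm_coe_le_norm r) (norm_nonneg _) (Real.exp_pos _).le
    refine h1.trans ?_
    have h2 : 0 ≤ Real.exp (N s) * ‖v - w‖ := by positivity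
    calc m s * (Real.exp (N s) * ‖v - w‖) ≤ b s * (Real.exp (N s) * ‖v - w‖) :=
          mul_le_mul_of_nonneg_right (le_add_of_nonneg_right (norm_nonneg _)) h2
      _ = _ := by ring
  have hWbd : ∀ v s, 0 ≤ s → ‖f (W v) s‖ ≤ (1 + ‖v‖) * b s * Real.exp (N s) := by
    intro v s hs
    have h1 := hWlip v 0 s hs
    rw [hW0, sub_zero] at h1
    have h2 : ‖f 0 s‖ ≤ b s * Real.exp (N s) :=
      (le_add_of_nonneg_left (hm0 s hs)).trans
        (le_mul_of_one_le_right (hb0 s hs) (hexp1 s hs))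
    calc ‖f (W v) s‖ = ‖(f (W v) s - f 0 s) + f 0 s‖ := by rw [sub_add_cancel]
      _ ≤ _ := norm_add_le _ _
      _ ≤ ‖v‖ * b s * Real.exp (N s) + b s * Real.exp (N s) := add_le_add h1 h2
      _ = _ := by ring
  let Ψ : (ℝ → X) → ℝ → X := fun U t =>
    S (max t 0) x0 + ∫ s in (0 : ℝ)..(max t 0), S (max t 0 - s) (f U s)
  have hΨc : ∀ v, Continuous (Ψ (W v)) := fun v =>
    (hS.comp ((continuous_id.max continuous_const).prodMk continuous_const)).add
      (continuous_convolution hS hM (hf (W v) (hWc v)))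
  let ρ : ℝ → ℝ := fun t => Real.exp (-N (max t 0))
  have hρc : Continuous ρ := (hNc.comp (continuous_id.max continuous_const)).neg.rexp
  have hρ0 : ∀ t, 0 ≤ ρ t := fun t => (Real.exp_pos _).le
  have hρ1 : ∀ t, ρ t ≤ 1 := fun t => Real.exp_le_one_iff.mpr
    (neg_nonpos.mpr (hN0 _ (le_max_right _ _)))
  have hρm : ∀ t, ρ t * Real.exp (N (max t 0)) = 1 := fun t => by
    simp only [ρ]; rw [← Real.exp_add]; simp
  have hΨb : ∀ v t, ‖ρ t • Ψ (W v) t‖ ≤ M * ‖x0‖ + (1 + ‖v‖) / 2 := by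
    intro v t
    have ht := le_max_right t 0
    rw [norm_smul, Real.norm_of_nonneg (hρ0 t)]
    have h1 := hest (f (W v)) (1 + ‖v‖) (max t 0) (by positivity) ht
      fun s hs => hWbd v s hs.1.le
    have h2 := (S (max t 0)).le_of_opNorm_le (hM _ ht) x0
    calc ρ t * ‖Ψ (W v) t‖
        ≤ ρ t * (M * ‖x0‖ + (1 + ‖v‖) / 2 * Real.exp (N (max t 0))) :=
          mul_le_mul_of_nonneg_left ((norm_add_le _ _).trans (add_le_add h2 h1)) (hρ0 t)
      _ = ρ t * (M * ‖x0‖) + (1 + ‖v‖) / 2 * (ρ t * Real.exp (N (max t 0))) := by ring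
      _ ≤ _ := by
          rw [hρm, mul_one]
          exact add_le_add_left (mul_le_of_le_one_left (by positivity) (hρ1 t)) _
  let Φ : (ℝ →ᵇ X) → (ℝ →ᵇ X) := fun v =>
    BoundedContinuousFunction.ofNormedAddCommGroup (fun t => ρ t • Ψ (W v) t)
      (hρc.smul (hΨc v)) _ (hΨb v)
  have hΦ : ContractingWith (1 / 2) Φ := by
    refine ⟨by rw [← NNReal.coe_lt_coe]; norm_num, LipschitzWith.of_dist_le_mul fun v w => ?_⟩
    rw [dist_eq_norm, dist_eq_norm, BoundedContinuousFunction.norm_le (by positivity)]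
    intro t
    have ht := le_max_right t 0
    have h1 := hest (fun s => f (W v) s - f (W w) s) ‖v - w‖ (max t 0) (norm_nonneg _) ht
      fun s hs => hWlip v w s hs.1.le
    have h2 : Ψ (W v) t - Ψ (W w) t
        = ∫ s in (0 : ℝ)..(max t 0), S (max t 0 - s) (f (W v) s - f (W w) s) := by
      simp only [Ψ, map_sub]
      rw [intervalIntegral.integral_sub
        (intervalIntegrable_convolution hS hM ht (hf (W v) (hWc v) _ ht))
        (intervalIntegrable_convolution hS hM ht (hf (W w) (hWc w) _ ht))]
      abel
    have h3 : (Φ v - Φ w) t = ρ t • (Ψ (W v) t - Ψ (W w) t) := by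
      rw [smul_sub]; rfl
    rw [h3, h2, norm_smul, Real.norm_of_nonneg (hρ0 t)]
    calc _ ≤ ρ t * (‖v - w‖ / 2 * Real.exp (N (max t 0))) :=
          mul_le_mul_of_nonneg_left h1 (hρ0 t)
      _ = ‖v - w‖ / 2 * (ρ t * Real.exp (N (max t 0))) := by ring
      _ = _ := by
          rw [hρm]; push_cast; ring
  obtain ⟨v, hv⟩ : ∃ v, Φ v = v := ⟨_, hΦ.fixedPoint_isFixedPt⟩
  refine ⟨W v, hWc v, fun t ht => ?_⟩
  have h1 : ρ t • Ψ (W v) t = v t := congrArg (fun w : ℝ →ᵇ X => w t) hv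
  have h2 : Ψ (W v) t = S t x0 + ∫ s in (0 : ℝ)..t, S (t - s) (f (W v) s) := by
    simp only [Ψ, max_eq_left ht]
  rw [← h2]
  have h3 := hρm t
  rw [max_eq_left ht, mul_comm] at h3
  calc W v t = Real.exp (N t) • (ρ t • Ψ (W v) t) := by rw [h1]
    _ = _ := by rw [smul_smul, h3, one_smul]

end Duhamel

end ViscoDelay

end

/-! ### The nonlinear term and its truncation; the delay term and growth estimates. -/

noncomputable section

namespace ViscoDelay

universe u

variable {H : Type u} [NormedAddCommGroup H] [InnerProductSpace ℝ H] [CompleteSpace H]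
variable {P : PositiveOperator H}

namespace Potential

variable (F : Potential P)

theorem norm_gradient_sub_le {F : Potential P} {r L : ℝ}
    (hL : ∀ u v : P.FormDomain, ‖P.sqrt u‖ ≤ r → ‖P.sqrt v‖ ≤ r →
      ‖F.gradient u - F.gradient v‖ ≤ L * ‖P.sqrt (u - v)‖) {u v : P.FormDomain}
    (hu : ‖u‖ ≤ r) (hv : ‖v‖ ≤ r) : ‖F.gradient u - F.gradient v‖ ≤ L * ‖u - v‖ := by
  rw [P.norm_formDomain] at hu hv ⊢
  exact hL u v hu hv

theorem LipschitzOnBounded.continuous_gradient {F : Potential P} (hF : F.LipschitzOnBounded) :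
    Continuous F.gradient := by
  refine continuous_iff_continuousAt.mpr fun u => ?_
  obtain ⟨L, hL0, hL⟩ := hF (‖u‖ + 1) (by positivity)
  rw [ContinuousAt, tendsto_iff_norm_sub_tendsto_zero]
  have h0 : Tendsto (fun v : P.FormDomain => L * ‖v - u‖) (𝓝 u) (𝓝 0) := by
    have : Continuous fun v : P.FormDomain => L * ‖v - u‖ := by fun_prop
    simpa using this.tendsto u
  refine squeeze_zero' (Eventually.of_forall fun _ => norm_nonneg _) ?_ h0
  filter_upwards [Metric.ball_mem_nhds u one_pos] with v hv
  refine norm_gradient_sub_le hL ?_ (by linarith)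
  have h1 : ‖v - u‖ < 1 := by rwa [Metric.mem_ball, dist_eq_norm] at hv
  calc ‖v‖ = ‖(v - u) + u‖ := by rw [sub_add_cancel]
    _ ≤ ‖v - u‖ + ‖u‖ := norm_add_le _ _
    _ ≤ _ := by linarith

/-- `∇ψ` composed with the radial retraction onto the ball of radius `r`. -/
def truncGradient (r : ℝ) (u : P.FormDomain) : H := F.gradient ((r / max r ‖u‖) • u)

theorem truncGradient_of_norm_le {r : ℝ} (hr : 0 < r) {u : P.FormDomain} (hu : ‖u‖ ≤ r) :
    F.truncGradient r u = F.gradient u := by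
  rw [truncGradient, max_eq_left hu, div_self hr.ne', one_smul]

theorem norm_radial_le {r : ℝ} (hr : 0 < r) (u : P.FormDomain) :
    ‖(r / max r ‖u‖) • u‖ ≤ r ∧ ‖(r / max r ‖u‖) • u‖ ≤ ‖u‖ := by
  have hm : 0 < max r ‖u‖ := lt_max_of_lt_left hr
  rw [norm_smul, Real.norm_of_nonneg (by positivity), div_mul_eq_mul_div, div_le_iff₀ hm,
    div_le_iff₀ hm]
  constructor
  · exact mul_le_mul_of_nonneg_left (le_max_right _ _) hr.le
  · rw [mul_comm]
    exact mul_le_mul_of_nonneg_left (le_max_left _ _) (norm_nonneg _)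

theorem norm_radial_sub_le {r : ℝ} (hr : 0 < r) (u v : P.FormDomain) :
    ‖(r / max r ‖u‖) • u - (r / max r ‖v‖) • v‖ ≤ 2 * ‖u - v‖ := by
  obtain ⟨a, ha⟩ : ∃ a, a = max r ‖u‖ := ⟨_, rfl⟩
  obtain ⟨b, hb⟩ : ∃ b, b = max r ‖v‖ := ⟨_, rfl⟩
  rw [← ha, ← hb]
  have ha0 : 0 < a := ha ▸ lt_max_of_lt_left hr
  have hb0 : 0 < b := hb ▸ lt_max_of_lt_left hr
  have har : r ≤ a := ha ▸ le_max_left _ _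
  have hbv : ‖v‖ ≤ b := hb ▸ le_max_right _ _
  have hab : |b - a| ≤ ‖u - v‖ := by
    rw [ha, hb, norm_sub_rev]
    exact (abs_max_sub_max_le_max _ _ _ _).trans (by simpa using abs_norm_sub_norm_le v u)
  have h1 : (r / a) • u - (r / b) • v = (r / a) • (u - v) + (r / a - r / b) • v := by
    rw [smul_sub, sub_smul]; abel
  have h2 : ‖(r / a) • (u - v)‖ ≤ ‖u - v‖ := by
    rw [norm_smul, Real.norm_of_nonneg (by positivity)]
    exact mul_le_of_le_one_left (norm_nonneg _) ((div_le_one ha0).mpr har)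
  have h3 : ‖(r / a - r / b) • v‖ ≤ ‖u - v‖ := by
    have h4 : r / a - r / b = (r / a) * ((b - a) / b) := by field_simp
    rw [norm_smul, h4, norm_mul, Real.norm_of_nonneg (by positivity : 0 ≤ r / a), norm_div,
      Real.norm_of_nonneg hb0.le, Real.norm_eq_abs]
    calc r / a * (|b - a| / b) * ‖v‖ ≤ 1 * (|b - a| / b) * b := by
          gcongr
          exact (div_le_one ha0).mpr har
      _ = |b - a| := by field_simp
      _ ≤ _ := hab
  rw [h1]
  linarith [norm_add_le ((r / a) • (u - v)) ((r / a - r / b) • v)]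

/-- The radial retraction is `2`-Lipschitz, so the local constant on the ball becomes a global one,
as the contraction argument requires. -/
theorem norm_truncGradient_sub_le {F : Potential P} {r L : ℝ} (hr : 0 < r) (hL0 : 0 ≤ L)
    (hL : ∀ u v : P.FormDomain, ‖P.sqrt u‖ ≤ r → ‖P.sqrt v‖ ≤ r →
      ‖F.gradient u - F.gradient v‖ ≤ L * ‖P.sqrt (u - v)‖) (u v : P.FormDomain) :
    ‖F.truncGradient r u - F.truncGradient r v‖ ≤ 2 * L * ‖u - v‖ := by
  have h1 := norm_gradient_sub_le hL (norm_radial_le hr u).1 (norm_radial_le hr v).1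
  have h2 := mul_le_mul_of_nonneg_left (norm_radial_sub_le hr u v) hL0
  exact h1.trans (h2.trans_eq (by ring))

theorem norm_gradient_le {F : Potential P} {h : ℝ → ℝ} (hmono : StrictMonoOn h (Ici 0))
    (hle : ∀ u, ‖F.gradient u‖ ≤ h ‖P.sqrt u‖ * ‖P.sqrt u‖) {r : ℝ} (hr : 0 ≤ r)
    {u : P.FormDomain} (hu : ‖u‖ ≤ r) : ‖F.gradient u‖ ≤ h r * ‖u‖ := by
  have h1 := hle u
  rw [← P.norm_formDomain] at h1
  exact h1.trans (mul_le_mul_of_nonneg_right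
    (hmono.monotoneOn (norm_nonneg _) hr hu) (norm_nonneg _))

theorem norm_truncGradient_le {F : Potential P} {h : ℝ → ℝ} (hmono : StrictMonoOn h (Ici 0))
    (h0 : h 0 = 0) (hle : ∀ u, ‖F.gradient u‖ ≤ h ‖P.sqrt u‖ * ‖P.sqrt u‖) {r : ℝ} (hr : 0 < r)
    (u : P.FormDomain) : ‖F.truncGradient r u‖ ≤ h r * ‖u‖ := by
  have h1 : 0 ≤ h r := h0 ▸ hmono.monotoneOn self_mem_Ici hr.le hr.le
  exact (norm_gradient_le hmono hle hr.le (norm_radial_le hr u).1).trans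
    (mul_le_mul_of_nonneg_left (norm_radial_le hr u).2 h1)

/-- Mean value inequality along `θ ↦ θ u` from `0` to `u`: only derivatives along lines are used,
each represented by the gradient. -/
theorem abs_psi_le {F : Potential P} {h : ℝ → ℝ} (hmono : StrictMonoOn h (Ici 0))
    (h0 : h 0 = 0) (hle : ∀ u, ‖F.gradient u‖ ≤ h ‖P.sqrt u‖ * ‖P.sqrt u‖) (hpsi : F.psi 0 = 0)
    {r : ℝ} (hr : 0 ≤ r) {u : P.FormDomain} (hu : ‖u‖ ≤ r) :
    |F.psi u| ≤ h r * Real.sqrt ‖P.inv‖ * ‖u‖ ^ 2 := by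
  have h1 : 0 ≤ h r := h0 ▸ hmono.monotoneOn self_mem_Ici hr hr
  have hderiv : ∀ θ ∈ Icc (0 : ℝ) 1, HasDerivWithinAt (fun t : ℝ => F.psi (t • u))
      (F.dpsi (θ • u) u) (Icc 0 1) θ := by
    intro θ _
    have h2 := F.hasLineDerivAt (θ • u) u
    rw [HasLineDerivAt] at h2
    have h3 : HasDerivAt (fun t : ℝ => t - θ) 1 θ := (hasDerivAt_id θ).sub_const θ
    have h4 := HasDerivAt.scomp (g₁ := fun t : ℝ => F.psi (θ • u + t • u)) θ
      (by rw [sub_self]; exact h2) h3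
    rw [one_smul] at h4
    refine HasDerivAt.hasDerivWithinAt (h4.congr_of_eventuallyEq (Eventually.of_forall fun t => ?_))
    simp only [Function.comp_apply, ← add_smul]
    congr 2; ring
  have hbd : ∀ θ ∈ Ico (0 : ℝ) 1,
      ‖F.dpsi (θ • u) u‖ ≤ h r * Real.sqrt ‖P.inv‖ * ‖u‖ ^ 2 := by
    intro θ hθ
    have h2 : F.dpsi (θ • u) u = inner ℝ (F.gradient (θ • u)) (P.incl u) :=
      ((F.exists_gradient (θ • u)).choose_spec u).symm
    have h3 : ‖θ • u‖ ≤ ‖u‖ := by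
      rw [norm_smul, Real.norm_of_nonneg hθ.1]
      exact mul_le_of_le_one_left (norm_nonneg _) hθ.2.le
    rw [h2]
    calc _ ≤ ‖F.gradient (θ • u)‖ * ‖P.incl u‖ := norm_inner_le_norm _ _
      _ ≤ (h r * ‖u‖) * (Real.sqrt ‖P.inv‖ * ‖u‖) := by
          refine mul_le_mul ?_ (P.norm_incl_le u) (norm_nonneg _) (by positivity)
          exact (norm_gradient_le hmono hle hr (h3.trans hu)).trans
            (mul_le_mul_of_nonneg_left h3 h1)
      _ = _ := by ring
  have h5 := norm_image_sub_le_of_norm_deriv_le_segment_01' hderiv hbd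
  simpa [hpsi] using h5

end Potential

namespace DelaySystem

variable (Q : DelaySystem P)

theorem intervalIntegrable_k {Q : DelaySystem P} (hk : LocallyIntegrableOn Q.k (Ici 0)) {a b : ℝ}
    (ha : 0 ≤ a) (hb : 0 ≤ b) : IntervalIntegrable Q.k volume a b := by
  rw [intervalIntegrable_iff']
  exact hk.integrableOn_compact_subset
    (fun x hx => (le_min ha hb).trans hx.1) isCompact_uIcc

theorem intervalIntegrable_k_shift {Q : DelaySystem P} (hk : LocallyIntegrableOn Q.k (Ici 0))
    {a b : ℝ} (ha : 0 ≤ a + Q.tau) (hb : 0 ≤ b + Q.tau) :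
    IntervalIntegrable (fun s => |Q.k (s + Q.tau)|) volume a b := by
  have := (intervalIntegrable_k hk ha hb).abs.comp_add_right Q.tau
  simpa using this

theorem norm_B_feedback_sub_le (d : Q.InitialData) (U V : ℝ → Q.State) {s : ℝ} (hs : 0 ≤ s) :
    ‖Q.B (Q.feedback d U s) - Q.B (Q.feedback d V s)‖ ≤ ‖Q.B‖ ^ 2 * ‖(U s).2.1 - (V s).2.1‖ := by
  rw [feedback, feedback, if_neg (not_lt.mpr hs), if_neg (not_lt.mpr hs), ← map_sub, ← map_sub]
  calc _ ≤ ‖Q.B‖ * (‖Q.B‖ * ‖(U s).2.1 - (V s).2.1‖) := by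
        refine Q.B.le_opNorm_of_le ?_
        have := (ContinuousLinearMap.adjoint Q.B).le_opNorm ((U s).2.1 - (V s).2.1)
        rwa [LinearIsometryEquiv.norm_map] at this
    _ = _ := by ring

theorem norm_feedback_le (d : Q.InitialData) (U : ℝ → Q.State) {s : ℝ} (hs : 0 ≤ s) :
    ‖Q.feedback d U s‖ ≤ ‖Q.B‖ * ‖(U s).2.1‖ := by
  rw [feedback, if_neg (not_lt.mpr hs)]
  have := (ContinuousLinearMap.adjoint Q.B).le_opNorm (U s).2.1
  rwa [LinearIsometryEquiv.norm_map] at this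

/-- The delay term `k(s) B B* u_t(s - τ)`. -/
def delayTerm (d : Q.InitialData) (U : ℝ → Q.State) (s : ℝ) : H :=
  Q.k s • Q.B (Q.feedback d U (s - Q.tau))

theorem intervalIntegrable_smul_of_continuousOn {E : Type*} [NormedAddCommGroup E]
    [NormedSpace ℝ E] {f : ℝ → ℝ} {g : ℝ → E} {a b : ℝ} (hf : IntervalIntegrable f volume a b)
    (hg : ContinuousOn g (uIcc a b)) : IntervalIntegrable (fun s => f s • g s) volume a b := by
  rw [intervalIntegrable_iff'] at hf ⊢
  exact hf.smul_continuousOn hg isCompact_uIcc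

/-- The term switches from the datum to the solution at `s = τ`, and the two values need not match
there. On each side it agrees, on the open interval, with `k` times a function continuous up to the
endpoints. -/
theorem intervalIntegrable_delayTerm {Q : DelaySystem P} (hk : LocallyIntegrableOn Q.k (Ici 0))
    (htau : 0 < Q.tau) (d : Q.InitialData) {U : ℝ → Q.State} {t : ℝ} (ht : 0 ≤ t)
    (hU : ContinuousOn U (Icc 0 t)) : IntervalIntegrable (Q.delayTerm d U) volume 0 t := by
  have hbase : ∀ b, 0 ≤ b → b ≤ Q.tau → IntervalIntegrable (Q.delayTerm d U) volume 0 b := by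
    intro b hb hbτ
    have h1 : ContinuousOn (fun s => Q.B (d.g (s - Q.tau))) (uIcc 0 b) := by
      rw [uIcc_of_le hb]
      refine d.continuousOn.comp (f := fun s => s - Q.tau) (by fun_prop) fun s hs => ?_
      exact ⟨by linarith [hs.1], by linarith [hs.2]⟩
    refine (intervalIntegrable_smul_of_continuousOn
      (intervalIntegrable_k hk le_rfl hb) h1).congr_uIoo fun s hs => ?_
    rw [uIoo_of_le hb] at hs
    have h2 : s - Q.tau < 0 := by linarith [hs.2]
    simp only [delayTerm, feedback, if_pos h2]
  rcases le_or_gt t Q.tau with h | h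
  · exact hbase t ht h
  · refine (hbase Q.tau htau.le le_rfl).trans ?_
    have h1 : ContinuousOn (fun s => Q.B (ContinuousLinearMap.adjoint Q.B (U (s - Q.tau)).2.1))
        (uIcc Q.tau t) := by
      rw [uIcc_of_le h.le]
      have h3 : ContinuousOn (fun s => U (s - Q.tau)) (Icc Q.tau t) :=
        hU.comp (f := fun s => s - Q.tau) (by fun_prop) fun s hs =>
          ⟨by linarith [hs.1], by linarith [hs.2]⟩
      exact (Q.B.continuous.comp (ContinuousLinearMap.adjoint Q.B).continuous).comp_continuousOn
        (continuous_fst.comp continuous_snd |>.comp_continuousOn h3)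
    refine (intervalIntegrable_smul_of_continuousOn
      (intervalIntegrable_k hk htau.le ht) h1).congr_uIoo fun s hs => ?_
    rw [uIoo_of_le h.le] at hs
    have h2 : ¬ s - Q.tau < 0 := by linarith [hs.1]
    simp only [delayTerm, feedback, if_neg h2]

theorem stateNorm_nonneg (U : Q.State) : 0 ≤ Q.stateNorm U := Real.sqrt_nonneg _

theorem continuous_stateNorm (hmu : IsMemoryKernel Q.mu) : Continuous Q.stateNorm :=
  Q.toEnergy.continuous.norm.congr fun U => Q.norm_toEnergy hmu U

theorem stateNorm_add_le (hmu : IsMemoryKernel Q.mu) (U V : Q.State) :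
    Q.stateNorm (U + V) ≤ Q.stateNorm U + Q.stateNorm V := by
  simp only [← Q.norm_toEnergy hmu, map_add]
  exact norm_add_le _ _

theorem DecayBound.exists_opNorm_le {Q : DelaySystem P} (hmu : IsMemoryKernel Q.mu)
    {S : ℝ → Q.State →L[ℝ] Q.State} {M ω : ℝ} (hM : 0 < M) (hω : 0 < ω)
    (hS : Q.DecayBound S M ω) : ∃ K, ∀ t, 0 ≤ t → ‖S t‖ ≤ K := by
  obtain ⟨C, hC, hCU⟩ := Q.exists_norm_le_stateNorm hmu
  refine ⟨C * (M * ‖Q.toEnergy‖), fun t ht => ?_⟩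
  refine (S t).opNorm_le_bound (by positivity) fun U => ?_
  have h1 : Real.exp (-ω * t) ≤ 1 := Real.exp_le_one_iff.mpr (by nlinarith)
  have h2 : Q.stateNorm U ≤ ‖Q.toEnergy‖ * ‖U‖ := by
    rw [← Q.norm_toEnergy hmu]; exact Q.toEnergy.le_opNorm U
  calc ‖S t U‖ ≤ C * (M * Real.exp (-ω * t) * Q.stateNorm U) :=
        (hCU _).trans (mul_le_mul_of_nonneg_left (hS t ht U) hC.le)
    _ ≤ C * (M * 1 * (‖Q.toEnergy‖ * ‖U‖)) := by
        have := Q.stateNorm_nonneg U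
        gcongr
    _ = _ := by ring

/-- The inclusion `v ↦ (0, v, 0)` of `H` in the phase space. -/
def velocity : H →L[ℝ] Q.State :=
  (ContinuousLinearMap.inr ℝ P.FormDomain _).comp (ContinuousLinearMap.inl ℝ H _)

@[simp] theorem velocity_apply (v : H) : Q.velocity v = (0, v, 0) := rfl

theorem stateNorm_integral_le {Q : DelaySystem P} (hmu : IsMemoryKernel Q.mu)
    {S : ℝ → Q.State →L[ℝ] Q.State} (hSc : Continuous fun p : ℝ × Q.State => S p.1 p.2)
    {M ω : ℝ} (hM : 0 < M) (hω : 0 < ω) (hS : Q.DecayBound S M ω) {F : ℝ → H} {b : ℝ → ℝ} {t : ℝ}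
    (ht : 0 ≤ t) (hF : IntervalIntegrable F volume 0 t) (hb : IntervalIntegrable b volume 0 t)
    (hFb : ∀ s ∈ Icc 0 t, ‖F s‖ ≤ b s) :
    Q.stateNorm (∫ s in (0 : ℝ)..t, S (t - s) (Q.velocity (F s)))
      ≤ ∫ s in (0 : ℝ)..t, M * Real.exp (-ω * (t - s)) * b s := by
  obtain ⟨K, hK⟩ := hS.exists_opNorm_le hmu hM hω
  have hvF : IntervalIntegrable (fun s => Q.velocity (F s)) volume 0 t :=
    ⟨Q.velocity.integrable_comp hF.1, Q.velocity.integrable_comp hF.2⟩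
  rw [← Q.norm_toEnergy hmu,
    ← Q.toEnergy.intervalIntegral_comp_comm (intervalIntegrable_convolution hSc hK ht hvF)]
  refine intervalIntegral.norm_integral_le_of_norm_le ht
    (Eventually.of_forall fun s hs => ?_) (hb.continuousOn_mul (by fun_prop))
  rw [Q.norm_toEnergy hmu]
  have h1 := hS (t - s) (by linarith [hs.2]) (Q.velocity (F s))
  rw [velocity_apply, Q.stateNorm_zero_mk hmu] at h1
  exact h1.trans (mul_le_mul_of_nonneg_left (hFb s ⟨hs.1.le, hs.2⟩) (by positivity))

/-- Growth estimate for solutions of Duhamel's formula with a delayed term and a small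
instantaneous term. -/
theorem stateNorm_le_of_duhamel {Q : DelaySystem P} (hmu : IsMemoryKernel Q.mu)
    (hk : LocallyIntegrableOn Q.k (Ici 0)) (htau : 0 < Q.tau)
    {S : ℝ → Q.State →L[ℝ] Q.State} (hSc : Continuous fun p : ℝ × Q.State => S p.1 p.2)
    {M ω : ℝ} (hM : 0 < M) (hω : 0 < ω) (hS : Q.DecayBound S M ω) {V : ℝ → Q.State} {x0 : Q.State}
    {F : ℝ → H} {D : ℝ → ℝ} {T ε D0 : ℝ} (hT : 0 ≤ T) (hε : 0 ≤ ε) (hV : ContinuousOn V (Icc 0 T))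
    (hF : IntervalIntegrable F volume 0 T)
    (hVF : ∀ t ∈ Icc 0 T, V t = S t x0 + ∫ s in (0 : ℝ)..t, S (t - s) (Q.velocity (F s)))
    (hD : IntervalIntegrable D volume 0 T) (hD0 : ∀ s ∈ Icc 0 T, 0 ≤ D s)
    (hFD : ∀ s ∈ Icc 0 T, ‖F s‖ ≤ D s + ε * Q.stateNorm (V s))
    (hDk : ∀ s ∈ Icc Q.tau T,
      D s ≤ ‖Q.B‖ ^ 2 * |Q.k s| * Q.stateNorm (V (s - Q.tau)))
    (hDint : ∀ t ∈ Icc 0 T, t ≤ Q.tau → ∫ s in (0 : ℝ)..t, D s ≤ D0) :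
    Q.stateNorm (V T) ≤ (M * Q.stateNorm x0 + M * Real.exp (ω * Q.tau) * D0)
      * Real.exp (-ω * T + ∫ s in (0 : ℝ)..T,
        (M * Real.exp (ω * Q.tau) * (‖Q.B‖ ^ 2 * |Q.k (s + Q.tau)|) + M * ε)) := by
  have hpc : ContinuousOn (fun t => Q.stateNorm (V t)) (Icc 0 T) :=
    (Q.continuous_stateNorm hmu).comp_continuousOn hV
  refine gronwall_delay (p := fun t => Q.stateNorm (V t)) (d := D)
    (K := fun s => ‖Q.B‖ ^ 2 * |Q.k (s + Q.tau)|) hT htau.le hω.le hM.le hε hpc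
    (fun t _ => Q.stateNorm_nonneg _) hD hD0
    ((intervalIntegrable_k_shift hk (by linarith) (by linarith)).const_mul _)
    (fun s _ => by positivity) (fun s hs => ?_) hDint fun t ht => ?_
  · simpa using hDk s hs
  · have hsub : uIcc 0 t ⊆ uIcc 0 T := by
      rw [uIcc_of_le hT, uIcc_of_le ht.1]; exact Icc_subset_Icc_right ht.2
    rw [hVF t ht]
    refine (Q.stateNorm_add_le hmu _ _).trans (add_le_add (hS t ht.1 x0) ?_)
    refine stateNorm_integral_le hmu hSc hM hω hS ht.1 (hF.mono_set hsub)
      ((hD.mono_set hsub).add ((hpc.mono ?_).intervalIntegrable.const_mul ε))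
      fun s hs => hFD s ⟨hs.1, hs.2.trans ht.2⟩
    rw [uIcc_of_le ht.1]; exact Icc_subset_Icc_right ht.2

end DelaySystem

end ViscoDelay

end

/-! ### Existence, uniqueness and bounds for the initial data. -/

noncomputable section

namespace ViscoDelay

namespace DelaySystem

universe u

variable {H : Type u} [NormedAddCommGroup H] [InnerProductSpace ℝ H] [CompleteSpace H]
variable {P : PositiveOperator H} {Q : DelaySystem P}

theorem norm_delayTerm_sub_le (d : Q.InitialData) (U V : ℝ → Q.State) {s : ℝ} (hs : Q.tau ≤ s) :
    ‖Q.delayTerm d U s - Q.delayTerm d V s‖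
      ≤ ‖Q.B‖ ^ 2 * |Q.k s| * ‖(U (s - Q.tau)).2.1 - (V (s - Q.tau)).2.1‖ := by
  rw [delayTerm, delayTerm, ← smul_sub, norm_smul, Real.norm_eq_abs]
  have := mul_le_mul_of_nonneg_left
    (Q.norm_B_feedback_sub_le d U V (s := s - Q.tau) (by linarith)) (abs_nonneg (Q.k s))
  exact this.trans_eq (by ring)

theorem delayTerm_of_lt (d : Q.InitialData) (U : ℝ → Q.State) {s : ℝ} (hs : s < Q.tau) :
    Q.delayTerm d U s = Q.k s • Q.B (d.g (s - Q.tau)) := by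
  rw [delayTerm, feedback, if_pos (by linarith)]

theorem exists_duhamel (htau : 0 < Q.tau) (hk : LocallyIntegrableOn Q.k (Ici 0))
    {S : ℝ → Q.State →L[ℝ] Q.State} (hSc : Continuous fun p : ℝ × Q.State => S p.1 p.2)
    {K : ℝ} (hK : ∀ t, 0 ≤ t → ‖S t‖ ≤ K) {G : P.FormDomain → H} {Λ : ℝ} (hΛ : 0 ≤ Λ)
    (hG : ∀ u v, ‖G u - G v‖ ≤ Λ * ‖u - v‖) (d : Q.InitialData) :
    ∃ U : ℝ → Q.State, Continuous U ∧ ∀ t, 0 ≤ t → U t = S t d.state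
      + ∫ s in (0 : ℝ)..t, S (t - s) (Q.velocity (-(Q.delayTerm d U s) + G (U s).1)) := by
  have hGc : Continuous G := by
    refine (LipschitzWith.of_dist_le_mul (K := ⟨Λ, hΛ⟩) fun u v => ?_).continuous
    rw [dist_eq_norm, dist_eq_norm]; exact hG u v
  refine exists_mild_solution hSc hK d.state
    (f := fun U s => Q.velocity (-(Q.delayTerm d U s) + G (U s).1))
    (m := fun s => ‖Q.B‖ ^ 2 * |Q.k s| + Λ) ?_ ?_ ?_ ?_
  · intro t ht
    exact ((intervalIntegrable_k hk le_rfl ht).abs.const_mul _).add intervalIntegrable_const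
  · intro s _; positivity
  · intro U hU t ht
    have h1 : IntervalIntegrable (fun s => -(Q.delayTerm d U s) + G (U s).1) volume 0 t :=
      (intervalIntegrable_delayTerm hk htau d ht hU.continuousOn).neg.add
        (hGc.comp (continuous_fst.comp hU)).continuousOn.intervalIntegrable
    exact ⟨Q.velocity.integrable_comp h1.1, Q.velocity.integrable_comp h1.2⟩
  · intro U V s D hs hD
    have hD0 : 0 ≤ D := (norm_nonneg _).trans (hD s (right_mem_Icc.mpr hs))
    have h1 : ‖G (U s).1 - G (V s).1‖ ≤ Λ * D :=
      (hG _ _).trans (mul_le_mul_of_nonneg_left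
        ((norm_fst_le (U s - V s)).trans (hD s (right_mem_Icc.mpr hs))) hΛ)
    have h2 : ‖Q.delayTerm d U s - Q.delayTerm d V s‖ ≤ ‖Q.B‖ ^ 2 * |Q.k s| * D := by
      -- Before `τ` both delay terms equal the same datum; afterwards they look back to `s - τ`,
      -- which lies in `[0, s]`.
      rcases lt_or_ge s Q.tau with h | h
      · rw [delayTerm_of_lt d U h, delayTerm_of_lt d V h, sub_self, norm_zero]
        positivity
      · refine (norm_delayTerm_sub_le d U V h).trans
          (mul_le_mul_of_nonneg_left ?_ (by positivity))
        exact ((norm_fst_le (U (s - Q.tau) - V (s - Q.tau)).2).trans (norm_snd_le _)).trans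
          (hD _ ⟨by linarith, by linarith⟩)
    rw [← map_sub]
    have h3 : ∀ v : H, ‖Q.velocity v‖ = ‖v‖ := fun v => by
      simp [Prod.norm_def]
    rw [h3, show -(Q.delayTerm d U s) + G (U s).1 - (-(Q.delayTerm d V s) + G (V s).1)
      = (G (U s).1 - G (V s).1) - (Q.delayTerm d U s - Q.delayTerm d V s) by abel]
    exact (norm_sub_le _ _).trans (by linarith)

theorem eq_of_duhamel (hmu : IsMemoryKernel Q.mu) (hk : LocallyIntegrableOn Q.k (Ici 0))
    (htau : 0 < Q.tau) (hpsi : Q.pot.LipschitzOnBounded)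
    {S : ℝ → Q.State →L[ℝ] Q.State} (hSc : Continuous fun p : ℝ × Q.State => S p.1 p.2)
    {M ω : ℝ} (hM : 0 < M) (hω : 0 < ω) (hS : Q.DecayBound S M ω) (d : Q.InitialData)
    {U W : ℝ → Q.State} {T : ℝ} (hT : 0 ≤ T)
    (hU : Q.IsMildSolution S d (Icc 0 T) U) (hW : Q.IsMildSolution S d (Icc 0 T) W) :
    W T = U T := by
  have hκ := Real.sqrt_pos.mpr (sub_pos.mpr hmu.mass_lt_one)
  change 0 < Real.sqrt (1 - Q.mass) at hκ
  obtain ⟨K, hK⟩ := hS.exists_opNorm_le hmu hM hω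
  obtain ⟨RU, hRU⟩ := isCompact_Icc.exists_bound_of_continuousOn hU.1
  obtain ⟨RW, hRW⟩ := isCompact_Icc.exists_bound_of_continuousOn hW.1
  -- Both solutions are bounded on the compact interval, so one Lipschitz constant serves them. The
  -- difference has zero initial state and no delay contribution before `τ`, so the growth estimate
  -- with `x0 = 0` and `D0 = 0` forces it to vanish.
  obtain ⟨L, hL0, hL⟩ := hpsi (max (max RU RW) 1) (lt_max_of_lt_right one_pos)
  have hgc := hpsi.continuous_gradient
  have hFi : ∀ V : ℝ → Q.State, ContinuousOn V (Icc 0 T) → IntervalIntegrable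
      (fun s => -(Q.delayTerm d V s) + Q.pot.gradient (V s).1) volume 0 T := fun V hV =>
    (intervalIntegrable_delayTerm hk htau d hT hV).neg.add
      (ContinuousOn.intervalIntegrable (by
        rw [uIcc_of_le hT]
        exact (hgc.comp continuous_fst).comp_continuousOn hV))
  have hv : ∀ {F : ℝ → H}, IntervalIntegrable F volume 0 T →
      IntervalIntegrable (fun s => Q.velocity (F s)) volume 0 T := fun h =>
    ⟨Q.velocity.integrable_comp h.1, Q.velocity.integrable_comp h.2⟩
  have hest := stateNorm_le_of_duhamel hmu hk htau hSc hM hω hS (V := fun t => W t - U t)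
    (x0 := 0) (D := fun s => ‖Q.delayTerm d W s - Q.delayTerm d U s‖)
    (F := fun s => (-(Q.delayTerm d W s) + Q.pot.gradient (W s).1)
      - (-(Q.delayTerm d U s) + Q.pot.gradient (U s).1))
    (ε := L / Real.sqrt (1 - Q.mass)) (D0 := 0) hT (by positivity) (hW.1.sub hU.1)
    ((hFi W hW.1).sub (hFi U hU.1)) ?_
    ((intervalIntegrable_delayTerm hk htau d hT hW.1).sub
      (intervalIntegrable_delayTerm hk htau d hT hU.1)).norm
    (fun s _ => norm_nonneg _) ?_ ?_ ?_
  · have h0 : Q.stateNorm (0 : Q.State) = 0 := by rw [← Q.norm_toEnergy hmu, map_zero, norm_zero]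
    rw [h0, mul_zero, mul_zero, add_zero, zero_mul] at hest
    obtain ⟨C, hC, hCU⟩ := Q.exists_norm_le_stateNorm hmu
    have h1 := (hCU (W T - U T)).trans (mul_le_mul_of_nonneg_left hest hC.le)
    rw [mul_zero] at h1
    exact sub_eq_zero.mp (norm_le_zero_iff.mp h1)
  · intro t ht
    have hsub : uIcc 0 t ⊆ uIcc 0 T := by
      rw [uIcc_of_le hT, uIcc_of_le ht.1]; exact Icc_subset_Icc_right ht.2
    have e1 := hU.2 t ht
    have e2 := hW.2 t ht
    have i1 := intervalIntegrable_convolution hSc hK ht.1 ((hv (hFi U hU.1)).mono_set hsub)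
    have i2 := intervalIntegrable_convolution hSc hK ht.1 ((hv (hFi W hW.1)).mono_set hsub)
    change W t - U t = _
    rw [e1, e2, map_zero, zero_add, add_sub_add_left_eq_sub]
    simp only [map_sub]
    rw [intervalIntegral.integral_sub i2 i1]
    rfl
  · intro s hs
    have h1 : ‖(W s).1‖ ≤ max (max RU RW) 1 :=
      ((norm_fst_le _).trans (hRW s hs)).trans ((le_max_right _ _).trans (le_max_left _ _))
    have h2 : ‖(U s).1‖ ≤ max (max RU RW) 1 :=
      ((norm_fst_le _).trans (hRU s hs)).trans ((le_max_left _ _).trans (le_max_left _ _))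
    have h3 := Potential.norm_gradient_sub_le hL h1 h2
    have h4 := Q.norm_fst_le_stateNorm hmu (W s - U s)
    have h5 : L * ‖(W s).1 - (U s).1‖ ≤ L / Real.sqrt (1 - Q.mass) * Q.stateNorm (W s - U s) := by
      rw [div_mul_eq_mul_div, le_div_iff₀ hκ, mul_assoc, mul_comm ‖_‖]
      exact mul_le_mul_of_nonneg_left h4 hL0.le
    rw [show -(Q.delayTerm d W s) + Q.pot.gradient (W s).1
        - (-(Q.delayTerm d U s) + Q.pot.gradient (U s).1)
      = (Q.pot.gradient (W s).1 - Q.pot.gradient (U s).1)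
        - (Q.delayTerm d W s - Q.delayTerm d U s) by abel]
    exact (norm_sub_le _ _).trans (by linarith)
  · intro s hs
    refine (norm_delayTerm_sub_le d W U hs.1).trans
      (mul_le_mul_of_nonneg_left ?_ (by positivity))
    exact Q.norm_snd_le_stateNorm hmu (W (s - Q.tau) - U (s - Q.tau))
  · intro t ht htτ
    have h1 : ∫ s in (0 : ℝ)..t, ‖Q.delayTerm d W s - Q.delayTerm d U s‖
        = ∫ _ in (0 : ℝ)..t, (0 : ℝ) := by
      refine intervalIntegral.integral_congr_uIoo fun s hs => ?_
      rw [uIoo_of_le ht.1] at hs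
      simp only [delayTerm_of_lt d _ (hs.2.trans_le htτ), sub_self, norm_zero]
    rw [h1, intervalIntegral.integral_zero]

theorem stateNorm_state_sq (hmu : IsMemoryKernel Q.mu) (d : Q.InitialData) :
    Q.stateNorm d.state ^ 2 = (1 - Q.mass) * ‖P.sqrt (d.u0 0)‖ ^ 2 + ‖d.u1‖ ^ 2
      + ∫ s in Ioi 0, Q.mu s * ‖P.sqrt (d.eta0 s)‖ ^ 2 := by
  have hκ : 0 < 1 - Q.mass := sub_pos.mpr hmu.mass_lt_one
  rw [stateNorm, Real.sq_sqrt]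
  · rw [stateInner, real_inner_self_eq_norm_sq, real_inner_self_eq_norm_sq]
    congr 1
    have h1 := hmu.integral_eq fun s => (inner ℝ (P.sqrt (d.state.2.2 s)) (P.sqrt (d.state.2.2 s)) : ℝ)
    have h2 := hmu.integral_eq fun s => ‖P.sqrt (d.eta0 s)‖ ^ 2
    simp only [smul_eq_mul] at h1 h2
    rw [← h1, ← h2]
    refine integral_congr_ae ?_
    filter_upwards [d.memLp.coeFn_toLp] with s hs
    have h3 : d.state.2.2 s = d.eta0 s := hs
    rw [h3, real_inner_self_eq_norm_sq]
  · rw [Q.stateInner_self hmu]; positivity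

/-- Bounds for the initial data in terms of their size. -/
theorem InitialData.bounds (hmu : IsMemoryKernel Q.mu) (hk : LocallyIntegrableOn Q.k (Ici 0))
    (htau : 0 < Q.tau) {c : ℝ} (hc : (∫ s in (0 : ℝ)..Q.tau, |Q.k s|) ≤ c) {d : Q.InitialData}
    {σ : ℝ} (hσ : 0 < σ) (hd : d.size < σ ^ 2) :
    Q.stateNorm d.state ≤ σ ∧ ∀ U : ℝ → Q.State, ∀ t ∈ Icc 0 Q.tau,
      ∫ s in (0 : ℝ)..t, ‖Q.delayTerm d U s‖ ≤ σ * ((c + 1) / 2) := by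
  have h0 : 0 ≤ ∫ s in (0 : ℝ)..Q.tau, |Q.k s| * ‖Q.B (d.g (s - Q.tau))‖ ^ 2 :=
    intervalIntegral.integral_nonneg htau.le fun s _ => by positivity
  have hsz : d.size = Q.stateNorm d.state ^ 2
      + ∫ s in (0 : ℝ)..Q.tau, |Q.k s| * ‖Q.B (d.g (s - Q.tau))‖ ^ 2 := by
    rw [stateNorm_state_sq hmu]; rfl
  refine ⟨?_, fun U t ht => ?_⟩
  · exact (sq_le_sq₀ (Q.stateNorm_nonneg _) hσ.le).mp (by linarith)
  · have hcont : ContinuousOn (fun s => Q.B (d.g (s - Q.tau))) (uIcc 0 Q.tau) := by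
      rw [uIcc_of_le htau.le]
      refine d.continuousOn.comp (f := fun s => s - Q.tau) (by fun_prop) fun s hs => ?_
      exact ⟨by linarith [hs.1], by linarith [hs.2]⟩
    have hki := (intervalIntegrable_k hk le_rfl htau.le).abs
    have hsub : uIcc 0 t ⊆ uIcc 0 Q.tau := by
      rw [uIcc_of_le htau.le, uIcc_of_le ht.1]; exact Icc_subset_Icc_right ht.2
    have i1 : IntervalIntegrable (fun s => |Q.k s| * ‖Q.B (d.g (s - Q.tau))‖) volume 0 Q.tau :=
      hki.mul_continuousOn hcont.norm
    have i2 : IntervalIntegrable (fun s => |Q.k s| * ‖Q.B (d.g (s - Q.tau))‖ ^ 2) volume 0 Q.tau :=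
      hki.mul_continuousOn (hcont.norm.pow 2)
    have e1 : ∫ s in (0 : ℝ)..t, ‖Q.delayTerm d U s‖
        = ∫ s in (0 : ℝ)..t, |Q.k s| * ‖Q.B (d.g (s - Q.tau))‖ := by
      refine intervalIntegral.integral_congr_uIoo fun s hs => ?_
      rw [uIoo_of_le ht.1] at hs
      simp only [delayTerm_of_lt d U (hs.2.trans_le ht.2), norm_smul, Real.norm_eq_abs]
    have e2 : ∫ s in (0 : ℝ)..t, |Q.k s| * ‖Q.B (d.g (s - Q.tau))‖
        ≤ ∫ s in (0 : ℝ)..Q.tau, |Q.k s| * ‖Q.B (d.g (s - Q.tau))‖ := by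
      have ht' : t ∈ uIcc 0 Q.tau := by rw [uIcc_of_le htau.le]; exact ht
      rw [← intervalIntegral.integral_add_adjacent_intervals (i1.mono_set hsub)
        (i1.mono_set (uIcc_subset_uIcc ht' right_mem_uIcc))]
      exact le_add_of_nonneg_right
        (intervalIntegral.integral_nonneg ht.2 fun s _ => by positivity)
    -- Young's inequality with weight `σ` turns the quadratic smallness of the data into a linear
    -- one: `(σ/2) c + σ²/(2σ) = σ (c + 1)/2`.
    have e3 : ∫ s in (0 : ℝ)..Q.tau, |Q.k s| * ‖Q.B (d.g (s - Q.tau))‖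
        ≤ ∫ s in (0 : ℝ)..Q.tau, (σ / 2 * |Q.k s|
          + 1 / (2 * σ) * (|Q.k s| * ‖Q.B (d.g (s - Q.tau))‖ ^ 2)) := by
      refine intervalIntegral.integral_mono_on htau.le i1
        ((hki.const_mul _).add (i2.const_mul _)) fun s _ => ?_
      obtain ⟨b, hb⟩ : ∃ b, b = ‖Q.B (d.g (s - Q.tau))‖ := ⟨_, rfl⟩
      rw [← hb]
      have h1 : b ≤ σ / 2 + 1 / (2 * σ) * b ^ 2 := by
        have h2 : σ / 2 + 1 / (2 * σ) * b ^ 2 - b = (b - σ) ^ 2 / (2 * σ) := by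
          field_simp; ring
        have h3 : 0 ≤ (b - σ) ^ 2 / (2 * σ) := by positivity
        linarith
      calc |Q.k s| * b ≤ |Q.k s| * (σ / 2 + 1 / (2 * σ) * b ^ 2) :=
            mul_le_mul_of_nonneg_left h1 (abs_nonneg _)
        _ = _ := by ring
    rw [intervalIntegral.integral_add (hki.const_mul _) (i2.const_mul _),
      intervalIntegral.integral_const_mul, intervalIntegral.integral_const_mul] at e3
    have h4 : ∫ s in (0 : ℝ)..Q.tau, |Q.k s| * ‖Q.B (d.g (s - Q.tau))‖ ^ 2 ≤ σ ^ 2 := by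
      linarith [sq_nonneg (Q.stateNorm d.state)]
    rw [e1]
    refine e2.trans (e3.trans ?_)
    calc _ ≤ σ / 2 * c + 1 / (2 * σ) * σ ^ 2 := by gcongr
      _ = _ := by field_simp

end DelaySystem

end ViscoDelay

end

/-! ### Decay of the solution and of its energy. -/

noncomputable section

namespace ViscoDelay

namespace DelaySystem

universe u

variable {H : Type u} [NormedAddCommGroup H] [InnerProductSpace ℝ H] [CompleteSpace H]
variable {P : PositiveOperator H} {Q : DelaySystem P}

theorem stateNorm_sq (hmu : IsMemoryKernel Q.mu) (U : Q.State) :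
    Q.stateNorm U ^ 2 = (1 - Q.mass) * ‖P.sqrt U.1‖ ^ 2 + ‖U.2.1‖ ^ 2
      + ∫ s in Ioi 0, Q.mu s * ‖P.sqrt (U.2.2 s)‖ ^ 2 := by
  have hκ : 0 < 1 - Q.mass := sub_pos.mpr hmu.mass_lt_one
  rw [stateNorm, Real.sq_sqrt (by rw [Q.stateInner_self hmu]; positivity), stateInner]
  simp only [real_inner_self_eq_norm_sq]

theorem integral_abs_k_shift_le (hk : LocallyIntegrableOn Q.k (Ici 0)) {c : ℝ}
    (hc : ∀ t : ℝ, 0 < t → (∫ s in (max (t - Q.tau) 0)..t, |Q.k s|) < c) (htau : 0 < Q.tau)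
    {a t : ℝ} (ht : 0 ≤ t) (ha0 : t - Q.tau ≤ a) :
    ∫ s in a..t, |Q.k (s + Q.tau)| ≤ c := by
  rw [intervalIntegral.integral_comp_add_right (fun s => |Q.k s|)]
  have h1 := hc (t + Q.tau) (by linarith)
  rw [add_sub_cancel_right, max_eq_left ht] at h1
  have h2 := intervalIntegral.integral_add_adjacent_intervals
    (intervalIntegrable_k hk ht (by linarith : 0 ≤ a + Q.tau)).abs
    (intervalIntegrable_k hk (by linarith : 0 ≤ a + Q.tau) (by linarith : 0 ≤ t + Q.tau)).abs
  have h3 : 0 ≤ ∫ s in t..(a + Q.tau), |Q.k s| :=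
    intervalIntegral.integral_nonneg (by linarith) fun s _ => abs_nonneg _
  linarith

/-- Decay of the part of the energy stored in the delay. -/
theorem integral_feedback_le (hmu : IsMemoryKernel Q.mu) (hk : LocallyIntegrableOn Q.k (Ici 0))
    (htau : 0 < Q.tau) {c : ℝ}
    (hc : ∀ t : ℝ, 0 < t → (∫ s in (max (t - Q.tau) 0)..t, |Q.k s|) < c) (d : Q.InitialData)
    {U : ℝ → Q.State} (hU : Continuous U) {R β : ℝ} (hR : 0 ≤ R) (hβ : 0 < β)
    (hUR : ∀ t, 0 ≤ t → Q.stateNorm (U t) ≤ R * Real.exp (-β * t)) :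
    ∃ C, ∀ t, 0 ≤ t → ∫ s in (t - Q.tau)..t, |Q.k (s + Q.tau)| * ‖Q.feedback d U s‖ ^ 2
      ≤ C * Real.exp (-β * t) := by
  have hint : ∀ a b, 0 ≤ a → a ≤ b → IntervalIntegrable
      (fun s => |Q.k (s + Q.tau)| * ‖Q.feedback d U s‖ ^ 2) volume a b := by
    intro a b ha hab
    have h1 : Continuous fun s => ‖ContinuousLinearMap.adjoint Q.B (U s).2.1‖ ^ 2 :=
      ((ContinuousLinearMap.adjoint Q.B).continuous.comp
        (continuous_fst.comp (continuous_snd.comp hU))).norm.pow 2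
    refine ((intervalIntegrable_k_shift hk (a := a) (b := b) (by linarith)
      (by linarith)).mul_continuousOn h1.continuousOn).congr_uIoo fun s hs => ?_
    rw [uIoo_of_le hab] at hs
    have h2 : ¬ s < 0 := by linarith [hs.1]
    simp only [feedback, if_neg h2]
  have hgi : IntervalIntegrable (fun s => |Q.k (s + Q.tau)| * ‖d.g s‖ ^ 2) volume (-Q.tau) 0 := by
    rw [intervalIntegrable_iff_integrableOn_Ioo_of_le (by linarith)]
    exact d.integrableOn
  obtain ⟨A, hA⟩ : ∃ A, A = ∫ s in (-Q.tau)..0, |Q.k (s + Q.tau)| * ‖d.g s‖ ^ 2 := ⟨_, rfl⟩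
  have hA0 : 0 ≤ A := by
    rw [hA]; exact intervalIntegral.integral_nonneg (by linarith) fun s _ => by positivity
  have hc0 : 0 ≤ c := by
    have := hc Q.tau htau
    rw [sub_self, max_self] at this
    exact (intervalIntegral.integral_nonneg htau.le fun s _ => abs_nonneg _).trans this.le
  -- On a window of length at most `τ` ending at `t`, `e^{-βs} ≤ e^{βτ} e^{-βt}`, and the shifted
  -- `|k|` has integral at most `c`.
  have hlate : ∀ t a, 0 ≤ t → 0 ≤ a → t - Q.tau ≤ a → a ≤ t →
      ∫ s in a..t, |Q.k (s + Q.tau)| * ‖Q.feedback d U s‖ ^ 2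
        ≤ c * (‖Q.B‖ * (R * Real.exp (β * Q.tau))) ^ 2 * Real.exp (-β * t) := by
    intro t a ht ha hta hat
    have hX : Real.exp (-β * t) ≤ 1 := Real.exp_le_one_iff.mpr (by nlinarith)
    calc _ ≤ ∫ s in a..t, |Q.k (s + Q.tau)|
          * (‖Q.B‖ * (R * Real.exp (β * Q.tau) * Real.exp (-β * t))) ^ 2 := by
          refine intervalIntegral.integral_mono_on hat (hint a t ha hat)
            ((intervalIntegrable_k_shift hk (by linarith) (by linarith)).mul_const _)
            fun s hs => ?_
          refine mul_le_mul_of_nonneg_left ?_ (abs_nonneg _)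
          refine pow_le_pow_left₀ (norm_nonneg _) ?_ 2
          have hs0 : 0 ≤ s := ha.trans hs.1
          refine (Q.norm_feedback_le d U hs0).trans
            (mul_le_mul_of_nonneg_left ?_ (norm_nonneg _))
          refine ((Q.norm_snd_le_stateNorm hmu _).trans (hUR s hs0)).trans ?_
          rw [mul_assoc, ← Real.exp_add]
          refine mul_le_mul_of_nonneg_left (Real.exp_le_exp.mpr ?_) hR
          nlinarith [hs.1]
      _ = (∫ s in a..t, |Q.k (s + Q.tau)|)
          * (‖Q.B‖ * (R * Real.exp (β * Q.tau) * Real.exp (-β * t))) ^ 2 :=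
          intervalIntegral.integral_mul_const _ _
      _ ≤ c * (‖Q.B‖ * (R * Real.exp (β * Q.tau) * Real.exp (-β * t))) ^ 2 :=
          mul_le_mul_of_nonneg_right (integral_abs_k_shift_le hk hc htau ht hta)
            (sq_nonneg _)
      _ = c * (‖Q.B‖ * (R * Real.exp (β * Q.tau))) ^ 2
          * (Real.exp (-β * t) * Real.exp (-β * t)) := by ring
      _ ≤ c * (‖Q.B‖ * (R * Real.exp (β * Q.tau))) ^ 2 * (Real.exp (-β * t) * 1) := by
          gcongr
      _ = _ := by rw [mul_one]
  refine ⟨A * Real.exp (β * Q.tau) + c * (‖Q.B‖ * (R * Real.exp (β * Q.tau))) ^ 2,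
    fun t ht => ?_⟩
  rw [add_mul]
  rcases le_or_gt Q.tau t with h | h
  · refine (hlate t (t - Q.tau) ht (by linarith) le_rfl (by linarith)).trans ?_
    exact le_add_of_nonneg_left (by positivity)
  · have hcg : EqOn (fun s => |Q.k (s + Q.tau)| * ‖d.g s‖ ^ 2)
        (fun s => |Q.k (s + Q.tau)| * ‖Q.feedback d U s‖ ^ 2) (uIoo (t - Q.tau) 0) := by
      intro s hs
      rw [uIoo_of_le (by linarith)] at hs
      simp only [feedback, if_pos hs.2]
    have hmem : t - Q.tau ∈ uIcc (-Q.tau) 0 := by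
      rw [uIcc_of_le (by linarith)]; exact ⟨by linarith, by linarith⟩
    have hgi' := hgi.mono_set (uIcc_subset_uIcc hmem right_mem_uIcc)
    rw [← intervalIntegral.integral_add_adjacent_intervals (hgi'.congr_uIoo hcg) (hint 0 t le_rfl ht),
      ← intervalIntegral.integral_congr_uIoo hcg]
    refine add_le_add ?_ (hlate t 0 ht le_rfl (by linarith) ht)
    have h1 := intervalIntegral.integral_add_adjacent_intervals
      (hgi.mono_set (uIcc_subset_uIcc left_mem_uIcc hmem)) hgi'
    have h2 : 0 ≤ ∫ s in (-Q.tau)..(t - Q.tau), |Q.k (s + Q.tau)| * ‖d.g s‖ ^ 2 :=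
      intervalIntegral.integral_nonneg (by linarith) fun s _ => by positivity
    have h3 : ∫ s in (t - Q.tau)..0, |Q.k (s + Q.tau)| * ‖d.g s‖ ^ 2 ≤ A := by linarith
    refine h3.trans ?_
    rw [mul_assoc, ← Real.exp_add]
    -- The datum `g` is seen only for `t < τ`, where `e^{βτ} e^{-βt} ≥ 1`.
    refine le_mul_of_one_le_right hA0 (Real.one_le_exp ?_)
    nlinarith

/-- Exponential decay of the energy of an exponentially decaying trajectory. -/
theorem energy_le (hmu : IsMemoryKernel Q.mu) (hk : LocallyIntegrableOn Q.k (Ici 0))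
    (htau : 0 < Q.tau) {c : ℝ}
    (hc : ∀ t : ℝ, 0 < t → (∫ s in (max (t - Q.tau) 0)..t, |Q.k s|) < c)
    {h : ℝ → ℝ} (hmono : StrictMonoOn h (Ici 0)) (h0 : h 0 = 0)
    (hle : ∀ u, ‖Q.pot.gradient u‖ ≤ h ‖P.sqrt u‖ * ‖P.sqrt u‖) (hpsi : Q.pot.psi 0 = 0)
    (d : Q.InitialData) {U : ℝ → Q.State} (hU : Continuous U) {r R β : ℝ} (hr : 0 ≤ r)
    (hR : 0 ≤ R) (hβ : 0 < β) (hUr : ∀ t, 0 ≤ t → ‖(U t).1‖ ≤ r)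
    (hUR : ∀ t, 0 ≤ t → Q.stateNorm (U t) ≤ R * Real.exp (-β * t)) :
    ∃ C, ∀ t, 0 ≤ t → Q.energy d U t ≤ C * Real.exp (-β * t) := by
  have hκ : 0 < 1 - Q.mass := sub_pos.mpr hmu.mass_lt_one
  obtain ⟨J, hJ⟩ := integral_feedback_le hmu hk htau hc d hU hR hβ hUR
  have hh : 0 ≤ h r := h0 ▸ hmono.monotoneOn self_mem_Ici hr hr
  obtain ⟨b, hb⟩ : ∃ b, b = h r * Real.sqrt ‖P.inv‖ / (1 - Q.mass) := ⟨_, rfl⟩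
  have hb0 : 0 ≤ b := by rw [hb]; positivity
  refine ⟨(1 / 2 + b) * R ^ 2 + 1 / 2 * J, fun t ht => ?_⟩
  have hX : Real.exp (-β * t) ≤ 1 := Real.exp_le_one_iff.mpr (by nlinarith)
  have h1 : Q.stateNorm (U t) ^ 2 ≤ R ^ 2 * Real.exp (-β * t) := by
    calc _ ≤ (R * Real.exp (-β * t)) ^ 2 := pow_le_pow_left₀ (Q.stateNorm_nonneg _) (hUR t ht) 2
      _ = R ^ 2 * (Real.exp (-β * t) * Real.exp (-β * t)) := by ring
      _ ≤ R ^ 2 * (Real.exp (-β * t) * 1) := by gcongr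
      _ = _ := by rw [mul_one]
  have h2 : |Q.pot.psi (U t).1| ≤ b * Q.stateNorm (U t) ^ 2 := by
    refine (Potential.abs_psi_le hmono h0 hle hpsi hr (hUr t ht)).trans ?_
    have h3 : (1 - Q.mass) * ‖(U t).1‖ ^ 2 ≤ Q.stateNorm (U t) ^ 2 := by
      have := pow_le_pow_left₀ (by positivity) (Q.norm_fst_le_stateNorm hmu (U t)) 2
      rwa [mul_pow, Real.sq_sqrt hκ.le] at this
    calc _ = b * ((1 - Q.mass) * ‖(U t).1‖ ^ 2) := by rw [hb]; field_simp
      _ ≤ _ := mul_le_mul_of_nonneg_left h3 hb0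
  have h4 := stateNorm_sq hmu (U t)
  have h5 := hJ t ht
  have h6 := mul_le_mul_of_nonneg_left h1 (by linarith : 0 ≤ 1 / 2 + b)
  have h7 := neg_abs_le (Q.pot.psi (U t).1)
  rw [energy]
  linarith

/-- Small data give global solutions which decay exponentially. -/
theorem exists_decaying_solution (hmu : IsMemoryKernel Q.mu)
    (hk : LocallyIntegrableOn Q.k (Ici 0)) (htau : 0 < Q.tau) {c : ℝ}
    (hc : (∫ s in (0 : ℝ)..Q.tau, |Q.k s|) ≤ c) (hpsi : Q.pot.LipschitzOnBounded)
    {h : ℝ → ℝ} (hmono : StrictMonoOn h (Ici 0)) (h0 : h 0 = 0)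
    (hle : ∀ u, ‖Q.pot.gradient u‖ ≤ h ‖P.sqrt u‖ * ‖P.sqrt u‖)
    {S : ℝ → Q.State →L[ℝ] Q.State} (hSc : Continuous fun p : ℝ × Q.State => S p.1 p.2)
    {M ω ω' γ r : ℝ} (hM : 0 < M) (hω : 0 < ω) (hS : Q.DecayBound S M ω)
    (hγ : ∀ t : ℝ, 0 ≤ t →
      ‖Q.B‖ ^ 2 * M * Real.exp (ω * Q.tau) * (∫ s in (0 : ℝ)..t, |Q.k (s + Q.tau)|)
        ≤ γ + ω' * t) (hω' : ω' < ω) (hr : 0 < r)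
    (hhr : M * (h r / Real.sqrt (1 - Q.mass)) ≤ (ω - ω') / 2) :
    ∃ σ > 0, ∀ d : Q.InitialData, d.size < σ ^ 2 → ∃ U : ℝ → Q.State, Continuous U ∧
      Q.IsMildSolution S d (Ici 0) U ∧ ∀ t, 0 ≤ t → Q.stateNorm (U t)
        ≤ Real.sqrt (1 - Q.mass) * r * Real.exp (-((ω - ω') / 2) * t) := by
  have hκ : 0 < Real.sqrt (1 - Q.mass) :=
    Real.sqrt_pos.mpr (sub_pos.mpr hmu.mass_lt_one)
  have hh : 0 ≤ h r := h0 ▸ hmono.monotoneOn self_mem_Ici hr.le hr.le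
  have hc0 : 0 ≤ c := (intervalIntegral.integral_nonneg htau.le fun s _ => abs_nonneg _).trans hc
  -- `a σ` is the amplitude that Grönwall's estimate yields for data of size below `σ²`. Choosing `a
  -- σ = √(1 - μ̃) r` keeps `u` in the ball of radius `r`.
  obtain ⟨a, ha⟩ : ∃ a, a = (M + M * Real.exp (ω * Q.tau) * ((c + 1) / 2)) * Real.exp γ :=
    ⟨_, rfl⟩
  have ha0 : 0 < a := by rw [ha]; positivity
  obtain ⟨σ, hσ⟩ : ∃ σ, σ = Real.sqrt (1 - Q.mass) * r / a := ⟨_, rfl⟩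
  have hσ0 : 0 < σ := by rw [hσ]; positivity
  have hσa : a * σ = Real.sqrt (1 - Q.mass) * r := by rw [hσ]; field_simp
  refine ⟨σ, hσ0, fun d hd => ?_⟩
  obtain ⟨K, hK⟩ := hS.exists_opNorm_le hmu hM hω
  obtain ⟨L, hL0, hL⟩ := hpsi r hr
  have hGlip := Potential.norm_truncGradient_sub_le hr hL0.le hL
  have hGc : Continuous (Q.pot.truncGradient r) := by
    refine (LipschitzWith.of_dist_le_mul (K := ⟨2 * L, by positivity⟩) fun u v => ?_).continuous
    rw [dist_eq_norm, dist_eq_norm]; exact hGlip u v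
  obtain ⟨U, hUc, hU⟩ := exists_duhamel htau hk hSc hK (by positivity) hGlip d
  obtain ⟨hd1, hd2⟩ := InitialData.bounds hmu hk htau hc hσ0 hd
  -- The truncated gradient obeys its smallness bound everywhere, so the decay holds for all times
  -- without knowing beforehand that `u` stays in the ball.
  have hdec : ∀ t, 0 ≤ t → Q.stateNorm (U t)
      ≤ Real.sqrt (1 - Q.mass) * r * Real.exp (-((ω - ω') / 2) * t) := by
    intro T hT
    have hdi := intervalIntegrable_delayTerm hk htau d hT hUc.continuousOn
    have hest := stateNorm_le_of_duhamel hmu hk htau hSc hM hω hS (V := U) (x0 := d.state)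
      (D := fun s => ‖Q.delayTerm d U s‖)
      (F := fun s => -(Q.delayTerm d U s) + Q.pot.truncGradient r (U s).1)
      (ε := h r / Real.sqrt (1 - Q.mass)) (D0 := σ * ((c + 1) / 2)) hT (by positivity)
      hUc.continuousOn
      (hdi.neg.add (hGc.comp (continuous_fst.comp hUc)).continuousOn.intervalIntegrable)
      (fun t ht => hU t ht.1) hdi.norm (fun s _ => norm_nonneg _) (fun s hs => ?_)
      (fun s hs => ?_) (fun t ht htτ => hd2 U t ⟨ht.1, htτ⟩)
    · have hki := intervalIntegrable_k_shift hk (Q := Q) (a := 0) (b := T) (by linarith)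
        (by linarith)
      rw [intervalIntegral.integral_add ((hki.const_mul _).const_mul _) intervalIntegrable_const,
        intervalIntegral.integral_const_mul, intervalIntegral.integral_const_mul,
        intervalIntegral.integral_const, sub_zero, smul_eq_mul] at hest
      have h1 := hγ T hT
      have h2 := mul_le_mul_of_nonneg_left hhr hT
      -- Balance of rates: `-ω` from the semigroup, `+ω'` from the delay and `+(ω - ω')/2` from the
      -- nonlinearity leave `-(ω - ω')/2`.
      have h3 : -ω * T + (M * Real.exp (ω * Q.tau) * (‖Q.B‖ ^ 2
          * ∫ s in (0 : ℝ)..T, |Q.k (s + Q.tau)|) + T * (M * (h r / Real.sqrt (1 - Q.mass))))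
          ≤ γ + -((ω - ω') / 2) * T := by
        linarith
      refine hest.trans ?_
      calc _ ≤ (M * σ + M * Real.exp (ω * Q.tau) * (σ * ((c + 1) / 2)))
            * Real.exp (γ + -((ω - ω') / 2) * T) := by
            refine mul_le_mul (add_le_add (mul_le_mul_of_nonneg_left hd1 hM.le) le_rfl)
              (Real.exp_le_exp.mpr h3) (Real.exp_pos _).le (by positivity)
        _ = a * σ * Real.exp (-((ω - ω') / 2) * T) := by
            rw [Real.exp_add, ha]; ring
        _ = _ := by rw [hσa]
    · have h1 := Potential.norm_truncGradient_le hmono h0 hle hr (U s).1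
      have h2 : h r * ‖(U s).1‖ ≤ h r / Real.sqrt (1 - Q.mass) * Q.stateNorm (U s) := by
        rw [div_mul_eq_mul_div, le_div_iff₀ hκ, mul_assoc, mul_comm ‖_‖]
        exact mul_le_mul_of_nonneg_left (Q.norm_fst_le_stateNorm hmu (U s)) hh
      refine (norm_add_le _ _).trans ?_
      rw [norm_neg]
      linarith
    · rw [delayTerm, norm_smul, Real.norm_eq_abs]
      have h1 : ‖Q.B (Q.feedback d U (s - Q.tau))‖
          ≤ ‖Q.B‖ * (‖Q.B‖ * Q.stateNorm (U (s - Q.tau))) := by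
        refine Q.B.le_opNorm_of_le ((Q.norm_feedback_le d U (by linarith [hs.1])).trans ?_)
        exact mul_le_mul_of_nonneg_left (Q.norm_snd_le_stateNorm hmu _) (norm_nonneg _)
      exact (mul_le_mul_of_nonneg_left h1 (abs_nonneg _)).trans_eq (by ring)
  refine ⟨U, hUc, ⟨hUc.continuousOn, fun t ht => ?_⟩, hdec⟩
  rw [hU t ht]
  congr 1
  refine intervalIntegral.integral_congr fun s hs => ?_
  rw [uIcc_of_le ht] at hs
  -- The decay bound keeps `u` in the ball of radius `r`, so the truncation is inactive and `U`
  -- solves the original problem.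
  have h1 : ‖(U s).1‖ ≤ r := by
    have h2 : Real.exp (-((ω - ω') / 2) * s) ≤ 1 :=
      Real.exp_le_one_iff.mpr (by nlinarith [hs.1])
    refine le_of_mul_le_mul_left ?_ hκ
    exact ((Q.norm_fst_le_stateNorm hmu (U s)).trans (hdec s hs.1)).trans
      (mul_le_of_le_one_right (by positivity) h2)
  simp only [velocity_apply, Q.pot.truncGradient_of_norm_le hr h1]
  rfl

end DelaySystem

end ViscoDelay

end

theorem mainTheorem3 {H : Type*} [NormedAddCommGroup H] [InnerProductSpace ℝ H] [CompleteSpace H]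
    (P : ViscoDelay.PositiveOperator H) (Q : ViscoDelay.DelaySystem P)
    (htau : 0 < Q.tau)
    (hmu : ViscoDelay.IsMemoryKernel Q.mu)
    (hk : LocallyIntegrableOn Q.k (Ici 0))
    (hkC : ∃ Cstar : ℝ, ∀ t : ℝ, 0 < t → (∫ s in (max (t - Q.tau) 0)..t, |Q.k s|) < Cstar)
    (hpsi : Q.pot.LipschitzOnBounded)
    (hpsi0 : Q.pot.SuperlinearAtZero) :
    ∃ S : ℝ → Q.State →L[ℝ] Q.State, Q.IsSemigroup S ∧
      (∃ M ω : ℝ, 0 < M ∧ 0 < ω ∧ Q.DecayBound S M ω) ∧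
      ∀ M ω ω' γ : ℝ, 0 < M → 0 < ω → Q.DecayBound S M ω → 0 ≤ ω' → ω' < ω →
        (∀ t : ℝ, 0 ≤ t →
          ‖Q.B‖ ^ 2 * M * Real.exp (ω * Q.tau) * (∫ s in (0 : ℝ)..t, |Q.k (s + Q.tau)|)
            ≤ γ + ω' * t) →
        ∃ δ > 0, ∃ β > 0, ∀ d : Q.InitialData, d.size < δ →
          ∃ U : ℝ → Q.State, Q.IsMildSolution S d (Ici 0) U ∧
            (∀ T : ℝ, 0 < T → ∀ W : ℝ → Q.State, Q.IsMildSolution S d (Ico 0 T) W →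
              EqOn W U (Ico 0 T)) ∧
            ∃ C : ℝ, ∀ t : ℝ, 0 ≤ t → Q.energy d U t ≤ C * Real.exp (-β * t) := by
  obtain ⟨S, hS, hSc, hdec⟩ := Q.exists_semigroup hmu
  refine ⟨S, hS, hdec, ?_⟩
  intro M ω ω' γ hM hω hSd _ hω' hγ
  obtain ⟨c, hc⟩ := hkC
  obtain ⟨hp0, -, h, hmono, hcont, h0, hle⟩ := hpsi0
  have hκ : 0 < Real.sqrt (1 - Q.mass) := Real.sqrt_pos.mpr (sub_pos.mpr hmu.mass_lt_one)
  -- Continuity of `h` at `0` with `h 0 = 0` provides the radius at which the nonlinearity consumes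
  -- at most half of the spare rate.
  obtain ⟨r, hr, hhr⟩ : ∃ r, 0 < r ∧ M * (h r / Real.sqrt (1 - Q.mass)) ≤ (ω - ω') / 2 := by
    have h1 : Filter.Tendsto (fun r => M * (h r / Real.sqrt (1 - Q.mass))) (𝓝[>] 0) (𝓝 0) := by
      have h2 := ((hcont 0 self_mem_Ici).mono Ioi_subset_Ici_self).tendsto
      rw [h0] at h2
      simpa using (h2.div_const (Real.sqrt (1 - Q.mass))).const_mul M
    obtain ⟨r, hr1, hr2⟩ := ((h1.eventually_lt_const
      (by linarith : (0 : ℝ) < (ω - ω') / 2)).and self_mem_nhdsWithin).exists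
    exact ⟨r, hr2, hr1.le⟩
  have hcτ : (∫ s in (0 : ℝ)..Q.tau, |Q.k s|) ≤ c := by
    have := hc Q.tau htau
    rw [sub_self, max_self] at this
    exact this.le
  obtain ⟨σ, hσ, hsol⟩ := ViscoDelay.DelaySystem.exists_decaying_solution hmu hk htau hcτ hpsi
    hmono h0 hle hSc hM hω hSd hγ hω' hr hhr
  refine ⟨σ ^ 2, by positivity, (ω - ω') / 2, by linarith, fun d hd => ?_⟩
  obtain ⟨U, hUc, hU, hUR⟩ := hsol d hd
  refine ⟨U, hU, fun T _ W hW t ht => ?_, ?_⟩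
  -- Uniqueness is applied on the compact interval `[0, t]`, on which both solutions are bounded.
  · exact ViscoDelay.DelaySystem.eq_of_duhamel hmu hk htau hpsi hSc hM hω hSd d ht.1
      ⟨hUc.continuousOn, fun s hs => hU.2 s hs.1⟩
      ⟨hW.1.mono fun s hs => ⟨hs.1, hs.2.trans_lt ht.2⟩,
        fun s hs => hW.2 s ⟨hs.1, hs.2.trans_lt ht.2⟩⟩
  · refine ViscoDelay.DelaySystem.energy_le hmu hk htau hc hmono h0 hle hp0 d hUc hr.le
      (by positivity) (by linarith) (fun t ht => ?_) hUR
    have h2 : Real.exp (-((ω - ω') / 2) * t) ≤ 1 :=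
      Real.exp_le_one_iff.mpr (by nlinarith)
    refine le_of_mul_le_mul_left ?_ hκ
    exact ((Q.norm_fst_le_stateNorm hmu (U t)).trans (hUR t ht)).trans
      (mul_le_of_le_one_right (by positivity) h2)
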